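/- Let $X=(X_t)_{t\ge0}$ be a real-valued Lévy process (with $X_0=0$ a.s. and almost surely càdlàg paths) with generating triplet $(\sigma^2,\nu,b)$ for the cutoff function $x\mapsto 1_{|x|<1}$, i.e. $\nu(\{0\})=0$, $\int_{\mathbb R}\min\{1,x^2\}\,\nu(dx)<\infty$ and $$\mathbb E\big[e^{iuX_t}\big]=\exp\Big(t\Big(iub-\tfrac{\sigma^2u^2}{2}+\int_{\mathbb R}\big(e^{iux}-1-iux1_{|x|<1}\big)\nu(dx)\Big)\Big),\qquad u\in\mathbb R,\ t\ge0.$$ Let $\overline X_t=\sup_{s\in[0,t]}X_s$ and $x^+=\max\{x,0\}$. For $p\ge0$ put $$I_0^p=\int_{(-1,1)}|x|^p\nu(dx),\qquad I_+^p=\int_{[1,\infty)}x^p\nu(dx),$$ and let $\beta=\inf\{p>0: I_0^p<\infty\}\in[0,2]$ be the Blumenthal–Getoor index. If $I_0^1<\infty$, put $b_0=b-\int_{(-1,1)}x\,\nu(dx)$. If $I_0^\beta=\infty$ (so that $\beta<2$), fix any $\delta\in(0,2-\beta)$, with $\beta+\delta<1$ in case $\beta<1$. Put $\beta_+=\beta+\delta\cdot1_{I_0^\beta=\infty}\in[\beta,2]$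 and $I'=\int_{(0,1)}x^{\beta_+}\nu(dx)$. Fix $T>0$ and let $t\in[0,T]$. (a) For every $p>0$ with $I_+^p<\infty$, the random variable $\overline X_t^{\,p}$ is integrable and $$\mathbb E\big[\overline X_t^{\,p}\big]\le 4^{(p-1)^+}\Big(C_{p,1}t^{p/\beta_+}+C_{p,2}t^{p/2}+C_{p,3}t^p+C_{p,4}t^{\min\{1,p/\beta_+\}}\Big),$$ where $$C_{p,1}=2^{(p-1)^+}T^{p-p/\beta_+}\big(I_0^{\beta_+}\big)^p+T^{-p/\beta_+}\Big(2^pT^{p/2}\big(I_0^{\beta_+}\big)^{p/2}1_{p\le2}+2\Big(\frac{p^2}{p-1}\Big)^p e^{TI_0^{\beta_+}-p}\,1_{p>2}\Big),$$ $$C_{p,2}=|\sigma|^p\,\Gamma\Big(\frac{p+1}2\Big)\frac{2^{p/2}}{\sqrt\pi},\qquad C_{p,3}=2^{(p-1)^+}\big(b^+1_{I_0^1=\infty}+b_0^+1_{I_0^1<\infty}\big)^p,$$ $$C_{p,4}=T^{(1-p/\beta_+)^+}\big(I_+^p+I'\big)\sum_{k=1}^{\lceil p\rceil}{\lceil p\rceil\brace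 k}T^{k-1}\big(I'+\nu([1,\infty))\big)^{k-1},$$ and ${m\brace k}$ are the Stirling numbers of the second kind. If $\beta_+=0$ (i.e. $\nu((-1,1))<\infty$), this is read with $p/\beta_+=\infty$: the summand $C_{p,1}t^{p/\beta_+}$ is $0$, $\min\{1,p/\beta_+\}=1$ and $(1-p/\beta_+)^+=0$. (b) If $I_+^1<\infty$, then $\overline X_t$ is integrable and $$\mathbb E\big[\overline X_t\big]\le|\sigma|\sqrt{\tfrac2\pi}\,\sqrt t+\begin{cases}(b^++I_+^1)t+2\sqrt{I_0^2}\,\sqrt t,&\beta_+=2,\\ (b^++I_+^1)t+2T^{-1/\beta_+}\Big(\sqrt{TI_0^{\beta_+}}+TI_0^{\beta_+}\Big)t^{1/\beta_+},&\beta_+\in(1,2),\\ \big(b_0^++\int_{(0,\infty)}x\,\nu(dx)\big)t,&\beta_+\le1.\end{cases}$$ -/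

import Mathlib

open MeasureTheory ProbabilityTheory
open scoped NNReal ENNReal

noncomputable section

namespace LevySup

/-- A real-valued Lévy process: started at `0`, with independent and stationary increments and
almost surely right-continuous paths with left limits (these properties imply stochastic
continuity). At `t = 0` the filter of left neighbourhoods is trivial, so the requirement on the
left limit is void there. -/
structure IsLevyProcess {Ω : Type*} [MeasurableSpace Ω] (X : ℝ≥0 → Ω → ℝ) (P : Measure Ω) :
    Prop where
  measurable : ∀ t, Measurable (X t)
  zero : ∀ᵐ ω ∂P, X 0 ω = 0
  indep : HasIndepIncrements X P
  stationary : ∀ s t : ℝ≥0,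
    IdentDistrib (fun ω => X (s + t) ω - X s ω) (fun ω => X t ω - X 0 ω) P P
  cadlag : ∀ᵐ ω ∂P, ∀ t : ℝ≥0,
    ContinuousWithinAt (fun s => X s ω) (Set.Ici t) t ∧
      ∃ l : ℝ, Filter.Tendsto (fun s => X s ω) (nhdsWithin t (Set.Iio t)) (nhds l)

/-- A Lévy measure on `ℝ`. -/
structure IsLevyMeasure (ν : Measure ℝ) : Prop where
  zero : ν {0} = 0
  lintegral_lt_top : ∫⁻ x, ENNReal.ofReal (min 1 (x ^ 2)) ∂ν < ∞

/-- The Lévy–Khintchine exponent of the triplet `(σ², ν, b)` for the cutoff function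
`x ↦ 1_{|x| < 1}`. -/
def levyExponent (σ : ℝ) (ν : Measure ℝ) (b u : ℝ) : ℂ :=
  Complex.I * b * u - σ ^ 2 * u ^ 2 / 2 +
    ∫ x : ℝ, (Complex.exp (Complex.I * u * x) - 1 -
      (if |x| < 1 then Complex.I * u * x else 0)) ∂ν

/-- `(σ², ν, b)` is the generating triplet of `X` for the cutoff function `x ↦ 1_{|x| < 1}`. -/
structure HasTriplet {Ω : Type*} [MeasurableSpace Ω] (X : ℝ≥0 → Ω → ℝ) (P : Measure Ω)
    (σ : ℝ) (ν : Measure ℝ) (b : ℝ) : Prop where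
  isLevyMeasure : IsLevyMeasure ν
  charFun_eq : ∀ (t : ℝ≥0) (u : ℝ),
    charFun (P.map (X t)) u = Complex.exp (((t : ℝ) : ℂ) * levyExponent σ ν b u)

/-- The running supremum of `X` over `[0, t]`. -/
def runSup {Ω : Type*} (X : ℝ≥0 → Ω → ℝ) (t : ℝ≥0) (ω : Ω) : ℝ :=
  ⨆ s : Set.Icc (0 : ℝ≥0) t, X s ω

/-- `∫_A |x|^p ν(dx)`, possibly infinite. -/
def absMoment (ν : Measure ℝ) (A : Set ℝ) (p : ℝ) : ℝ≥0∞ :=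
  ∫⁻ x in A, ENNReal.ofReal (|x| ^ p) ∂ν

/-- `I_0^p = ∫_{(-1,1)} |x|^p ν(dx)`. -/
def I0 (ν : Measure ℝ) (p : ℝ) : ℝ≥0∞ := absMoment ν (Set.Ioo (-1) 1) p

/-- `I_+^p = ∫_{[1,∞)} x^p ν(dx)`. -/
def Iplus (ν : Measure ℝ) (p : ℝ) : ℝ≥0∞ := absMoment ν (Set.Ici 1) p

/-- The Blumenthal–Getoor index `β`. -/
def bgIndex (ν : Measure ℝ) : ℝ := sInf {p : ℝ | 0 < p ∧ I0 ν p < ∞}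

open Classical in
/-- `β_+ = β + δ · 1_{I_0^β = ∞}`. -/
def bgIndexPlus (ν : Measure ℝ) (δ : ℝ) : ℝ :=
  bgIndex ν + if I0 ν (bgIndex ν) = ∞ then δ else 0

/-- The natural drift `b_0 = b - ∫_{(-1,1)} x ν(dx)` (used only if `I_0^1 < ∞`). -/
def natDrift (ν : Measure ℝ) (b : ℝ) : ℝ := b - ∫ x in Set.Ioo (-1 : ℝ) 1, x ∂ν

/-- `min {1, p / β}`, where `p / 0 = ∞`. -/
def minOneDiv (p β : ℝ) : ℝ := if β = 0 then 1 else min 1 (p / β)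

/-- `(1 - p / β)^+`, where `p / 0 = ∞`. -/
def oneSubDivPos (p β : ℝ) : ℝ := if β = 0 then 0 else max (1 - p / β) 0

/-- `C_{p,1}`, with `β` in the role of `β_+` (used only if `β ≠ 0`). -/
def C₁ (ν : Measure ℝ) (T β p : ℝ) : ℝ :=
  2 ^ max (p - 1) 0 * T ^ (p - p / β) * (I0 ν β).toReal ^ p +
    T ^ (-(p / β)) *
      (if p ≤ 2 then 2 ^ p * T ^ (p / 2) * (I0 ν β).toReal ^ (p / 2)
        else 2 * (p ^ 2 / (p - 1)) ^ p * Real.exp (T * (I0 ν β).toReal - p))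

/-- `C_{p,2}`. -/
def C₂ (σ p : ℝ) : ℝ :=
  |σ| ^ p * Real.Gamma ((p + 1) / 2) * (2 ^ (p / 2) / √Real.pi)

open Classical in
/-- `C_{p,3}`. -/
def C₃ (ν : Measure ℝ) (b p : ℝ) : ℝ :=
  2 ^ max (p - 1) 0 * (if I0 ν 1 = ∞ then max b 0 else max (natDrift ν b) 0) ^ p

/-- `I' = ∫_{(0,1)} x^β ν(dx)`, with `β` in the role of `β_+`. -/
def Iprime (ν : Measure ℝ) (β : ℝ) : ℝ := (absMoment ν (Set.Ioo 0 1) β).toReal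

/-- `C_{p,4}`, with `β` in the role of `β_+`. -/
def C₄ (ν : Measure ℝ) (T β p : ℝ) : ℝ :=
  T ^ oneSubDivPos p β * ((Iplus ν p).toReal + Iprime ν β) *
    ∑ k ∈ Finset.Icc 1 ⌈p⌉₊, (Nat.stirlingSecond ⌈p⌉₊ k : ℝ) * T ^ (k - 1) *
      (Iprime ν β + (ν (Set.Ici 1)).toReal) ^ (k - 1)

/-- The bound `m_X^p(t)` on the `p`-th moment of the running supremum, with `β` in the role of
`β_+`. For `β = 0` the exponent `p / β` is infinite, and the term in `t^{p/β}` is absent. -/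
def momentBound (σ : ℝ) (ν : Measure ℝ) (b T β p t : ℝ) : ℝ :=
  4 ^ max (p - 1) 0 *
    ((if β = 0 then 0 else C₁ ν T β p * t ^ (p / β)) + C₂ σ p * t ^ (p / 2) +
      C₃ ν b p * t ^ p + C₄ ν T β p * t ^ minOneDiv p β)

/-- The sharper bound on the mean of the running supremum, with `β` in the role of `β_+`. -/
def meanBound (σ : ℝ) (ν : Measure ℝ) (b T β t : ℝ) : ℝ :=
  |σ| * √(2 / Real.pi) * √t +
    if β = 2 then
      (max b 0 + (Iplus ν 1).toReal) * t + 2 * √(I0 ν 2).toReal * √t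
    else if 1 < β then
      (max b 0 + (Iplus ν 1).toReal) * t +
        2 * T ^ (-(1 / β)) * (√(T * (I0 ν β).toReal) + T * (I0 ν β).toReal) * t ^ (1 / β)
    else
      (max (natDrift ν b) 0 + (absMoment ν (Set.Ioi 0) 1).toReal) * t

end LevySup

end

/-!
The bounds come from one estimate for random walks, which passes to the process in the limit.

**The walk.** Let the steps of a walk be the sum of a constant, a centred Gaussian variable and a
jump. Fix a level `h ≤ 1` and split the positive part of the maximum over `N` steps into four parts
(`lintegral_maxUpTo_walk_rpow_le`): the drift increased by the mean of the jumps smaller than `h`,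
the centred jumps smaller than `h`, the Gaussian part, and the positive jumps that are at least `h`;
the negative ones are discarded. The factor `4 ^ (p - 1)⁺` is the price of taking `p`-th powers.
The Gaussian part is treated by Lévy's inequality (`lintegral_maxUpTo_gaussian_rpow_le`), which
turns the maximum into twice a positive part, that is, into an absolute value. The centred small
jumps are treated by Doob's inequality (`lintegral_maxUpTo_centred_rpow_le`), together with the
variance if `p ≤ 2` and with exponential moments at `±1 / h` if `p > 2`. The large jumps are nonzero
only at a binomial number of times, and expanding powers of this number in factorial moments
produces the Stirling numbers (`lintegral_sum_rpow_le`). Lévy's and Doob's inequalities are two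
cases of `measure_entry_le_setLIntegral`.

**The process.** On a grid, the increments of the process are independent and identically
distributed. Each is the weak limit of sums of `m r` independent steps as above, whose jumps are
those of the Lévy measure of size at least `1 / (r + 1)`; this is the convergence of characteristic
functions in `tendsto_charFun_stepLaw_pow`. As the maximum over the grid is a continuous function of
finitely many increments, the portmanteau theorem transfers the estimate to it
(`lintegral_maxUpTo_le_liminf`, `lintegral_maxUpTo_grid_rpow_le`). Neither the Lévy–Itô
decomposition nor stochastic integration is needed. Finally the grid is refined: by right-continuity
the maxima converge to the running supremum, and Fatou's lemma gives `lintegral_runSup_rpow_le`.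

**The constants.** The level `h = (t / T) ^ (1 / β₊)` turns the moments of the Lévy measure over
`(-h, h)` and `[h, 1)` into powers of `t` times `I_0^{β₊}` and `I'`. For `β₊ = 0` no jump is small,
and `h = 0`. For the mean, the level is `1` if `β₊ = 2` and `0` if `β₊ ≤ 1`.
-/

namespace LevySup

open Filter Topology

/-! ### Maxima of partial sums and the first entry inequality -/

section PartialSums

variable {Ω : Type*}

/-- The partial sums `∑_{i < k} ξ i` of a sequence of random variables. -/
def partialSum (ξ : ℕ → Ω → ℝ) (k : ℕ) (ω : Ω) : ℝ := ∑ i ∈ Finset.range k, ξ i ω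

/-- The maximum of `S 0, …, S N`. -/
def maxUpTo (S : ℕ → Ω → ℝ) (N : ℕ) (ω : Ω) : ℝ :=
  (Finset.range (N + 1)).sup' Finset.nonempty_range_add_one fun k => S k ω

lemma le_maxUpTo {S : ℕ → Ω → ℝ} {N k : ℕ} (hk : k ≤ N) (ω : Ω) : S k ω ≤ maxUpTo S N ω :=
  Finset.le_sup' (fun k => S k ω) (Finset.mem_range.2 (Nat.lt_succ_of_le hk))

lemma maxUpTo_le {S : ℕ → Ω → ℝ} {N : ℕ} {ω : Ω} {a : ℝ} (h : ∀ k ≤ N, S k ω ≤ a) :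
    maxUpTo S N ω ≤ a :=
  Finset.sup'_le _ _ fun k hk => h k (Nat.lt_succ_iff.1 (Finset.mem_range.1 hk))

lemma le_maxUpTo_iff {S : ℕ → Ω → ℝ} {N : ℕ} {ω : Ω} {a : ℝ} :
    a ≤ maxUpTo S N ω ↔ ∃ k ≤ N, a ≤ S k ω := by
  simp [maxUpTo, Finset.le_sup'_iff]

end PartialSums

section FirstEntry

variable {Ω : Type*} [MeasurableSpace Ω] {P : Measure Ω} {ξ : ℕ → Ω → ℝ}

lemma measurable_partialSum (hξ : ∀ i, Measurable (ξ i)) (k : ℕ) : Measurable (partialSum ξ k) :=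
  Finset.measurable_fun_sum _ fun i _ => hξ i

lemma measurable_maxUpTo {S : ℕ → Ω → ℝ} (hS : ∀ k, Measurable (S k)) (N : ℕ) :
    Measurable (maxUpTo S N) :=
  Finset.measurable_range_sup'' fun k _ => hS k

/-- The history of the partial sums up to time `k` is independent of the increments after `k`. -/
lemma indepFun_history_increment (hξ : ∀ i, Measurable (ξ i)) (hind : iIndepFun ξ P) {k N : ℕ}
    (hk : k ≤ N) :
    IndepFun (fun ω (j : Fin (k + 1)) => partialSum ξ j ω)
      (fun ω => partialSum ξ N ω - partialSum ξ k ω) P := by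
  have h := hind.indepFun_finset (Finset.range k) (Finset.Ico k N)
    (by
      rw [Finset.disjoint_left]
      intro a ha hb
      simp at ha hb
      omega) hξ
  have h2 := h.comp (φ := fun (w : Finset.range k → ℝ) (j : Fin (k + 1)) =>
      ∑ i : Finset.range k, if (i : ℕ) < j then w i else 0)
    (ψ := fun (w : Finset.Ico k N → ℝ) => ∑ i, w i) (by
      refine measurable_pi_lambda _ fun j => Finset.measurable_fun_sum _ fun i _ => ?_
      split_ifs
      · exact measurable_pi_apply i
      · exact measurable_const) (by fun_prop)
  convert h2 using 1
  · ext ω j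
    simp only [partialSum, Function.comp]
    rw [Finset.univ_eq_attach,
      Finset.sum_attach (Finset.range k) (fun i => if i < (j : ℕ) then ξ i ω else 0),
      ← Finset.sum_filter]
    refine Finset.sum_congr ?_ fun _ _ => rfl
    ext i
    simp only [Finset.mem_range, Finset.mem_filter]
    have := j.2
    omega
  · ext ω
    simp only [partialSum, Function.comp]
    rw [Finset.univ_eq_attach, Finset.sum_attach (Finset.Ico k N) (fun i => ξ i ω),
      Finset.sum_Ico_eq_sub _ hk]

/-- **First entry inequality**. If, from every point of `A` and every time `k ≤ N`, the walk has
`φ`-mean at least `1` at time `N`, then the event that the walk enters `A` by time `N` has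
probability at most the integral of `φ (S N)` over this event. Lévy's inequality for symmetric
walks and Doob's maximal inequality for centred walks are the cases `φ = 2 · 1_A` and
`φ = |·| / x`. -/
lemma measure_entry_le_setLIntegral [IsProbabilityMeasure P]
    (hξ : ∀ i, Measurable (ξ i)) (hind : iIndepFun ξ P)
    {A : Set ℝ} (hA : MeasurableSet A) {φ : ℝ → ℝ≥0∞} (hφ : Measurable φ) (N : ℕ)
    (h : ∀ k ≤ N, ∀ a ∈ A, 1 ≤ ∫⁻ ω, φ (a + (partialSum ξ N ω - partialSum ξ k ω)) ∂P) :
    P {ω | ∃ k ≤ N, partialSum ξ k ω ∈ A} ≤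
      ∫⁻ ω in {ω | ∃ k ≤ N, partialSum ξ k ω ∈ A}, φ (partialSum ξ N ω) ∂P := by
  -- `E k` is the event that the first entry into `A` takes place at time `k`
  let B : (k : ℕ) → Set (Fin (k + 1) → ℝ) := fun k =>
    {w | w (Fin.last k) ∈ A ∧ ∀ j : Fin (k + 1), j ≠ Fin.last k → w j ∉ A}
  let H : (k : ℕ) → Ω → (Fin (k + 1) → ℝ) := fun k ω j => partialSum ξ j ω
  let E : ℕ → Set Ω := fun k => H k ⁻¹' B k
  have hB : ∀ k, MeasurableSet (B k) := fun k => by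
    have : B k = {w | w (Fin.last k) ∈ A} ∩ ⋂ j : Fin (k + 1),
        {w | j ≠ Fin.last k → w j ∉ A} := by ext w; simp [B]
    rw [this]
    refine (measurable_pi_apply (X := fun _ : Fin (k + 1) => ℝ) (Fin.last k) hA).inter
      (MeasurableSet.iInter fun j => ?_)
    by_cases hj : j = Fin.last k
    · simp [hj]
    · simp only [ne_eq, hj, not_false_eq_true, forall_const]
      exact (measurable_pi_apply (X := fun _ : Fin (k + 1) => ℝ) j hA).compl
  have hH : ∀ k, Measurable (H k) := fun k =>
    measurable_pi_lambda _ fun j => measurable_partialSum hξ _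
  have hE : ∀ k, MeasurableSet (E k) := fun k => hH k (hB k)
  have memE : ∀ k ω, ω ∈ E k ↔ partialSum ξ k ω ∈ A ∧ ∀ j < k, partialSum ξ j ω ∉ A := by
    intro k ω
    simp only [E, B, H, Set.mem_preimage, Set.mem_ofPred_eq, Fin.val_last]
    refine and_congr_right fun _ => ⟨fun h j hj => ?_, fun h j hj => ?_⟩
    · exact h ⟨j, by omega⟩ (by simp [Fin.ext_iff]; omega)
    · exact h j (by have := j.2; simp [Fin.ext_iff] at hj; omega)
  have hU : {ω | ∃ k ≤ N, partialSum ξ k ω ∈ A} = ⋃ k ∈ Finset.range (N + 1), E k := by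
    ext ω
    simp only [Set.mem_ofPred_eq, Set.mem_iUnion, Finset.mem_range, memE, exists_prop]
    constructor
    · rintro ⟨k, hk, hkA⟩
      classical
      have hex : ∃ k, partialSum ξ k ω ∈ A := ⟨k, hkA⟩
      refine ⟨Nat.find hex, ?_, Nat.find_spec hex, fun j hj => Nat.find_min hex hj⟩
      have := Nat.find_min' hex hkA
      omega
    · rintro ⟨k, hk, hkA, -⟩
      exact ⟨k, by omega, hkA⟩
  have hdisj : Set.PairwiseDisjoint (↑(Finset.range (N + 1))) E := by
    intro i _ j _ hij
    rw [Function.onFun, Set.disjoint_left]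
    intro ω hi hj
    rw [memE] at hi hj
    rcases lt_or_gt_of_ne hij with h' | h'
    · exact hj.2 i h' hi.1
    · exact hi.2 j h' hj.1
  rw [hU, measure_biUnion_finset hdisj fun k _ => hE k,
    lintegral_biUnion_finset hdisj fun k _ => hE k]
  refine Finset.sum_le_sum fun k hk => ?_
  have hk : k ≤ N := by simpa [Nat.lt_succ_iff] using hk
  have hR : Measurable fun ω => partialSum ξ N ω - partialSum ξ k ω :=
    (measurable_partialSum hξ N).sub (measurable_partialSum hξ k)
  have hprod := (indepFun_iff_map_prod_eq_prod_map_map (hH k).aemeasurable hR.aemeasurable).1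
    (indepFun_history_increment hξ hind hk)
  have : IsProbabilityMeasure (P.map (H k)) := Measure.isProbabilityMeasure_map (hH k).aemeasurable
  have hF : Measurable fun x : (Fin (k + 1) → ℝ) × ℝ =>
      (B k).indicator (fun w => φ (w (Fin.last k) + x.2)) x.1 := by
    have : (fun x : (Fin (k + 1) → ℝ) × ℝ =>
      (B k).indicator (fun w => φ (w (Fin.last k) + x.2)) x.1) =
        (Prod.fst ⁻¹' B k).indicator fun x => φ (x.1 (Fin.last k) + x.2) := by
      ext x; simp only [Set.indicator]; rfl
    rw [this]
    exact (hφ.comp (by fun_prop)).indicator (measurable_fst (hB k))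
  calc P (E k) = ∫⁻ w, (B k).indicator 1 w ∂(P.map (H k)) := by
        rw [lintegral_indicator_one (hB k), Measure.map_apply (hH k) (hB k)]
    _ ≤ ∫⁻ w, ∫⁻ r, (B k).indicator (fun w => φ (w (Fin.last k) + r)) w
          ∂(P.map fun ω => partialSum ξ N ω - partialSum ξ k ω) ∂(P.map (H k)) := by
        refine lintegral_mono fun w => ?_
        by_cases hw : w ∈ B k
        · simp only [Set.indicator_of_mem hw, Pi.one_apply]
          rw [lintegral_map (f := fun r => φ (w (Fin.last k) + r)) (by fun_prop) hR]
          exact h k hk _ hw.1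
        · simp [Set.indicator_of_notMem hw]
    _ = ∫⁻ ω, (B k).indicator (fun w => φ (w (Fin.last k) +
          (partialSum ξ N ω - partialSum ξ k ω))) (H k ω) ∂P := by
        rw [← lintegral_prod _ hF.aemeasurable, ← hprod, lintegral_map hF ((hH k).prodMk hR)]
    _ = ∫⁻ ω in E k, φ (partialSum ξ N ω) ∂P := by
        rw [← lintegral_indicator (hE k)]
        refine lintegral_congr fun ω => ?_
        by_cases hω : ω ∈ E k
        · rw [Set.indicator_of_mem hω, Set.indicator_of_mem (show H k ω ∈ B k from hω)]
          simp [H]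
        · rw [Set.indicator_of_notMem hω, Set.indicator_of_notMem (show H k ω ∉ B k from hω)]

end FirstEntry

/-! ### Maximal inequalities of Lévy and Doob -/

section MaximalMoments

variable {Ω : Type*} [MeasurableSpace Ω] {P : Measure Ω} {ξ : ℕ → Ω → ℝ}

/-- The layer cake formula for the `p`-th moment of the positive part of `f`. -/
lemma lintegral_ofReal_rpow_eq (P : Measure Ω) {f : Ω → ℝ} (hf : Measurable f) {p : ℝ}
    (hp : 0 < p) :
    ∫⁻ ω, ENNReal.ofReal (f ω) ^ p ∂P = ENNReal.ofReal p *
      ∫⁻ t in Set.Ioi (0 : ℝ), P {ω | t ≤ f ω} * ENNReal.ofReal (t ^ (p - 1)) := by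
  have h := lintegral_rpow_eq_lintegral_meas_le_mul P (f := fun ω => max (f ω) 0)
    (Filter.Eventually.of_forall fun ω => le_max_right _ _)
    (hf.max measurable_const).aemeasurable hp
  rw [setLIntegral_congr_fun (g := fun t => P {ω | t ≤ f ω} * ENNReal.ofReal (t ^ (p - 1)))
    measurableSet_Ioi] at h
  · rw [← h]
    refine lintegral_congr fun ω => ?_
    rw [← ENNReal.ofReal_rpow_of_nonneg (le_max_right _ _) hp.le]
    congr 1
    rcases le_total (f ω) 0 with h0 | h0
    · rw [max_eq_right h0, ENNReal.ofReal_of_nonpos h0, ENNReal.ofReal_zero]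
    · rw [max_eq_left h0]
  · intro t ht
    have ht : 0 < t := ht
    simp [ht.not_ge]

/-- **Lévy's inequality** for moments: if the increments up to time `N` are nonnegative with
probability at least `1/2`, then the positive part of the maximum has at most twice the `p`-th
moment of the positive part of the final value. -/
lemma lintegral_maxUpTo_rpow_le_two_mul [IsProbabilityMeasure P]
    (hξ : ∀ i, Measurable (ξ i)) (hind : iIndepFun ξ P) (N : ℕ)
    (hsym : ∀ k ≤ N, 1 ≤ 2 * P {ω | 0 ≤ partialSum ξ N ω - partialSum ξ k ω})
    {p : ℝ} (hp : 0 < p) :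
    ∫⁻ ω, ENNReal.ofReal (maxUpTo (partialSum ξ) N ω) ^ p ∂P ≤
      2 * ∫⁻ ω, ENNReal.ofReal (partialSum ξ N ω) ^ p ∂P := by
  have hS := measurable_partialSum hξ
  rw [lintegral_ofReal_rpow_eq P (measurable_maxUpTo hS N) hp,
    lintegral_ofReal_rpow_eq P (hS N) hp, mul_left_comm]
  gcongr
  rw [← lintegral_const_mul' _ _ (by simp)]
  refine lintegral_mono fun x => ?_
  rw [← mul_assoc]
  gcongr
  have hA : MeasurableSet (Set.Ici x) := measurableSet_Ici
  have h := measure_entry_le_setLIntegral hξ hind hA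
    (φ := (Set.Ici x).indicator fun _ => 2) (measurable_const.indicator hA) N ?_
  · calc P {ω | x ≤ maxUpTo (partialSum ξ) N ω}
        = P {ω | ∃ k ≤ N, partialSum ξ k ω ∈ Set.Ici x} := by
          simp [le_maxUpTo_iff]
      _ ≤ _ := h
      _ ≤ ∫⁻ ω, (Set.Ici x).indicator (fun _ => 2) (partialSum ξ N ω) ∂P :=
          setLIntegral_le_lintegral _ _
      _ = 2 * P {ω | x ≤ partialSum ξ N ω} := by
          have : (fun ω => (Set.Ici x).indicator (fun _ => (2 : ℝ≥0∞)) (partialSum ξ N ω)) =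
            {ω | x ≤ partialSum ξ N ω}.indicator fun _ => 2 := by
            ext ω; simp [Set.indicator]
          rw [this, lintegral_indicator_const (measurableSet_le measurable_const (hS N))]
  · intro k hk a ha
    refine (hsym k hk).trans ?_
    have hms : MeasurableSet {ω | 0 ≤ partialSum ξ N ω - partialSum ξ k ω} :=
      measurableSet_le measurable_const ((hS N).sub (hS k))
    rw [← lintegral_indicator_const hms]
    refine lintegral_mono fun ω => Set.indicator_apply_le' (fun hω => ?_) fun _ => zero_le
    have ha : x ≤ a := ha
    have hω : 0 ≤ partialSum ξ N ω - partialSum ξ k ω := hω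
    rw [Set.indicator_of_mem (show _ ∈ Set.Ici x by simp only [Set.mem_Ici]; linarith)]

/-- The passage from a maximal inequality to an inequality for `p`-th moments, `p > 1`. -/
lemma lintegral_rpow_le_of_maximal_inequality {M f : Ω → ℝ} (hM : Measurable M)
    (hf : Measurable f)
    (h : ∀ x : ℝ, 0 < x → ENNReal.ofReal x * P {ω | x ≤ M ω} ≤
      ∫⁻ ω in {ω | x ≤ M ω}, ENNReal.ofReal (f ω) ∂P)
    {p : ℝ} (hp : 1 < p) (hfin : ∫⁻ ω, ENNReal.ofReal (M ω) ^ p ∂P ≠ ∞) :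
    ∫⁻ ω, ENNReal.ofReal (M ω) ^ p ∂P ≤
      ENNReal.ofReal (p / (p - 1)) ^ p * ∫⁻ ω, ENNReal.ofReal (f ω) ^ p ∂P := by
  have hp0 : 0 < p := by linarith
  have hp1 : 0 < p - 1 := by linarith
  set A := ∫⁻ ω, ENNReal.ofReal (M ω) ^ p ∂P with hA
  set B := ∫⁻ ω, ENNReal.ofReal (f ω) ^ p ∂P with hB
  set ρ := P.withDensity fun ω => ENNReal.ofReal (f ω) with hρ
  have hms : ∀ x : ℝ, MeasurableSet {ω | x ≤ M ω} := fun x => measurableSet_le measurable_const hM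
  have h1 : A ≤ ENNReal.ofReal (p / (p - 1)) *
      ∫⁻ ω, ENNReal.ofReal (f ω) * ENNReal.ofReal (M ω) ^ (p - 1) ∂P := by
    have e2 : ∫⁻ ω, ENNReal.ofReal (f ω) * ENNReal.ofReal (M ω) ^ (p - 1) ∂P =
        ∫⁻ ω, ENNReal.ofReal (M ω) ^ (p - 1) ∂ρ := by
      rw [hρ, lintegral_withDensity_eq_lintegral_mul _ (by fun_prop) (by fun_prop)]
      rfl
    rw [e2, lintegral_ofReal_rpow_eq ρ hM hp1, hA, lintegral_ofReal_rpow_eq P hM hp0, ← mul_assoc,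
      ← ENNReal.ofReal_mul (by positivity), div_mul_cancel₀ _ hp1.ne']
    gcongr 1
    refine setLIntegral_mono' measurableSet_Ioi fun t ht => ?_
    have ht : 0 < t := ht
    rw [show p - 1 = 1 + (p - 1 - 1) by ring, Real.rpow_add ht, Real.rpow_one,
      ENNReal.ofReal_mul ht.le, ← mul_assoc, mul_comm (P _)]
    rw [show 1 + (p - 1 - 1) - 1 = p - 1 - 1 by ring]
    gcongr
    rw [hρ, withDensity_apply _ (hms t)]
    exact h t ht
  have hq : p.HolderConjugate (p / (p - 1)) := Real.HolderConjugate.conjExponent hp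
  have h2 := ENNReal.lintegral_mul_le_Lp_mul_Lq P hq
    (f := fun ω => ENNReal.ofReal (f ω)) (g := fun ω => ENNReal.ofReal (M ω) ^ (p - 1))
    (by fun_prop) (by fun_prop)
  have e3 : ∀ ω, (ENNReal.ofReal (M ω) ^ (p - 1)) ^ (p / (p - 1)) = ENNReal.ofReal (M ω) ^ p := by
    intro ω
    rw [← ENNReal.rpow_mul, mul_div_cancel₀ _ hp1.ne']
  simp only [e3, Pi.mul_apply] at h2
  rw [← hA, ← hB] at h2
  have h3 : A ≤ ENNReal.ofReal (p / (p - 1)) * (B ^ (1 / p) * A ^ (1 / (p / (p - 1)))) :=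
    h1.trans (by gcongr)
  rcases eq_or_ne A 0 with hA0 | hA0
  · simp [hA0]
  have h4 : A ^ (1 / p) ≤ ENNReal.ofReal (p / (p - 1)) * B ^ (1 / p) := by
    have hne : A ^ (1 / (p / (p - 1))) ≠ 0 := by
      simp [ENNReal.rpow_eq_zero_iff, hA0, hfin]
    have hnt : A ^ (1 / (p / (p - 1))) ≠ ∞ :=
      ENNReal.rpow_ne_top_of_nonneg (by positivity) hfin
    have hsplit : A = A ^ (1 / p) * A ^ (1 / (p / (p - 1))) := by
      rw [← ENNReal.rpow_add _ _ hA0 hfin]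
      have : 1 / p + 1 / (p / (p - 1)) = 1 := by field_simp; ring
      rw [this, ENNReal.rpow_one]
    rw [← mul_assoc] at h3
    nth_rewrite 1 [hsplit] at h3
    exact (ENNReal.mul_le_mul_iff_left hne hnt).1 h3
  calc A = (A ^ (1 / p)) ^ p := by
        rw [← ENNReal.rpow_mul, one_div, inv_mul_cancel₀ hp0.ne', ENNReal.rpow_one]
    _ ≤ (ENNReal.ofReal (p / (p - 1)) * B ^ (1 / p)) ^ p := by gcongr
    _ = _ := by
        rw [ENNReal.mul_rpow_of_nonneg _ _ hp0.le, ← ENNReal.rpow_mul, one_div,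
          inv_mul_cancel₀ hp0.ne', ENNReal.rpow_one]

/-- **Doob's `L^p` inequality** for walks with independent, centred and bounded steps. -/
lemma lintegral_maxUpTo_abs_rpow_le [IsProbabilityMeasure P]
    (hξ : ∀ i, Measurable (ξ i)) (hind : iIndepFun ξ P) {C : ℝ} (hC : ∀ i ω, |ξ i ω| ≤ C)
    (hmean : ∀ i, ∫ ω, ξ i ω ∂P = 0) (N : ℕ) {p : ℝ} (hp : 1 < p) :
    ∫⁻ ω, ENNReal.ofReal (maxUpTo (fun k ω => |partialSum ξ k ω|) N ω) ^ p ∂P ≤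
      ENNReal.ofReal (p / (p - 1)) ^ p * ∫⁻ ω, ENNReal.ofReal |partialSum ξ N ω| ^ p ∂P := by
  have hp0 : 0 < p := by linarith
  have hS := measurable_partialSum hξ
  have hC0 : 0 ≤ C := by
    have : Nonempty Ω := nonempty_of_isProbabilityMeasure P
    exact (abs_nonneg _).trans (hC 0 (Classical.arbitrary Ω))
  have hbd : ∀ k ω, |partialSum ξ k ω| ≤ k * C := fun k ω =>
    (Finset.abs_sum_le_sum_abs _ _).trans
      ((Finset.sum_le_sum fun i _ => hC i ω).trans_eq (by simp))
  have hξi : ∀ i, Integrable (ξ i) P := fun i =>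
    Integrable.of_bound (hξ i).aestronglyMeasurable C
      (Filter.Eventually.of_forall fun ω => by simpa using hC i ω)
  have hSi : ∀ k, Integrable (partialSum ξ k) P := fun k =>
    integrable_finsetSum _ fun i _ => hξi i
  have hS0 : ∀ k, ∫ ω, partialSum ξ k ω ∂P = 0 := fun k => by
    simp only [partialSum]
    rw [integral_finsetSum _ fun i _ => hξi i]
    simp [hmean]
  refine lintegral_rpow_le_of_maximal_inequality
    (measurable_maxUpTo (fun k => (hS k).abs) N) ((hS N).abs) (fun x hx => ?_) hp ?_
  · have hA : MeasurableSet {y : ℝ | x ≤ |y|} := measurableSet_le measurable_const (by fun_prop)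
    have hset : {ω | x ≤ maxUpTo (fun k ω => |partialSum ξ k ω|) N ω} =
        {ω | ∃ k ≤ N, partialSum ξ k ω ∈ {y : ℝ | x ≤ |y|}} := by
      ext ω; simp [le_maxUpTo_iff]
    have hx0 : ENNReal.ofReal x ≠ 0 := by simpa using hx
    have h := measure_entry_le_setLIntegral hξ hind hA
      (φ := fun y => (ENNReal.ofReal x)⁻¹ * ENNReal.ofReal |y|) (by fun_prop) N ?_
    · rw [hset]
      refine (mul_le_mul_right h _).trans_eq ?_
      rw [lintegral_const_mul' _ _ (by simp [hx]), ← mul_assoc,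
        ENNReal.mul_inv_cancel hx0 ENNReal.ofReal_ne_top, one_mul]
    · intro k hk a ha
      have ha : x ≤ |a| := ha
      rw [lintegral_const_mul' _ _ (by simp [hx])]
      have hRi : Integrable (fun ω => a + (partialSum ξ N ω - partialSum ξ k ω)) P :=
        (integrable_const a).add ((hSi N).sub (hSi k))
      have hRm : ∫ ω, (a + (partialSum ξ N ω - partialSum ξ k ω)) ∂P = a := by
        have h1 : ∫ ω, (partialSum ξ N ω - partialSum ξ k ω) ∂P = 0 := by
          rw [integral_sub (hSi N) (hSi k), hS0, hS0, sub_zero]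
        have hi : Integrable (fun ω => partialSum ξ N ω - partialSum ξ k ω) P :=
          (hSi N).sub (hSi k)
        rw [integral_add (integrable_const a) hi, h1]
        simp
      have hle : x ≤ ∫ ω, |a + (partialSum ξ N ω - partialSum ξ k ω)| ∂P := by
        refine ha.trans ?_
        have := abs_integral_le_integral_abs
          (f := fun ω => a + (partialSum ξ N ω - partialSum ξ k ω)) (μ := P)
        rwa [hRm] at this
      rw [← ofReal_integral_eq_lintegral_ofReal hRi.abs
        (Filter.Eventually.of_forall fun ω => abs_nonneg _)]
      calc 1 = (ENNReal.ofReal x)⁻¹ * ENNReal.ofReal x :=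
            (ENNReal.inv_mul_cancel hx0 ENNReal.ofReal_ne_top).symm
        _ ≤ _ := by gcongr
  · refine ne_top_of_le_ne_top (b := ∫⁻ _, ENNReal.ofReal (N * C) ^ p ∂P) ?_
      (lintegral_mono fun ω => ?_)
    · simpa using ENNReal.rpow_ne_top_of_nonneg hp0.le (ENNReal.ofReal_ne_top (r := N * C))
    · gcongr
      refine maxUpTo_le fun k hk => (hbd k ω).trans ?_
      gcongr

end MaximalMoments

/-! ### Gaussian random walks -/

section Gaussian

variable {Ω : Type*} [MeasurableSpace Ω] {P : Measure Ω}

/-- The `p`-th moment of the positive part of a centred Gaussian variable. -/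
lemma two_mul_lintegral_ofReal_rpow_gaussianReal (v : ℝ≥0) {p : ℝ} (hp : 0 < p) :
    2 * ∫⁻ x, ENNReal.ofReal x ^ p ∂(gaussianReal 0 v) =
      ENNReal.ofReal ((v : ℝ) ^ (p / 2) *
        (Real.Gamma ((p + 1) / 2) * (2 ^ (p / 2) / √Real.pi))) := by
  rcases eq_or_ne v 0 with rfl | hv
  · simp [hp, Real.zero_rpow (show p / 2 ≠ 0 by positivity)]
  have hv0 : 0 < (v : ℝ) := by positivity
  rw [gaussianReal_of_var_ne_zero _ hv,
    lintegral_withDensity_eq_lintegral_mul _ (measurable_gaussianPDF 0 v) (by fun_prop)]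
  have h1 : ∫⁻ x, (gaussianPDF 0 v * fun x => ENNReal.ofReal x ^ p) x =
      ∫⁻ x in Set.Ioi (0 : ℝ), ENNReal.ofReal ((√(2 * Real.pi * v))⁻¹ *
        (x ^ p * Real.exp (-(1 / (2 * v)) * x ^ (2 : ℝ)))) := by
    rw [← lintegral_indicator measurableSet_Ioi]
    refine lintegral_congr fun x => ?_
    rcases le_or_gt x 0 with hx | hx
    · rw [Set.indicator_of_notMem (by simpa using hx)]
      simp [ENNReal.ofReal_of_nonpos hx, hp]
    · rw [Set.indicator_of_mem (by simpa using hx), Pi.mul_apply, gaussianPDF, gaussianPDFReal,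
        ENNReal.ofReal_rpow_of_pos hx, ← ENNReal.ofReal_mul (by positivity)]
      congr 1
      rw [mul_comm (x ^ p), mul_assoc]
      congr 3
      rw [Real.rpow_two]
      ring
  have hb : 0 < 1 / (2 * (v : ℝ)) := by positivity
  have h2 := integral_rpow_mul_exp_neg_mul_rpow (p := 2) (q := p) (b := 1 / (2 * v))
    (by norm_num) (by linarith) hb
  have hint : IntegrableOn (fun x : ℝ => x ^ p * Real.exp (-(1 / (2 * v)) * x ^ (2 : ℝ)))
      (Set.Ioi 0) := by
    have := integrableOn_rpow_mul_exp_neg_mul_rpow (p := 2) (s := p) (b := 1 / (2 * v))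
      (by linarith) (by norm_num) hb
    exact this
  rw [h1, ← ofReal_integral_eq_lintegral_ofReal (hint.const_mul _)
    ((ae_restrict_iff' measurableSet_Ioi).2 (Filter.Eventually.of_forall fun x hx => by
      have : 0 < x := hx
      positivity)), integral_const_mul, h2,
    show (2 : ℝ≥0∞) = ENNReal.ofReal 2 by simp, ← ENNReal.ofReal_mul (by norm_num)]
  congr 1
  have e1 : √(2 * Real.pi * v) = √Real.pi * (2 * v) ^ (1 / 2 : ℝ) := by
    rw [show 2 * Real.pi * v = Real.pi * (2 * v) by ring, Real.sqrt_mul Real.pi_pos.le,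
      Real.sqrt_eq_rpow (2 * v)]
  have e2 : (1 / (2 * (v : ℝ))) ^ (-(p + 1) / 2) =
      (2 * v) ^ (1 / 2 : ℝ) * ((v : ℝ) ^ (p / 2) * 2 ^ (p / 2)) := by
    rw [one_div, Real.inv_rpow (by positivity), ← Real.rpow_neg (by positivity),
      ← Real.mul_rpow hv0.le (by norm_num), mul_comm (v : ℝ) 2,
      ← Real.rpow_add (by positivity)]
    congr 1
    ring
  rw [e1, e2]
  have : (2 * (v : ℝ)) ^ (1 / 2 : ℝ) ≠ 0 := by positivity
  field_simp

lemma map_finsetSum_gaussianReal [IsProbabilityMeasure P] {g : ℕ → Ω → ℝ} {v : ℝ≥0}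
    (hg : ∀ i, Measurable (g i)) (hind : iIndepFun g P)
    (hlaw : ∀ i, P.map (g i) = gaussianReal 0 v) (s : Finset ℕ) :
    P.map (fun ω => ∑ i ∈ s, g i ω) = gaussianReal 0 (s.card * v) := by
  have : IsProbabilityMeasure (P.map (fun ω => ∑ i ∈ s, g i ω)) :=
    Measure.isProbabilityMeasure_map (by fun_prop)
  refine Measure.ext_of_charFun ?_
  ext u
  rw [(hind.restrict s).charFun_map_fun_finsetSum_eq_prod (fun i _ => (hg i).aemeasurable)]
  simp only [Finset.prod_apply, hlaw, charFun_gaussianReal, Finset.prod_const,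
    ← Complex.exp_nat_mul]
  congr 1
  push_cast
  ring

lemma one_le_two_mul_gaussianReal_nonneg (v : ℝ≥0) :
    1 ≤ 2 * gaussianReal 0 v (Set.Ici 0) := by
  have h1 : gaussianReal 0 v (Set.Iic 0) = gaussianReal 0 v (Set.Ici 0) := by
    have h := gaussianReal_map_neg (μ := 0) (v := v)
    rw [neg_zero] at h
    conv_lhs => rw [← h]
    rw [Measure.map_apply (by fun_prop) measurableSet_Iic]
    congr 1
    ext x
    simp
  calc (1 : ℝ≥0∞) = gaussianReal 0 v (Set.Ici 0 ∪ Set.Iic 0) := by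
        rw [← measure_univ (μ := gaussianReal 0 v)]
        congr 1
        ext x
        simp
    _ ≤ _ := measure_union_le _ _
    _ = _ := by rw [h1, two_mul]

/-- The moments of the maximum of a centred Gaussian random walk. -/
lemma lintegral_maxUpTo_gaussian_rpow_le [IsProbabilityMeasure P] {g : ℕ → Ω → ℝ} {v : ℝ≥0}
    (hg : ∀ i, Measurable (g i)) (hind : iIndepFun g P)
    (hlaw : ∀ i, P.map (g i) = gaussianReal 0 v) (N : ℕ) {p : ℝ} (hp : 0 < p) :
    ∫⁻ ω, ENNReal.ofReal (maxUpTo (partialSum g) N ω) ^ p ∂P ≤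
      ENNReal.ofReal ((N * v : ℝ) ^ (p / 2) *
        (Real.Gamma ((p + 1) / 2) * (2 ^ (p / 2) / √Real.pi))) := by
  refine (lintegral_maxUpTo_rpow_le_two_mul hg hind N (fun k hk => ?_) hp).trans_eq ?_
  · have hm : Measurable fun ω => ∑ i ∈ Finset.Ico k N, g i ω := by fun_prop
    have h := one_le_two_mul_gaussianReal_nonneg ((Finset.Ico k N).card * v)
    rw [← map_finsetSum_gaussianReal hg hind hlaw, Measure.map_apply hm measurableSet_Ici] at h
    simp only [partialSum, ← Finset.sum_Ico_eq_sub _ hk]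
    exact h
  · have h := two_mul_lintegral_ofReal_rpow_gaussianReal ((Finset.range N).card * v) hp
    rw [← map_finsetSum_gaussianReal hg hind hlaw, lintegral_map (by fun_prop) (by fun_prop)] at h
    simpa [partialSum] using h

end Gaussian

/-! ### Sums of rare nonnegative jumps -/

section Powers

/-- The power mean inequality and its version for exponents at most `1`, in one statement. -/
lemma ennreal_sum_rpow_le {ι : Type*} (s : Finset ι) (f : ι → ℝ≥0∞) {p : ℝ} (hp : 0 < p) :
    (∑ i ∈ s, f i) ^ p ≤ (s.card : ℝ≥0∞) ^ max (p - 1) 0 * ∑ i ∈ s, f i ^ p := by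
  rcases le_total 1 p with h | h
  · rw [max_eq_left (by linarith)]
    exact ENNReal.rpow_sum_le_const_mul_sum_rpow s f h
  · rw [max_eq_right (by linarith), ENNReal.rpow_zero, one_mul]
    classical
    induction s using Finset.induction_on with
    | empty => simp [hp]
    | insert a s ha ih =>
      rw [Finset.sum_insert ha, Finset.sum_insert ha]
      exact (ENNReal.rpow_add_le_add_rpow _ _ hp.le h).trans (by gcongr)

end Powers

section Jumps

/-- The expansion of the powers of `1 + x` in falling factorials of `x`. -/
lemma one_add_pow_eq_sum_stirlingSecond (n x : ℕ) :
    (1 + x) ^ n =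
      ∑ k ∈ Finset.range (n + 1), Nat.stirlingSecond (n + 1) (k + 1) * x.descFactorial k := by
  induction n with
  | zero => simp [Nat.stirlingSecond_self]
  | succ n ih =>
    have hstep : ∀ k, x.descFactorial k * (1 + x) =
        x.descFactorial (k + 1) + (k + 1) * x.descFactorial k := by
      intro k
      rw [Nat.descFactorial_succ]
      rcases le_or_gt k x with hk | hk
      · obtain ⟨y, rfl⟩ := Nat.exists_eq_add_of_le hk
        rw [Nat.add_sub_cancel_left]
        ring
      · simp [Nat.descFactorial_of_lt hk]
    have hR : ∀ k, Nat.stirlingSecond (n + 2) (k + 1) * x.descFactorial k =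
        (k + 1) * Nat.stirlingSecond (n + 1) (k + 1) * x.descFactorial k +
          Nat.stirlingSecond (n + 1) k * x.descFactorial k := by
      intro k
      rw [Nat.stirlingSecond_succ_succ]
      ring
    simp only [hR]
    rw [pow_succ, ih, Finset.sum_mul, Finset.sum_add_distrib, Finset.sum_range_succ _ (n + 1),
      Finset.sum_range_succ' (fun k => Nat.stirlingSecond (n + 1) k * x.descFactorial k) (n + 1),
      Nat.stirlingSecond_eq_zero_of_lt (show n + 1 < n + 1 + 1 by omega)]
    simp only [mul_zero, zero_mul, add_zero, Nat.stirlingSecond_succ_zero]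
    rw [add_comm (∑ k ∈ _, _), ← Finset.sum_add_distrib]
    refine Finset.sum_congr rfl fun k _ => ?_
    rw [mul_assoc, hstep]
    ring

lemma pow_succ_add_le_add_pow (x q : ℝ≥0∞) (j : ℕ) :
    x ^ (j + 1) + q * ((j + 1) * x ^ j) ≤ (x + q) ^ (j + 1) := by
  induction j with
  | zero => simp
  | succ j ih =>
    calc x ^ (j + 1 + 1) + q * (((j + 1 : ℕ) + 1) * x ^ (j + 1))
        ≤ x ^ (j + 1 + 1) + q * (((j + 1 : ℕ) + 1) * x ^ (j + 1)) +
          (j + 1) * q ^ 2 * x ^ j := le_self_add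
      _ = (x ^ (j + 1) + q * ((j + 1) * x ^ j)) * (x + q) := by push_cast; ring
      _ ≤ (x + q) ^ (j + 1) * (x + q) := by gcongr
      _ = _ := (pow_succ _ _).symm

variable {Ω : Type*}

open Classical in
/-- The number of indices in `s` at which `Y` does not vanish. -/
noncomputable def countNe (Y : ℕ → Ω → ℝ≥0∞) (s : Finset ℕ) (ω : Ω) : ℕ :=
  (s.filter fun i => Y i ω ≠ 0).card

lemma countNe_eq_sum (Y : ℕ → Ω → ℝ≥0∞) (s : Finset ℕ) (ω : Ω) :
    countNe Y s ω = ∑ i ∈ s, ({0}ᶜ : Set ℝ≥0∞).indicator (fun _ => 1) (Y i ω) := by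
  classical
  rw [countNe, Finset.card_filter]
  refine Finset.sum_congr rfl fun i _ => ?_
  by_cases h : Y i ω = 0 <;> simp [h]

/-- A sum of `K` nonzero terms has `p`-th power at most `K ^ (⌈p⌉ - 1)` times the sum of the
`p`-th powers; in the `i`-th summand, `K` is written as `1` plus the number of other nonzero
terms. -/
lemma sum_rpow_le_sum_mul_countNe (Y : ℕ → Ω → ℝ≥0∞) {p : ℝ} (hp : 0 < p) (N : ℕ)
    (ω : Ω) :
    (∑ i ∈ Finset.range N, Y i ω) ^ p ≤ ∑ i ∈ Finset.range N,
      Y i ω ^ p * ((1 + countNe Y ((Finset.range N).erase i) ω) ^ (⌈p⌉₊ - 1) : ℕ) := by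
  classical
  set s := (Finset.range N).filter fun i => Y i ω ≠ 0 with hs
  have h1 : ∑ i ∈ Finset.range N, Y i ω = ∑ i ∈ s, Y i ω := (Finset.sum_filter_ne_zero _).symm
  have hm1 : 1 ≤ ⌈p⌉₊ := Nat.one_le_ceil_iff.2 hp
  have hcard : ∀ i ∈ s, 1 + countNe Y ((Finset.range N).erase i) ω = s.card := by
    intro i hi
    rw [countNe, Finset.filter_erase, ← hs, Finset.card_erase_of_mem hi]
    have := Finset.card_pos.2 ⟨i, hi⟩
    omega
  calc (∑ i ∈ Finset.range N, Y i ω) ^ p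
      ≤ (s.card : ℝ≥0∞) ^ (⌈p⌉₊ - 1) * ∑ i ∈ s, Y i ω ^ p := by
        rw [h1]
        rcases s.eq_empty_or_nonempty with he | hne
        · simp [he, hp]
        have hc1 : (1 : ℝ≥0∞) ≤ s.card := by exact_mod_cast Finset.card_pos.2 hne
        refine (ennreal_sum_rpow_le s (fun i => Y i ω) hp).trans ?_
        gcongr
        rw [← ENNReal.rpow_natCast]
        refine ENNReal.rpow_le_rpow_of_exponent_le hc1 (max_le ?_ (Nat.cast_nonneg _))
        rw [Nat.cast_sub hm1]
        have := Nat.le_ceil p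
        push_cast
        linarith
    _ = ∑ i ∈ s, Y i ω ^ p * ((1 + countNe Y ((Finset.range N).erase i) ω) ^ (⌈p⌉₊ - 1) : ℕ) := by
        rw [Finset.mul_sum]
        refine Finset.sum_congr rfl fun i hi => ?_
        rw [hcard i hi]
        push_cast
        ring
    _ ≤ _ := Finset.sum_le_sum_of_subset (Finset.filter_subset _ _)

variable [MeasurableSpace Ω] {P : Measure Ω} {Y : ℕ → Ω → ℝ≥0∞}

lemma measurable_countNe (hY : ∀ i, Measurable (Y i)) (s : Finset ℕ) :
    Measurable (countNe Y s) := by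
  have : countNe Y s = fun ω => ∑ i ∈ s, ({0}ᶜ : Set ℝ≥0∞).indicator (fun _ => 1) (Y i ω) := by
    ext ω; exact countNe_eq_sum Y s ω
  rw [this]
  exact Finset.measurable_fun_sum _ fun i _ =>
    (measurable_const.indicator (measurableSet_singleton 0).compl).comp (hY i)

lemma indepFun_countNe (hY : ∀ i, Measurable (Y i)) (hind : iIndepFun Y P) {a : ℕ} {s : Finset ℕ}
    (ha : a ∉ s) : IndepFun (Y a) (countNe Y s) P := by
  have h := hind.indepFun_finset {a} s (by simpa using ha) hY
  have h2 := h.comp (φ := fun w : ({a} : Finset ℕ) → ℝ≥0∞ => w ⟨a, by simp⟩)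
    (ψ := fun w : s → ℝ≥0∞ => ∑ i, ({0}ᶜ : Set ℝ≥0∞).indicator (fun _ => 1) (w i))
    (measurable_pi_apply (X := fun _ : ({a} : Finset ℕ) => ℝ≥0∞) ⟨a, by simp⟩)
    (Finset.measurable_fun_sum _ fun i _ =>
      (measurable_const.indicator (measurableSet_singleton 0).compl).comp (measurable_pi_apply i))
  have e : countNe Y s =
      (fun w : s → ℝ≥0∞ => ∑ i, ({0}ᶜ : Set ℝ≥0∞).indicator (fun _ => 1) (w i)) ∘
        fun ω (i : s) => Y i ω := by
    ext ω
    rw [countNe_eq_sum, Function.comp, Finset.univ_eq_attach,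
      Finset.sum_attach s (fun i => ({0}ᶜ : Set ℝ≥0∞).indicator (fun _ => 1) (Y i ω))]
  rw [e]
  exact h2

/-- The factorial moments of a binomial variable. -/
lemma lintegral_descFactorial_countNe_le [IsProbabilityMeasure P]
    (hY : ∀ i, Measurable (Y i)) (hind : iIndepFun Y P)
    {q : ℝ≥0∞} (hq : ∀ i, P {ω | Y i ω ≠ 0} = q) (s : Finset ℕ) (j : ℕ) :
    ∫⁻ ω, ((countNe Y s ω).descFactorial j : ℝ≥0∞) ∂P ≤ (s.card * q) ^ j := by
  classical
  induction s using Finset.induction_on generalizing j with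
  | empty =>
    cases j with
    | zero => simp
    | succ j => simp [countNe]
  | insert a s ha ih =>
    cases j with
    | zero => simp
    | succ j =>
      have hset : MeasurableSet {ω | Y a ω ≠ 0} := hY a (measurableSet_singleton 0).compl
      have hdesc : ∀ c : ℕ, (c + 1).descFactorial (j + 1) =
          c.descFactorial (j + 1) + (j + 1) * c.descFactorial j := by
        intro c
        rw [Nat.succ_descFactorial_succ, Nat.descFactorial_succ]
        rcases le_or_gt j c with hk | hk
        · obtain ⟨y, rfl⟩ := Nat.exists_eq_add_of_le hk
          rw [Nat.add_sub_cancel_left]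
          ring
        · simp [Nat.descFactorial_of_lt hk]
      have hpt : ∀ ω, ((countNe Y (insert a s) ω).descFactorial (j + 1) : ℝ≥0∞) =
          (countNe Y s ω).descFactorial (j + 1) +
            ({0}ᶜ : Set ℝ≥0∞).indicator (fun _ => 1) (Y a ω) *
              ((j + 1) * (countNe Y s ω).descFactorial j) := by
        intro ω
        have e : countNe Y (insert a s) ω = countNe Y s ω + if Y a ω = 0 then 0 else 1 := by
          rw [countNe_eq_sum, Finset.sum_insert ha, ← countNe_eq_sum, add_comm]
          by_cases h : Y a ω = 0 <;> simp [h]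
        by_cases h : Y a ω = 0
        · simp [e, h]
        · simp only [e, h, if_false, hdesc]
          simp [h]
      have hm : ∀ f : ℕ → ℝ≥0∞, Measurable fun ω => f (countNe Y s ω) := fun f =>
        (measurable_of_countable f).comp (measurable_countNe hY s)
      have hI : Measurable (({0}ᶜ : Set ℝ≥0∞).indicator fun _ => (1 : ℝ≥0∞)) :=
        measurable_const.indicator (measurableSet_singleton 0).compl
      have hprod := lintegral_mul_eq_lintegral_mul_lintegral_of_indepFun
        (hI.comp (hY a)) (hm fun c => (j + 1) * c.descFactorial j)
        ((indepFun_countNe hY hind ha).comp hI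
          (measurable_of_countable fun c : ℕ => ((j + 1) * c.descFactorial j : ℝ≥0∞)))
      have hIq : ∫⁻ ω, (({0}ᶜ : Set ℝ≥0∞).indicator fun _ => (1 : ℝ≥0∞)) (Y a ω) ∂P = q := by
        rw [← hq a, ← lintegral_indicator_one hset]
        refine lintegral_congr fun ω => ?_
        by_cases h : Y a ω = 0 <;> simp [h]
      simp only [hpt]
      rw [lintegral_add_left (hm fun c => (c.descFactorial (j + 1) : ℝ≥0∞))]
      simp only [Pi.mul_apply, Function.comp] at hprod
      rw [hprod, hIq, lintegral_const_mul _ (hm fun c => (c.descFactorial j : ℝ≥0∞)),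
        Finset.card_insert_of_notMem ha]
      calc _ ≤ (s.card * q) ^ (j + 1) + q * ((j + 1) * (s.card * q) ^ j) := by
            gcongr
            · exact ih (j + 1)
            · exact ih j
        _ ≤ (s.card * q + q) ^ (j + 1) := pow_succ_add_le_add_pow _ _ _
        _ = _ := by push_cast; ring

/-- The `p`-th moment of a sum of `N` independent nonnegative variables which are rarely nonzero. -/
lemma lintegral_sum_rpow_le [IsProbabilityMeasure P]
    (hY : ∀ i, Measurable (Y i)) (hind : iIndepFun Y P)
    {q a : ℝ≥0∞} (hq : ∀ i, P {ω | Y i ω ≠ 0} = q) {p : ℝ} (hp : 0 < p)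
    (ha : ∀ i, ∫⁻ ω, Y i ω ^ p ∂P = a) (N : ℕ) :
    ∫⁻ ω, (∑ i ∈ Finset.range N, Y i ω) ^ p ∂P ≤
      N * a * ∑ k ∈ Finset.Icc 1 ⌈p⌉₊, Nat.stirlingSecond ⌈p⌉₊ k * (N * q) ^ (k - 1) := by
  obtain ⟨n, hn⟩ : ∃ n, ⌈p⌉₊ = n + 1 :=
    Nat.exists_eq_succ_of_ne_zero (Nat.ceil_pos.2 hp).ne'
  have hm : ∀ (s : Finset ℕ) (f : ℕ → ℝ≥0∞), Measurable fun ω => f (countNe Y s ω) := fun s f =>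
    (measurable_of_countable f).comp (measurable_countNe hY s)
  have hK : ∀ s : Finset ℕ, ∫⁻ ω, (((1 + countNe Y s ω) ^ n : ℕ) : ℝ≥0∞) ∂P ≤
      ∑ k ∈ Finset.range (n + 1), Nat.stirlingSecond (n + 1) (k + 1) * (s.card * q) ^ k := by
    intro s
    simp only [one_add_pow_eq_sum_stirlingSecond]
    push_cast
    rw [lintegral_finsetSum _ fun k _ =>
      hm s fun c => (Nat.stirlingSecond (n + 1) (k + 1) * c.descFactorial k : ℝ≥0∞)]
    refine Finset.sum_le_sum fun k _ => ?_
    rw [lintegral_const_mul _ (hm s fun c => (c.descFactorial k : ℝ≥0∞))]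
    gcongr
    exact lintegral_descFactorial_countNe_le hY hind hq s k
  have hsum : ∑ k ∈ Finset.Icc 1 ⌈p⌉₊, (Nat.stirlingSecond ⌈p⌉₊ k : ℝ≥0∞) * (N * q) ^ (k - 1) =
      ∑ k ∈ Finset.range (n + 1), Nat.stirlingSecond (n + 1) (k + 1) * (N * q) ^ k := by
    have h := Finset.sum_Ico_add'
      (fun k => (Nat.stirlingSecond (n + 1) k : ℝ≥0∞) * (N * q) ^ (k - 1)) 0 (n + 1) 1
    simp only [Nat.add_sub_cancel, Nat.Ico_zero_eq_range] at h
    rw [hn, h]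
    rfl
  rw [hsum]
  calc ∫⁻ ω, (∑ i ∈ Finset.range N, Y i ω) ^ p ∂P
      ≤ ∫⁻ ω, ∑ i ∈ Finset.range N,
          Y i ω ^ p * ((1 + countNe Y ((Finset.range N).erase i) ω) ^ n : ℕ) ∂P := by
        refine lintegral_mono fun ω => ?_
        have := sum_rpow_le_sum_mul_countNe Y hp N ω
        rwa [hn, Nat.add_sub_cancel] at this
    _ = ∑ i ∈ Finset.range N, a * ∫⁻ ω,
          (((1 + countNe Y ((Finset.range N).erase i) ω) ^ n : ℕ) : ℝ≥0∞) ∂P := by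
        have hmi : ∀ i ∈ Finset.range N, Measurable fun ω =>
            Y i ω ^ p * (((1 + countNe Y ((Finset.range N).erase i) ω) ^ n : ℕ) : ℝ≥0∞) :=
          fun i _ => ((hY i).pow_const p).mul (hm _ fun c => (((1 + c) ^ n : ℕ) : ℝ≥0∞))
        rw [lintegral_finsetSum _ hmi]
        refine Finset.sum_congr rfl fun i _ => ?_
        rw [← ha i]
        exact lintegral_mul_eq_lintegral_mul_lintegral_of_indepFun
          ((hY i).pow_const p) (hm _ fun c => (((1 + c) ^ n : ℕ) : ℝ≥0∞))
          ((indepFun_countNe hY hind (Finset.notMem_erase i _)).comp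
            (measurable_id.pow_const p)
            (measurable_of_countable fun c : ℕ => (((1 + c) ^ n : ℕ) : ℝ≥0∞)))
    _ ≤ ∑ i ∈ Finset.range N, a * ∑ k ∈ Finset.range (n + 1),
          Nat.stirlingSecond (n + 1) (k + 1) * (N * q) ^ k := by
        refine Finset.sum_le_sum fun i hi => ?_
        gcongr
        refine (hK _).trans ?_
        gcongr
        exact (Finset.card_erase_le).trans_eq (Finset.card_range N)
    _ = _ := by
        rw [Finset.sum_const, Finset.card_range, nsmul_eq_mul, mul_assoc]

end Jumps

/-! ### Random walks with small centred steps -/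

section CentredWalk

variable {Ω : Type*} [MeasurableSpace Ω] {P : Measure Ω} {ξ : ℕ → Ω → ℝ}

/-- For `p ≤ 2`, the `p`-th moment of the maximum of a centred walk is controlled by the variance
of its final value. -/
lemma lintegral_maxUpTo_abs_rpow_le_of_le_two [IsProbabilityMeasure P]
    (hξ : ∀ i, Measurable (ξ i)) (hind : iIndepFun ξ P) {C : ℝ} (hC : ∀ i ω, |ξ i ω| ≤ C)
    (hmean : ∀ i, ∫ ω, ξ i ω ∂P = 0) {w : ℝ} (hw : ∀ i, ∫ ω, ξ i ω ^ 2 ∂P ≤ w) (N : ℕ)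
    {p : ℝ} (hp : 0 < p) (hp2 : p ≤ 2) :
    ∫⁻ ω, ENNReal.ofReal (maxUpTo (fun k ω => |partialSum ξ k ω|) N ω) ^ p ∂P ≤
      ENNReal.ofReal ((4 * (N * w)) ^ (p / 2)) := by
  have hS := measurable_partialSum hξ
  have hM : Measurable (maxUpTo (fun k ω => |partialSum ξ k ω|) N) :=
    measurable_maxUpTo (fun k => (hS k).abs) N
  have hM0 : ∀ ω, 0 ≤ maxUpTo (fun k ω => |partialSum ξ k ω|) N ω := fun ω =>
    (abs_nonneg _).trans (le_maxUpTo (S := fun k ω => |partialSum ξ k ω|) (Nat.zero_le N) ω)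
  have hL : ∀ i, MemLp (ξ i) 2 P := fun i =>
    MemLp.of_bound (hξ i).aestronglyMeasurable C
      (Filter.Eventually.of_forall fun ω => by simpa using hC i ω)
  have hLS : MemLp (partialSum ξ N) 2 P := memLp_finsetSum _ fun i _ => hL i
  have hw0 : 0 ≤ w := (integral_nonneg fun ω => sq_nonneg (ξ 0 ω)).trans (hw 0)
  have hvar : ∫ ω, partialSum ξ N ω ^ 2 ∂P ≤ N * w := by
    have hm : ∫ ω, partialSum ξ N ω ∂P = 0 := by
      simp only [partialSum]
      rw [integral_finsetSum _ fun i _ => (hL i).integrable (by norm_num)]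
      simp [hmean]
    have h1 := variance_of_integral_eq_zero hLS.aestronglyMeasurable.aemeasurable hm
    have h2 := IndepFun.variance_sum (s := Finset.range N) (fun i _ => hL i)
      (fun i _ j _ hij => hind.indepFun hij)
    have e : partialSum ξ N = ∑ i ∈ Finset.range N, ξ i := by
      ext ω; simp [partialSum]
    rw [← h1, e, h2]
    calc _ ≤ ∑ i ∈ Finset.range N, w := Finset.sum_le_sum fun i _ =>
          (variance_le_expectation_sq (hξ i).aestronglyMeasurable).trans (hw i)
      _ = N * w := by simp
  have h2 : ∫⁻ ω, ENNReal.ofReal (maxUpTo (fun k ω => |partialSum ξ k ω|) N ω) ^ (2 : ℝ) ∂P ≤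
      ENNReal.ofReal (4 * (N * w)) := by
    refine (lintegral_maxUpTo_abs_rpow_le hξ hind hC hmean N (by norm_num)).trans ?_
    have e : ∫⁻ ω, ENNReal.ofReal |partialSum ξ N ω| ^ (2 : ℝ) ∂P =
        ENNReal.ofReal (∫ ω, partialSum ξ N ω ^ 2 ∂P) := by
      rw [ofReal_integral_eq_lintegral_ofReal hLS.integrable_sq
        (Filter.Eventually.of_forall fun ω => sq_nonneg _)]
      refine lintegral_congr fun ω => ?_
      rw [ENNReal.ofReal_rpow_of_nonneg (abs_nonneg _) (by norm_num), Real.rpow_two, sq_abs]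
    rw [e, ENNReal.ofReal_rpow_of_nonneg (by norm_num) (by norm_num),
      ← ENNReal.ofReal_mul (by positivity)]
    refine ENNReal.ofReal_le_ofReal ?_
    norm_num
    linarith
  have h3 := eLpNorm'_le_eLpNorm'_of_exponent_le hp hp2 P hM.aestronglyMeasurable
  simp only [eLpNorm', Real.enorm_of_nonneg (hM0 _)] at h3
  calc _ = ((∫⁻ ω, ENNReal.ofReal
        (maxUpTo (fun k ω => |partialSum ξ k ω|) N ω) ^ p ∂P) ^ (1 / p)) ^ p := by
        rw [← ENNReal.rpow_mul, one_div, inv_mul_cancel₀ hp.ne', ENNReal.rpow_one]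
    _ ≤ (ENNReal.ofReal (4 * (N * w)) ^ (1 / (2 : ℝ))) ^ p := by
        gcongr
        exact h3.trans (by gcongr)
    _ = _ := by
        rw [← ENNReal.rpow_mul, ENNReal.ofReal_rpow_of_nonneg (by positivity) (by positivity)]
        congr 2
        ring

/-- The elementary bound `y ^ p ≤ (p / e) ^ p e ^ y`. -/
lemma rpow_le_mul_exp {y p : ℝ} (hy : 0 ≤ y) (hp : 0 < p) :
    y ^ p ≤ p ^ p * Real.exp (y - p) := by
  rcases hy.eq_or_lt with rfl | hy
  · rw [Real.zero_rpow hp.ne']; positivity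
  have h : y ≤ p * Real.exp (y / p - 1) := by
    have := Real.add_one_le_exp (y / p - 1)
    rw [sub_add_cancel, div_le_iff₀ hp] at this
    linarith
  calc y ^ p ≤ (p * Real.exp (y / p - 1)) ^ p := by gcongr
    _ = p ^ p * Real.exp (y - p) := by
        rw [Real.mul_rpow hp.le (Real.exp_pos _).le, ← Real.exp_mul]
        congr 2
        field_simp

/-- Moments of order `p > 2` of the maximum of a centred walk with small exponential moments at
the scale `h`. -/
lemma lintegral_maxUpTo_abs_rpow_le_of_mgf [IsProbabilityMeasure P]
    (hξ : ∀ i, Measurable (ξ i)) (hind : iIndepFun ξ P) {C : ℝ} (hC : ∀ i ω, |ξ i ω| ≤ C)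
    (hmean : ∀ i, ∫ ω, ξ i ω ∂P = 0) {h w : ℝ} (hh : 0 < h)
    (hmgf : ∀ i, ∀ s : ℝ, |s| = h⁻¹ → mgf (ξ i) P s ≤ Real.exp w) (N : ℕ) {p : ℝ} (hp : 1 < p) :
    ∫⁻ ω, ENNReal.ofReal (maxUpTo (fun k ω => |partialSum ξ k ω|) N ω) ^ p ∂P ≤
      ENNReal.ofReal (h ^ p * (2 * (p ^ 2 / (p - 1)) ^ p * Real.exp (N * w - p))) := by
  have hp0 : 0 < p := by linarith
  have hp1 : 0 < p - 1 := by linarith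
  have hS := measurable_partialSum hξ
  have hsum : partialSum ξ N = ∑ i ∈ Finset.range N, ξ i := by ext ω; simp [partialSum]
  have hbd : ∀ ω, |partialSum ξ N ω| ≤ N * C := fun ω =>
    (Finset.abs_sum_le_sum_abs _ _).trans
      ((Finset.sum_le_sum fun i _ => hC i ω).trans_eq (by simp))
  have hexp : ∀ s : ℝ, Integrable (fun ω => Real.exp (s * partialSum ξ N ω)) P := fun s =>
    Integrable.of_bound ((hS N).const_mul s).exp.aestronglyMeasurable (Real.exp (|s| * (N * C)))
      (Filter.Eventually.of_forall fun ω => by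
        rw [Real.norm_eq_abs, Real.abs_exp]
        refine Real.exp_le_exp.2 ((le_abs_self _).trans ?_)
        rw [abs_mul]
        exact mul_le_mul_of_nonneg_left (hbd ω) (abs_nonneg s))
  have hmgfS : ∀ s : ℝ, |s| = h⁻¹ → ∫ ω, Real.exp (s * partialSum ξ N ω) ∂P ≤
      Real.exp (N * w) := by
    intro s hs
    change mgf (partialSum ξ N) P s ≤ _
    rw [hsum, hind.mgf_sum hξ]
    calc _ ≤ ∏ i ∈ Finset.range N, Real.exp w :=
          Finset.prod_le_prod (fun i _ => mgf_nonneg) fun i _ => hmgf i s hs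
      _ = _ := by rw [Finset.prod_const, Finset.card_range, ← Real.exp_nat_mul]
  -- at the scale `h` a power is dominated by an exponential
  have hpt : ∀ ω, |partialSum ξ N ω| ^ p ≤ h ^ p * (p ^ p * Real.exp (-p)) *
      (Real.exp (h⁻¹ * partialSum ξ N ω) + Real.exp (-h⁻¹ * partialSum ξ N ω)) := by
    intro ω
    have h1 := rpow_le_mul_exp (y := |partialSum ξ N ω| / h) (by positivity) hp0
    have h2 : Real.exp (|partialSum ξ N ω| / h) ≤
        Real.exp (h⁻¹ * partialSum ξ N ω) + Real.exp (-h⁻¹ * partialSum ξ N ω) := by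
      rcases abs_cases (partialSum ξ N ω) with ⟨e, -⟩ | ⟨e, -⟩ <;> rw [e]
      · rw [div_eq_inv_mul]
        linarith [Real.exp_pos (-h⁻¹ * partialSum ξ N ω)]
      · rw [div_eq_inv_mul, show h⁻¹ * -partialSum ξ N ω = -h⁻¹ * partialSum ξ N ω by ring]
        linarith [Real.exp_pos (h⁻¹ * partialSum ξ N ω)]
    rw [Real.div_rpow (abs_nonneg _) hh.le, div_le_iff₀ (by positivity)] at h1
    calc _ ≤ _ := h1
      _ = h ^ p * (p ^ p * Real.exp (-p)) * Real.exp (|partialSum ξ N ω| / h) := by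
          rw [sub_eq_add_neg, Real.exp_add]
          ring
      _ ≤ _ := by gcongr
  refine (lintegral_maxUpTo_abs_rpow_le hξ hind hC hmean N hp).trans ?_
  have h3 : ∫⁻ ω, ENNReal.ofReal |partialSum ξ N ω| ^ p ∂P ≤
      ENNReal.ofReal (h ^ p * (p ^ p * Real.exp (-p)) * (2 * Real.exp (N * w))) := by
    calc _ ≤ ∫⁻ ω, ENNReal.ofReal (h ^ p * (p ^ p * Real.exp (-p)) *
          (Real.exp (h⁻¹ * partialSum ξ N ω) + Real.exp (-h⁻¹ * partialSum ξ N ω))) ∂P := by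
          refine lintegral_mono fun ω => ?_
          rw [ENNReal.ofReal_rpow_of_nonneg (abs_nonneg _) hp0.le]
          exact ENNReal.ofReal_le_ofReal (hpt ω)
      _ = ENNReal.ofReal (∫ ω, h ^ p * (p ^ p * Real.exp (-p)) *
          (Real.exp (h⁻¹ * partialSum ξ N ω) + Real.exp (-h⁻¹ * partialSum ξ N ω)) ∂P) := by
          have hi : Integrable (fun ω => h ^ p * (p ^ p * Real.exp (-p)) *
              (Real.exp (h⁻¹ * partialSum ξ N ω) + Real.exp (-h⁻¹ * partialSum ξ N ω))) P :=
            ((hexp _).add (hexp _)).const_mul _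
          rw [ofReal_integral_eq_lintegral_ofReal hi
            (Filter.Eventually.of_forall fun ω => by positivity)]
      _ ≤ _ := by
          refine ENNReal.ofReal_le_ofReal ?_
          rw [integral_const_mul, integral_add (hexp _) (hexp _), two_mul]
          gcongr
          · exact hmgfS _ (abs_of_pos (by positivity))
          · exact hmgfS _ (by rw [abs_neg, abs_of_pos (by positivity)])
  calc _ ≤ ENNReal.ofReal (p / (p - 1)) ^ p *
        ENNReal.ofReal (h ^ p * (p ^ p * Real.exp (-p)) * (2 * Real.exp (N * w))) := by gcongr
    _ = _ := by
        rw [ENNReal.ofReal_rpow_of_nonneg (by positivity) hp0.le,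
          ← ENNReal.ofReal_mul (by positivity)]
        congr 1
        rw [show p ^ 2 / (p - 1) = p / (p - 1) * p by ring, Real.mul_rpow (by positivity) hp0.le,
          sub_eq_add_neg (N * w : ℝ), Real.exp_add]
        ring

/-- A bounded variable `Z`, `|Z| ≤ h`, has exponential moments of its centring at `±1/h`
controlled by its second moment. -/
lemma mgf_sub_integral_le [IsProbabilityMeasure P] {Z : Ω → ℝ} (hZ : Measurable Z) {h : ℝ}
    (hh : 0 < h) (hZh : ∀ ω, |Z ω| ≤ h) {s : ℝ} (hs : |s| = h⁻¹) :
    mgf (fun ω => Z ω - ∫ ω', Z ω' ∂P) P s ≤ Real.exp ((∫ ω, Z ω ^ 2 ∂P) / h ^ 2) := by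
  set m := ∫ ω', Z ω' ∂P with hm
  have hs2 : s ^ 2 = (h ^ 2)⁻¹ := by rw [← sq_abs, hs, inv_pow]
  have hZi : Integrable Z P := Integrable.of_bound hZ.aestronglyMeasurable h
    (Filter.Eventually.of_forall fun ω => by simpa using hZh ω)
  have hZ2 : Integrable (fun ω => Z ω ^ 2) P :=
    Integrable.of_bound (hZ.pow_const 2).aestronglyMeasurable (h ^ 2)
      (Filter.Eventually.of_forall fun ω => by
        rw [Real.norm_eq_abs, abs_pow]
        exact pow_le_pow_left₀ (abs_nonneg _) (hZh ω) 2)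
  have hsZ : ∀ ω, |s * Z ω| ≤ 1 := fun ω => by
    rw [abs_mul, hs]
    calc h⁻¹ * |Z ω| ≤ h⁻¹ * h := by gcongr; exact hZh ω
      _ = 1 := inv_mul_cancel₀ hh.ne'
  have hpt : ∀ ω, Real.exp (s * Z ω) ≤ 1 + s * Z ω + s ^ 2 * Z ω ^ 2 := fun ω => by
    have := (abs_le.1 (Real.abs_exp_sub_one_sub_id_le (hsZ ω))).2
    nlinarith
  have hei : Integrable (fun ω => Real.exp (s * Z ω)) P :=
    Integrable.of_bound (hZ.const_mul s).exp.aestronglyMeasurable (Real.exp 1)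
      (Filter.Eventually.of_forall fun ω => by
        rw [Real.norm_eq_abs, Real.abs_exp]
        exact Real.exp_le_exp.2 ((le_abs_self _).trans (hsZ ω)))
  have hi1 : Integrable (fun ω => 1 + s * Z ω) P := (integrable_const 1).add (hZi.const_mul s)
  have hle : ∫ ω, Real.exp (s * Z ω) ∂P ≤ 1 + s * m + s ^ 2 * ∫ ω, Z ω ^ 2 ∂P := by
    calc _ ≤ ∫ ω, (1 + s * Z ω + s ^ 2 * Z ω ^ 2) ∂P :=
          integral_mono hei (hi1.add (hZ2.const_mul _)) hpt
      _ = _ := by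
          rw [integral_add hi1 (hZ2.const_mul _), integral_add (integrable_const 1)
            (hZi.const_mul s), integral_const_mul, integral_const_mul, ← hm]
          simp
  -- the centring costs the factor `exp (-s m)`, which absorbs the linear term
  have e : mgf (fun ω => Z ω - m) P s = Real.exp (-(s * m)) * ∫ ω, Real.exp (s * Z ω) ∂P := by
    rw [mgf, ← integral_const_mul]
    refine integral_congr_ae (Filter.Eventually.of_forall fun ω => ?_)
    simp only
    rw [← Real.exp_add]
    congr 1
    ring
  rw [e]
  calc _ ≤ Real.exp (-(s * m)) * Real.exp (s * m + s ^ 2 * ∫ ω, Z ω ^ 2 ∂P) := by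
        gcongr
        refine hle.trans ?_
        have := Real.add_one_le_exp (s * m + s ^ 2 * ∫ ω, Z ω ^ 2 ∂P)
        linarith
    _ = _ := by
        rw [← Real.exp_add, hs2]
        congr 1
        field_simp
        ring

/-- The bound on the `p`-th moment of the maximum of a martingale obtained by centring jumps of size
at most `h` whose squares sum to `w` in the mean. For `h = 0` and `p > 2` the factor `h ^ p` makes
the bound `0`, whatever the value of `w / 0`. -/
noncomputable def martingaleBound (p h w : ℝ) : ℝ :=
  if p ≤ 2 then (4 * w) ^ (p / 2)
  else h ^ p * (2 * (p ^ 2 / (p - 1)) ^ p * Real.exp (w / h ^ 2 - p))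

lemma martingaleBound_nonneg {p h w : ℝ} (hh : 0 ≤ h) (hw : 0 ≤ w) :
    0 ≤ martingaleBound p h w := by
  unfold martingaleBound
  split_ifs with hp
  · positivity
  · have : 0 < p - 1 := by linarith
    positivity

lemma martingaleBound_mono {p h w w' : ℝ} (hp : 0 < p) (hh : 0 ≤ h) (hw : 0 ≤ w) (hww : w ≤ w') :
    martingaleBound p h w ≤ martingaleBound p h w' := by
  unfold martingaleBound
  split_ifs with hp2
  · gcongr
  · have : 0 < p - 1 := by linarith
    gcongr

/-- The moments of the maximum of the centred partial sums of independent variables bounded by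
`h`. -/
lemma lintegral_maxUpTo_centred_rpow_le [IsProbabilityMeasure P] {Z : ℕ → Ω → ℝ}
    (hZ : ∀ i, Measurable (Z i)) (hind : iIndepFun Z P) {h : ℝ} (hh : 0 ≤ h)
    (hZh : ∀ i ω, |Z i ω| ≤ h) {w : ℝ} (hw : ∀ i, ∫ ω, Z i ω ^ 2 ∂P = w) (N : ℕ)
    {p : ℝ} (hp : 0 < p) :
    ∫⁻ ω, ENNReal.ofReal (maxUpTo (fun k ω =>
        |partialSum (fun i ω => Z i ω - ∫ ω', Z i ω' ∂P) k ω|) N ω) ^ p ∂P ≤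
      ENNReal.ofReal (martingaleBound p h (N * w)) := by
  set ξ : ℕ → Ω → ℝ := fun i ω => Z i ω - ∫ ω', Z i ω' ∂P with hξdef
  have hξ : ∀ i, Measurable (ξ i) := fun i => (hZ i).sub_const _
  have hξind : iIndepFun ξ P := hind.comp (fun i x => x - ∫ ω', Z i ω' ∂P) fun i => by fun_prop
  have hL : ∀ i, MemLp (Z i) 2 P := fun i =>
    MemLp.of_bound (hZ i).aestronglyMeasurable h
      (Filter.Eventually.of_forall fun ω => by simpa using hZh i ω)
  have hZi : ∀ i, Integrable (Z i) P := fun i => (hL i).integrable (by norm_num)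
  have hmi : ∀ i, |∫ ω', Z i ω' ∂P| ≤ h := fun i => by
    have := norm_integral_le_of_norm_le_const (μ := P) (f := Z i) (C := h)
      (Filter.Eventually.of_forall fun ω => by simpa using hZh i ω)
    simpa using this
  have hC : ∀ i ω, |ξ i ω| ≤ h + h := fun i ω =>
    (abs_sub _ _).trans (add_le_add (hZh i ω) (hmi i))
  have hmean : ∀ i, ∫ ω, ξ i ω ∂P = 0 := fun i => by
    simp only [hξdef]
    rw [integral_sub (hZi i) (integrable_const _)]
    simp
  unfold martingaleBound
  split_ifs with hp2
  · refine lintegral_maxUpTo_abs_rpow_le_of_le_two hξ hξind hC hmean (fun i => ?_) N hp hp2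
    rw [← hw i]
    have := variance_le_expectation_sq (hL i).aestronglyMeasurable
    rw [variance_eq_integral (hL i).aestronglyMeasurable.aemeasurable] at this
    exact this
  · rcases hh.eq_or_lt with rfl | hh
    · have hξ0 : ∀ k ω, partialSum ξ k ω = 0 := fun k ω =>
        Finset.sum_eq_zero fun i _ => abs_nonpos_iff.1 ((hC i ω).trans_eq (add_zero 0))
      simp only [hξ0, abs_zero]
      have : ∀ ω : Ω, maxUpTo (fun (_ : ℕ) (_ : Ω) => (0 : ℝ)) N ω ≤ 0 := fun ω =>
        maxUpTo_le fun _ _ => le_rfl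
      simp [ENNReal.ofReal_of_nonpos (this _), hp]
    · have := lintegral_maxUpTo_abs_rpow_le_of_mgf hξ hξind hC hmean hh (w := w / h ^ 2)
        (fun i s hs => by
          rw [← hw i]
          exact mgf_sub_integral_le (hZ i) hh (hZh i) hs) N (p := p) (by linarith)
      rwa [← mul_div_assoc] at this

end CentredWalk

/-! ### Random walks with drift, Gaussian part and jumps -/

section Walk

lemma ofReal_maxUpTo_le {Ω : Type*} {S : ℕ → Ω → ℝ} {N : ℕ} {ω : Ω} {c : ℝ≥0∞}
    (h : ∀ k ≤ N, ENNReal.ofReal (S k ω) ≤ c) : ENNReal.ofReal (maxUpTo S N ω) ≤ c := by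
  obtain ⟨k, hk, e⟩ := Finset.exists_mem_eq_sup' (Finset.nonempty_range_add_one (n := N))
    fun k => S k ω
  rw [maxUpTo, e]
  exact h k (Nat.lt_succ_iff.1 (Finset.mem_range.1 hk))

/-- The absolute moment of order `p` of a centred Gaussian variable of variance `v`. -/
noncomputable def gaussianMoment (p v : ℝ) : ℝ :=
  v ^ (p / 2) * (Real.Gamma ((p + 1) / 2) * (2 ^ (p / 2) / √Real.pi))

/-- The bound on the `p`-th moment of a sum of nonnegative jumps, in terms of the integral `a` of
the `p`-th powers of the jumps and of the mean number of jumps `q`. -/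
noncomputable def jumpBound (p : ℝ) (a q : ℝ≥0∞) : ℝ≥0∞ :=
  a * ∑ k ∈ Finset.Icc 1 ⌈p⌉₊, Nat.stirlingSecond ⌈p⌉₊ k * q ^ (k - 1)

lemma jumpBound_mono {p : ℝ} {a a' q q' : ℝ≥0∞} (ha : a ≤ a') (hq : q ≤ q') :
    jumpBound p a q ≤ jumpBound p a' q' := by
  unfold jumpBound
  gcongr

lemma ennreal_add_four_rpow_le (a b c d : ℝ≥0∞) {p : ℝ} (hp : 0 < p) :
    (a + b + c + d) ^ p ≤ 4 ^ max (p - 1) 0 * (a ^ p + b ^ p + c ^ p + d ^ p) := by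
  have h := ennreal_sum_rpow_le Finset.univ ![a, b, c, d] hp
  simpa [Fin.sum_univ_four] using h

variable {Ω : Type*} [MeasurableSpace Ω] {P : Measure Ω}

/-- The moments of the maximum of a random walk with drift `c` per step, Gaussian part `g` and
jumps `J`. The walk is split into its drift, its Gaussian part, the centred jumps of size less
than `h`, and the remaining jumps, of which the negative ones are discarded. -/
lemma lintegral_maxUpTo_walk_rpow_le [IsProbabilityMeasure P] {g J : ℕ → Ω → ℝ}
    (hg : ∀ i, Measurable (g i)) (hgind : iIndepFun g P)
    (hJ : ∀ i, Measurable (J i)) (hJind : iIndepFun J P) {v : ℝ≥0} {κ : Measure ℝ}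
    (hglaw : ∀ i, P.map (g i) = gaussianReal 0 v) (hJlaw : ∀ i, P.map (J i) = κ)
    (c : ℝ) (N : ℕ) {h : ℝ} (hh : 0 ≤ h) {p : ℝ} (hp : 0 < p) :
    ∫⁻ ω, ENNReal.ofReal (maxUpTo (partialSum fun i ω => c + g i ω + J i ω) N ω) ^ p ∂P ≤
      4 ^ max (p - 1) 0 *
        (ENNReal.ofReal (N * (c + ∫ x in Set.Ioo (-h) h, x ∂κ)) ^ p +
          ENNReal.ofReal (martingaleBound p h (N * ∫ x in Set.Ioo (-h) h, x ^ 2 ∂κ)) +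
          ENNReal.ofReal (gaussianMoment p (N * v)) +
          jumpBound p (N * ∫⁻ x in Set.Ici h, ENNReal.ofReal x ^ p ∂κ)
            (N * κ (Set.Ici h ∩ Set.Ioi 0))) := by
  -- `f` keeps the small jumps and `y` the large positive ones
  set f : ℝ → ℝ := (Set.Ioo (-h) h).indicator id with hf
  have hfm : Measurable f := measurable_id.indicator measurableSet_Ioo
  set y : ℝ → ℝ := (Set.Ici h).indicator id with hy
  have hym : Measurable y := measurable_id.indicator measurableSet_Ici
  have hy0 : ∀ x, 0 ≤ y x := fun x => Set.indicator_nonneg (fun x hx => hh.trans hx) x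
  have hfh : ∀ x, |f x| ≤ h := fun x => by
    by_cases hx : x ∈ Set.Ioo (-h) h
    · rw [hf, Set.indicator_of_mem hx]
      exact abs_le.2 ⟨hx.1.le, hx.2.le⟩
    · rw [hf, Set.indicator_of_notMem hx]
      simpa using hh
  have hxle : ∀ x, x ≤ f x + y x := fun x => by
    by_cases hx : x ∈ Set.Ioo (-h) h
    · rw [hf, Set.indicator_of_mem hx]
      linarith [hy0 x, show id x = x from rfl]
    · by_cases hx' : h ≤ x
      · rw [hf, hy, Set.indicator_of_notMem hx, Set.indicator_of_mem (show x ∈ Set.Ici h from hx')]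
        simp
      · have : x ≤ -h := by
          by_contra hcon
          exact hx ⟨not_le.1 hcon, not_le.1 hx'⟩
        rw [hf, Set.indicator_of_notMem hx]
        linarith [hy0 x]
  set Z : ℕ → Ω → ℝ := fun i ω => f (J i ω) with hZ
  set Y : ℕ → Ω → ℝ≥0∞ := fun i ω => ENNReal.ofReal (y (J i ω)) with hY
  have hZm : ∀ i, Measurable (Z i) := fun i => hfm.comp (hJ i)
  have hYm : ∀ i, Measurable (Y i) := fun i => (hym.comp (hJ i)).ennreal_ofReal
  set m := ∫ x in Set.Ioo (-h) h, x ∂κ with hm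
  have hZmean : ∀ i, ∫ ω, Z i ω ∂P = m := fun i => by
    have e := integral_map (μ := P) (hJ i).aemeasurable hfm.aestronglyMeasurable
    rw [hJlaw i] at e
    rw [hm, ← integral_indicator measurableSet_Ioo]
    exact e.symm
  have hZsq : ∀ i, ∫ ω, Z i ω ^ 2 ∂P = ∫ x in Set.Ioo (-h) h, x ^ 2 ∂κ := fun i => by
    have hsq : Measurable ((Set.Ioo (-h) h).indicator fun x : ℝ => x ^ 2) :=
      (measurable_id.pow_const 2).indicator measurableSet_Ioo
    rw [← integral_indicator measurableSet_Ioo, ← hJlaw i,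
      integral_map (hJ i).aemeasurable hsq.aestronglyMeasurable]
    refine integral_congr_ae (Filter.Eventually.of_forall fun ω => ?_)
    by_cases hx : J i ω ∈ Set.Ioo (-h) h <;> simp [hZ, hf, hx]
  have hMind : iIndepFun Z P := hJind.comp (fun _ => f) fun _ => hfm
  have hYind : iIndepFun Y P := hJind.comp (fun _ x => ENNReal.ofReal (y x)) fun _ =>
    hym.ennreal_ofReal
  have hYq : ∀ i, P {ω | Y i ω ≠ 0} = κ (Set.Ici h ∩ Set.Ioi 0) := fun i => by
    rw [← hJlaw i, Measure.map_apply (hJ i) (measurableSet_Ici.inter measurableSet_Ioi)]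
    congr 1
    ext ω
    by_cases hx : h ≤ J i ω <;> simp [hY, hy, hx]
  have hYp : ∀ i, ∫⁻ ω, Y i ω ^ p ∂P = ∫⁻ x in Set.Ici h, ENNReal.ofReal x ^ p ∂κ := fun i => by
    rw [← lintegral_indicator measurableSet_Ici, ← hJlaw i, lintegral_map
      ((by fun_prop : Measurable fun x : ℝ => ENNReal.ofReal x ^ p).indicator measurableSet_Ici)
      (hJ i)]
    refine lintegral_congr fun ω => ?_
    by_cases hx : h ≤ J i ω <;> simp [hY, hy, hx, hp]
  set M : ℕ → Ω → ℝ := partialSum fun i ω => Z i ω - ∫ ω', Z i ω' ∂P with hMdef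
  have hpt : ∀ ω, ENNReal.ofReal (maxUpTo (partialSum fun i ω => c + g i ω + J i ω) N ω) ≤
      ENNReal.ofReal (N * (c + m)) + ENNReal.ofReal (maxUpTo (fun k ω => |M k ω|) N ω) +
        ENNReal.ofReal (maxUpTo (partialSum g) N ω) + ∑ i ∈ Finset.range N, Y i ω := by
    intro ω
    refine ofReal_maxUpTo_le fun k hk => ?_
    have h1 : partialSum (fun i ω => c + g i ω + J i ω) k ω ≤
        k * (c + m) + M k ω + partialSum g k ω + ∑ i ∈ Finset.range k, y (J i ω) := by
      have : k * (c + m) = ∑ i ∈ Finset.range k, (c + m) := by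
        simp [mul_add]
      simp only [partialSum, hMdef, hZmean, this, ← Finset.sum_add_distrib]
      refine Finset.sum_le_sum fun i _ => ?_
      have := hxle (J i ω)
      simp only [hZ]
      linarith
    have h2 : ENNReal.ofReal (k * (c + m)) ≤ ENNReal.ofReal (N * (c + m)) := by
      rcases le_total 0 (c + m) with h0 | h0
      · gcongr
      · rw [ENNReal.ofReal_of_nonpos (mul_nonpos_of_nonneg_of_nonpos (Nat.cast_nonneg k) h0)]
        exact zero_le
    calc _ ≤ _ := ENNReal.ofReal_le_ofReal h1
      _ ≤ ENNReal.ofReal (k * (c + m)) + ENNReal.ofReal (M k ω) +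
          ENNReal.ofReal (partialSum g k ω) +
            ENNReal.ofReal (∑ i ∈ Finset.range k, y (J i ω)) := by
          refine ENNReal.ofReal_add_le.trans ?_
          gcongr
          refine ENNReal.ofReal_add_le.trans ?_
          gcongr
          exact ENNReal.ofReal_add_le
      _ ≤ _ := by
          gcongr
          · exact (le_abs_self _).trans (le_maxUpTo (S := fun k ω => |M k ω|) hk ω)
          · exact le_maxUpTo hk ω
          · rw [ENNReal.ofReal_sum_of_nonneg fun i _ => hy0 _]
            exact Finset.sum_le_sum_of_subset (Finset.range_subset_range.2 hk)
  have hMmeas : ∀ k, Measurable (M k) := measurable_partialSum fun i => (hZm i).sub_const _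
  have hm1 : Measurable fun ω => ENNReal.ofReal (maxUpTo (fun k ω => |M k ω|) N ω) ^ p :=
    (measurable_maxUpTo (fun k => (hMmeas k).abs) N).ennreal_ofReal.pow_const p
  have hm2 : Measurable fun ω => ENNReal.ofReal (maxUpTo (partialSum g) N ω) ^ p :=
    (measurable_maxUpTo (measurable_partialSum hg) N).ennreal_ofReal.pow_const p
  have hm01 : Measurable fun ω => ENNReal.ofReal (N * (c + m)) ^ p +
      ENNReal.ofReal (maxUpTo (fun k ω => |M k ω|) N ω) ^ p := measurable_const.add hm1
  have hm02 : Measurable fun ω => ENNReal.ofReal (N * (c + m)) ^ p +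
      ENNReal.ofReal (maxUpTo (fun k ω => |M k ω|) N ω) ^ p +
        ENNReal.ofReal (maxUpTo (partialSum g) N ω) ^ p := hm01.add hm2
  calc _ ≤ ∫⁻ ω, 4 ^ max (p - 1) 0 * (ENNReal.ofReal (N * (c + m)) ^ p +
        ENNReal.ofReal (maxUpTo (fun k ω => |M k ω|) N ω) ^ p +
        ENNReal.ofReal (maxUpTo (partialSum g) N ω) ^ p +
          (∑ i ∈ Finset.range N, Y i ω) ^ p) ∂P := by
        refine lintegral_mono fun ω => ?_
        refine le_trans ?_ (ennreal_add_four_rpow_le _ _ _ _ hp)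
        gcongr
        exact hpt ω
    _ = 4 ^ max (p - 1) 0 * (ENNReal.ofReal (N * (c + m)) ^ p +
        ∫⁻ ω, ENNReal.ofReal (maxUpTo (fun k ω => |M k ω|) N ω) ^ p ∂P +
        ∫⁻ ω, ENNReal.ofReal (maxUpTo (partialSum g) N ω) ^ p ∂P +
          ∫⁻ ω, (∑ i ∈ Finset.range N, Y i ω) ^ p ∂P) := by
        rw [lintegral_const_mul' _ _ (by finiteness),
          lintegral_add_left hm02, lintegral_add_left hm01, lintegral_add_left measurable_const]
        simp
    _ ≤ _ := by
        gcongr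
        · exact lintegral_maxUpTo_centred_rpow_le hZm hMind hh (fun i ω => hfh _) hZsq N hp
        · exact lintegral_maxUpTo_gaussian_rpow_le hg hgind hglaw N hp
        · exact lintegral_sum_rpow_le hYm hYind hYq hp hYp N

/-- The law of the jump of a walk over a time step `δ` for the finite jump measure `η`: it is
`δ η` away from `0`, the remaining mass being put at `0`. -/
noncomputable def jumpLaw (η : Measure ℝ) (δ : ℝ≥0) : Measure ℝ :=
  (1 - δ * η Set.univ) • Measure.dirac 0 + (δ : ℝ≥0∞) • η

lemma isProbabilityMeasure_jumpLaw {η : Measure ℝ} {δ : ℝ≥0} (h : δ * η Set.univ ≤ 1) :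
    IsProbabilityMeasure (jumpLaw η δ) :=
  ⟨by simp [jumpLaw, tsub_add_cancel_of_le h]⟩

lemma lintegral_jumpLaw {η : Measure ℝ} {δ : ℝ≥0} {f : ℝ → ℝ≥0∞} (hf : Measurable f)
    (h0 : f 0 = 0) : ∫⁻ x, f x ∂(jumpLaw η δ) = δ * ∫⁻ x, f x ∂η := by
  rw [jumpLaw, lintegral_add_measure, lintegral_smul_measure, lintegral_smul_measure,
    lintegral_dirac' _ hf, h0]
  simp

lemma integral_jumpLaw {E : Type*} [NormedAddCommGroup E] [NormedSpace ℝ E] [CompleteSpace E]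
    {η : Measure ℝ} {δ : ℝ≥0} {f : ℝ → E} (hf : StronglyMeasurable f)
    (hi : Integrable f η) : ∫ x, f x ∂(jumpLaw η δ) =
      (1 - (δ : ℝ≥0∞) * η Set.univ).toReal • f 0 + (δ : ℝ) • ∫ x, f x ∂η := by
  have h1 : Integrable f ((1 - (δ : ℝ≥0∞) * η Set.univ) • Measure.dirac 0) :=
    ((integrable_dirac' hf) (by simp)).smul_measure (by finiteness)
  rw [jumpLaw, integral_add_measure h1 (hi.smul_measure (by simp)), integral_smul_measure,
    integral_smul_measure, integral_dirac' _ _ hf]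
  simp

end Walk

/-! ### Comparison with approximating walks -/

section Blocks

/-- The enumeration of the variables of a block array with blocks of length `m`. -/
def blockCoord {α : Type*} (m i : ℕ) (ω : ℕ → ℕ → α) : α := ω (i / m) (i % m)

lemma partialSum_blockCoord {α : Type*} (f : α → ℝ) {m : ℕ} (hm : 0 < m) (k : ℕ) (ω : ℕ → ℕ → α) :
    partialSum (fun i ω => f (blockCoord m i ω)) (k * m) ω =
      ∑ j ∈ Finset.range k, ∑ l ∈ Finset.range m, f (ω j l) := by
  induction k with
  | zero => simp [partialSum]
  | succ k ih =>
    rw [Finset.sum_range_succ, ← ih, Nat.succ_mul, partialSum, Finset.sum_range_add]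
    congr 1
    refine Finset.sum_congr rfl fun l hl => ?_
    have hl : l < m := Finset.mem_range.1 hl
    rw [blockCoord, Nat.mul_comm k m, Nat.mul_add_div hm, Nat.mul_add_mod,
      Nat.div_eq_of_lt hl, Nat.mod_eq_of_lt hl, add_zero]

variable {α : Type*} [MeasurableSpace α]

/-- The law of infinitely many independent infinite sequences of independent variables of law
`ρ`. The `j`-th sequence carries the steps of a walk in the `j`-th block of time. -/
noncomputable def blockMeasure (ρ : Measure α) : Measure (ℕ → ℕ → α) :=
  Measure.infinitePi fun _ => Measure.infinitePi fun _ => ρ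

instance (ρ : Measure α) [IsProbabilityMeasure ρ] : IsProbabilityMeasure (blockMeasure ρ) := by
  unfold blockMeasure; infer_instance

lemma measurable_blockCoord (m i : ℕ) : Measurable (blockCoord (α := α) m i) := by
  unfold blockCoord; fun_prop

lemma iIndepFun_blockCoord (ρ : Measure α) [IsProbabilityMeasure ρ] (m : ℕ)
    {β : Type*} [MeasurableSpace β] {f : α → β} (hf : Measurable f) :
    iIndepFun (fun i ω => f (blockCoord m i ω)) (blockMeasure ρ) := by
  have h := iIndepFun_uncurry_infinitePi' (fun _ _ : ℕ => ρ) (X := fun _ _ => f) fun _ _ => hf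
  refine h.precomp (g := fun i : ℕ => (i / m, i % m)) fun i j hij => ?_
  simp only [Prod.mk.injEq] at hij
  rw [← Nat.div_add_mod i m, ← Nat.div_add_mod j m, hij.1, hij.2]

lemma map_blockCoord (ρ : Measure α) [IsProbabilityMeasure ρ] (m i : ℕ) :
    (blockMeasure ρ).map (blockCoord m i) = ρ := by
  have h1 : Measurable fun ω : ℕ → ℕ → α => ω (i / m) := by fun_prop
  have h2 : Measurable fun ω : ℕ → α => ω (i % m) := by fun_prop
  have e : blockCoord (α := α) m i = (fun ω => ω (i % m)) ∘ fun ω => ω (i / m) := rfl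
  rw [e, ← Measure.map_map h2 h1, blockMeasure, Measure.infinitePi_map_eval,
    Measure.infinitePi_map_eval]

/-- The law of the sum of the first `m` of a sequence of independent variables. -/
noncomputable def blockLaw (ρ : Measure α) (f : α → ℝ) (m : ℕ) : Measure ℝ :=
  (Measure.infinitePi fun _ : ℕ => ρ).map fun w => ∑ l ∈ Finset.range m, f (w l)

lemma charFun_blockLaw (ρ : Measure α) [IsProbabilityMeasure ρ] {f : α → ℝ} (hf : Measurable f)
    (m : ℕ) (u : ℝ) : charFun (blockLaw ρ f m) u = charFun (ρ.map f) u ^ m := by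
  have h := iIndepFun_infinitePi (P := fun _ : ℕ => ρ) (X := fun _ => f) fun _ => hf
  rw [blockLaw, (h.restrict _).charFun_map_fun_finsetSum_eq_prod fun i _ =>
    Measurable.aemeasurable (by fun_prop)]
  have hl : ∀ i : ℕ, (Measure.infinitePi fun _ : ℕ => ρ).map (fun w => f (w i)) = ρ.map f := by
    intro i
    have e : (fun w : ℕ → α => f (w i)) = f ∘ fun w => w i := rfl
    rw [e, ← Measure.map_map hf (by fun_prop), Measure.infinitePi_map_eval (fun _ => ρ) i]
  simp [hl]

lemma map_blockSums (ρ : Measure α) [IsProbabilityMeasure ρ] {f : α → ℝ} (hf : Measurable f)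
    (m n : ℕ) :
    (blockMeasure ρ).map (fun ω (j : Fin n) => ∑ l ∈ Finset.range m, f (ω j l)) =
      Measure.pi fun _ => blockLaw ρ f m := by
  have hs : Measurable fun w : ℕ → α => ∑ l ∈ Finset.range m, f (w l) := by fun_prop
  have h := (iIndepFun_infinitePi (P := fun _ : ℕ => Measure.infinitePi fun _ : ℕ => ρ)
    (X := fun _ w => ∑ l ∈ Finset.range m, f (w l)) fun _ => hs).precomp
      (Fin.val_injective (n := n))
  have h2 := h.map_fun_eq_pi_map fun i => Measurable.aemeasurable (by fun_prop)
  rw [blockMeasure]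
  refine h2.trans ?_
  congr 1
  ext1 j
  have e : (fun w : ℕ → ℕ → α => ∑ l ∈ Finset.range m, f (w j l)) =
      (fun w : ℕ → α => ∑ l ∈ Finset.range m, f (w l)) ∘ fun w => w j := rfl
  rw [blockLaw, e, ← Measure.map_map hs (by fun_prop),
    Measure.infinitePi_map_eval (fun _ : ℕ => Measure.infinitePi fun _ : ℕ => ρ) (j : ℕ)]

/-- The partial sums of a vector of increments. -/
def vecPartialSum (n k : ℕ) (x : Fin n → ℝ) : ℝ := ∑ j : Fin n, if (j : ℕ) < k then x j else 0

lemma vecPartialSum_eq {n k : ℕ} (hk : k ≤ n) (y : ℕ → ℝ) :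
    vecPartialSum n k (fun j => y j) = ∑ j ∈ Finset.range k, y j := by
  rw [vecPartialSum, Fin.sum_univ_eq_sum_range (fun j => if j < k then y j else 0),
    ← Finset.sum_filter]
  refine Finset.sum_congr ?_ fun _ _ => rfl
  ext j
  simp only [Finset.mem_filter, Finset.mem_range]
  omega

/-- **Comparison with approximating walks**. Let `D` be independent variables of law `μ`, and let
`μ` be the weak limit of the laws of the sums of `m r` independent steps. Then the moments of the
maximum of the partial sums of `D` are bounded by those of the maxima of the approximating
walks. -/
lemma lintegral_maxUpTo_le_liminf {Ω : Type*} [MeasurableSpace Ω] {P : Measure Ω}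
    [IsProbabilityMeasure P] {D : ℕ → Ω → ℝ} (hD : ∀ i, Measurable (D i)) (hind : iIndepFun D P)
    {μ : Measure ℝ} (hμ : ∀ i, P.map (D i) = μ)
    {ρ : ℕ → Measure α} [∀ r, IsProbabilityMeasure (ρ r)] {f : ℕ → α → ℝ}
    (hf : ∀ r, Measurable (f r)) {m : ℕ → ℕ} (hm : ∀ r, 0 < m r)
    (hlim : ∀ u, Tendsto (fun r => charFun ((ρ r).map (f r)) u ^ m r) atTop (𝓝 (charFun μ u)))
    (n : ℕ) {p : ℝ} (hp : 0 < p) :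
    ∫⁻ ω, ENNReal.ofReal (maxUpTo (partialSum D) n ω) ^ p ∂P ≤
      liminf (fun r => ∫⁻ ω, ENNReal.ofReal
        (maxUpTo (partialSum fun i ω => f r (blockCoord (m r) i ω)) (n * m r) ω) ^ p
          ∂(blockMeasure (ρ r))) atTop := by
  have hμp : IsProbabilityMeasure μ := by
    rw [← hμ 0]; exact Measure.isProbabilityMeasure_map (hD 0).aemeasurable
  have hβp : ∀ r, IsProbabilityMeasure (blockLaw (ρ r) (f r) (m r)) := fun r =>
    Measure.isProbabilityMeasure_map (Measurable.aemeasurable (by have := hf r; fun_prop))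
  let F : (Fin n → ℝ) → ℝ := fun x => maxUpTo (vecPartialSum n) n x ^ p
  have hmax0 : ∀ x, 0 ≤ maxUpTo (vecPartialSum n) n x := fun x => by
    have := le_maxUpTo (S := vecPartialSum n) (Nat.zero_le n) x
    simpa [vecPartialSum] using this
  have hF0 : 0 ≤ F := fun x => Real.rpow_nonneg (hmax0 x) p
  have hFc : Continuous F := by
    refine Continuous.rpow_const ?_ fun x => Or.inr hp.le
    refine Continuous.finset_sup'_apply _ fun k _ => ?_
    refine continuous_finsetSum _ fun j _ => ?_
    split_ifs <;> fun_prop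
  let μs : ℕ → ProbabilityMeasure ℝ := fun r => ⟨blockLaw (ρ r) (f r) (m r), hβp r⟩
  let μ0 : ProbabilityMeasure ℝ := ⟨μ, hμp⟩
  have h1 : Tendsto μs atTop (𝓝 μ0) := by
    refine ProbabilityMeasure.tendsto_iff_tendsto_charFun.2 fun u => ?_
    refine (hlim u).congr fun r => ?_
    exact (charFun_blockLaw (ρ r) (hf r) (m r) u).symm
  have h2 : Tendsto (fun r => ProbabilityMeasure.pi fun _ : Fin n => μs r) atTop
      (𝓝 (ProbabilityMeasure.pi fun _ : Fin n => μ0)) :=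
    (ProbabilityMeasure.continuous_pi.tendsto _).comp (tendsto_pi_nhds.2 fun _ => h1)
  have h3 := lintegral_le_liminf_lintegral_of_forall_isOpen_measure_le_liminf_measure hFc hF0
    fun G hG => ProbabilityMeasure.le_liminf_measure_open_of_tendsto h2 hG
  have hFm : Measurable fun x => ENNReal.ofReal (F x) := hFc.measurable.ennreal_ofReal
  have e1 : ∫⁻ x, ENNReal.ofReal (F x) ∂(ProbabilityMeasure.pi fun _ : Fin n => μ0).toMeasure =
      ∫⁻ ω, ENNReal.ofReal (maxUpTo (partialSum D) n ω) ^ p ∂P := by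
    have hpi := iIndepFun.map_fun_eq_pi_map (f := fun (j : Fin n) => D j)
      (fun j => (hD j).aemeasurable) (hind.precomp (Fin.val_injective (n := n)))
    simp only [hμ] at hpi
    rw [ProbabilityMeasure.toMeasure_pi]
    change ∫⁻ x, ENNReal.ofReal (F x) ∂(Measure.pi fun _ : Fin n => μ) = _
    rw [← hpi, lintegral_map hFm (measurable_pi_lambda _ fun j => hD j)]
    refine lintegral_congr fun ω => ?_
    rw [← ENNReal.ofReal_rpow_of_nonneg (hmax0 _) hp.le]
    congr 2
    refine Finset.sup'_congr _ rfl fun k hk => ?_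
    exact vecPartialSum_eq (Nat.lt_succ_iff.1 (Finset.mem_range.1 hk)) fun j => D j ω
  have e2 : ∀ r, ∫⁻ x, ENNReal.ofReal (F x)
      ∂(ProbabilityMeasure.pi fun _ : Fin n => μs r).toMeasure ≤
      ∫⁻ ω, ENNReal.ofReal
        (maxUpTo (partialSum fun i ω => f r (blockCoord (m r) i ω)) (n * m r) ω) ^ p
          ∂(blockMeasure (ρ r)) := by
    intro r
    rw [ProbabilityMeasure.toMeasure_pi]
    change ∫⁻ x, ENNReal.ofReal (F x)
      ∂(Measure.pi fun _ : Fin n => blockLaw (ρ r) (f r) (m r)) ≤ _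
    have hfr := hf r
    rw [← map_blockSums (ρ r) (hf r), lintegral_map hFm (by fun_prop)]
    refine lintegral_mono fun ω => ?_
    rw [← ENNReal.ofReal_rpow_of_nonneg (hmax0 _) hp.le]
    gcongr
    refine maxUpTo_le fun k hk => ?_
    rw [vecPartialSum_eq hk fun j => ∑ l ∈ Finset.range (m r), f r (ω j l),
      ← partialSum_blockCoord (f r) (hm r)]
    exact le_maxUpTo (Nat.mul_le_mul_right _ hk) ω
  rw [e1] at h3
  exact h3.trans (liminf_le_liminf (Eventually.of_forall e2))

end Blocks

/-! ### Approximation of the characteristic function -/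

section CharFun

/-- The integrand of the Lévy–Khintchine exponent. -/
noncomputable def levyIntegrand (u x : ℝ) : ℂ :=
  Complex.exp (Complex.I * u * x) - 1 - (if |x| < 1 then Complex.I * u * x else 0)

lemma norm_exp_I_mul_mul (u x : ℝ) : ‖Complex.exp (Complex.I * u * x)‖ = 1 := by
  rw [Complex.norm_exp]
  simp [mul_assoc]

lemma measurable_levyIntegrand (u : ℝ) : Measurable (levyIntegrand u) := by
  unfold levyIntegrand
  refine (by fun_prop : Measurable fun x : ℝ => Complex.exp (Complex.I * u * x) - 1).sub ?_
  exact Measurable.ite (measurableSet_lt (by fun_prop) measurable_const) (by fun_prop)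
    measurable_const

lemma norm_levyIntegrand_le (u x : ℝ) :
    ‖levyIntegrand u x‖ ≤ (3 * u ^ 2 + 2) * min 1 (x ^ 2) := by
  have hn : ‖Complex.I * u * x‖ = |u * x| := by simp [abs_mul]
  have h2 : ‖Complex.exp (Complex.I * u * x) - 1‖ ≤ 2 := by
    refine (norm_sub_le _ _).trans ?_
    rw [norm_exp_I_mul_mul]
    norm_num
  unfold levyIntegrand
  split_ifs with hx
  · have hx2 : x ^ 2 ≤ 1 := by
      rw [← sq_abs]
      nlinarith [abs_nonneg x]
    rw [min_eq_right hx2]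
    have key : ‖Complex.exp (Complex.I * u * x) - 1 - Complex.I * u * x‖ ≤ 3 * (u * x) ^ 2 := by
      rcases le_or_gt |u * x| 1 with h1 | h1
      · refine (Complex.norm_exp_sub_one_sub_id_le (by rwa [hn])).trans ?_
        rw [hn, sq_abs]
        nlinarith [sq_nonneg (u * x)]
      · refine (norm_sub_le _ _).trans ?_
        rw [hn, ← sq_abs (u * x)]
        nlinarith
    refine key.trans ?_
    nlinarith [sq_nonneg x]
  · rw [sub_zero, min_eq_left (by rw [← sq_abs]; nlinarith [not_lt.1 hx])]
    nlinarith [sq_nonneg u]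

lemma integrable_min_one_sq {ν : Measure ℝ} (hν : IsLevyMeasure ν) :
    Integrable (fun x : ℝ => min 1 (x ^ 2)) ν := by
  refine ⟨by fun_prop, ?_⟩
  rw [hasFiniteIntegral_iff_ofReal (Eventually.of_forall fun x => by positivity)]
  exact hν.lintegral_lt_top

lemma integrable_levyIntegrand {ν : Measure ℝ} (hν : IsLevyMeasure ν) (u : ℝ) :
    Integrable (levyIntegrand u) ν :=
  ((integrable_min_one_sq hν).const_mul (3 * u ^ 2 + 2)).mono'
    (measurable_levyIntegrand u).aestronglyMeasurable
    (Eventually.of_forall (norm_levyIntegrand_le u))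

/-- The set of jumps kept at the `r`-th stage of the approximation. -/
def truncSet (r : ℕ) : Set ℝ := {x | 1 / ((r : ℝ) + 1) ≤ |x|}

lemma measurableSet_truncSet (r : ℕ) : MeasurableSet (truncSet r) :=
  measurableSet_le measurable_const (by fun_prop)

lemma measure_truncSet_le (ν : Measure ℝ) (r : ℕ) :
    ν (truncSet r) ≤ (r + 1) ^ 2 * ∫⁻ x, ENNReal.ofReal (min 1 (x ^ 2)) ∂ν := by
  rw [← lintegral_indicator_one (measurableSet_truncSet r),
    ← lintegral_const_mul' _ _ (by finiteness)]
  refine lintegral_mono fun x => Set.indicator_apply_le' (fun hx => ?_) fun _ => zero_le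
  have hx : 1 / ((r : ℝ) + 1) ≤ |x| := hx
  have h1 : (1 : ℝ) ≤ ((r : ℝ) + 1) ^ 2 * min 1 (x ^ 2) := by
    have hr : (0 : ℝ) ≤ r := Nat.cast_nonneg r
    rw [div_le_iff₀ (by positivity)] at hx
    rcases min_cases 1 (x ^ 2) with ⟨e, -⟩ | ⟨e, -⟩ <;> rw [e]
    · nlinarith
    · rw [← sq_abs x]
      nlinarith
  calc (1 : ℝ≥0∞) = ENNReal.ofReal 1 := by simp
    _ ≤ ENNReal.ofReal (((r : ℝ) + 1) ^ 2 * min 1 (x ^ 2)) := ENNReal.ofReal_le_ofReal h1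
    _ = _ := by
        rw [ENNReal.ofReal_mul (by positivity), ENNReal.ofReal_pow (by positivity),
          ENNReal.ofReal_add (by positivity) (by norm_num)]
        simp

lemma measure_truncSet_ne_top {ν : Measure ℝ} (hν : IsLevyMeasure ν) (r : ℕ) :
    ν (truncSet r) ≠ ∞ :=
  ne_top_of_le_ne_top (ENNReal.mul_ne_top (by finiteness) hν.lintegral_lt_top.ne)
    (measure_truncSet_le ν r)

/-- The compensating drift of the jumps of size at least `h` that are kept at stage `r`. -/
noncomputable def truncDrift (ν : Measure ℝ) (b h : ℝ) (r : ℕ) : ℝ :=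
  b - ∫ x in truncSet r ∩ {x | h ≤ |x| ∧ |x| < 1}, x ∂ν

lemma measurableSet_annulus (h k : ℝ) : MeasurableSet {x : ℝ | h ≤ |x| ∧ |x| < k} := by
  have h1 : MeasurableSet {x : ℝ | h ≤ |x|} := measurableSet_le measurable_const (by fun_prop)
  have h2 : MeasurableSet {x : ℝ | |x| < k} := measurableSet_lt (by fun_prop) measurable_const
  exact h1.inter h2

lemma integrableOn_id_truncSet {ν : Measure ℝ} (hν : IsLevyMeasure ν) (r : ℕ) {s : Set ℝ}
    (hs : MeasurableSet s) (hs1 : ∀ x ∈ s, |x| ≤ 1) :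
    IntegrableOn (fun x : ℝ => x) (truncSet r ∩ s) ν := by
  refine IntegrableOn.of_bound
    ((measure_mono Set.inter_subset_left).trans_lt (measure_truncSet_ne_top hν r).lt_top)
    (by fun_prop) 1 ?_
  filter_upwards [ae_restrict_mem ((measurableSet_truncSet r).inter hs)] with x hx
  exact hs1 x hx.2

/-- The truncated exponents converge to the Lévy–Khintchine exponent. -/
lemma tendsto_truncated_exponent {ν : Measure ℝ} (hν : IsLevyMeasure ν) (b u : ℝ) :
    Tendsto (fun r => Complex.I * (truncDrift ν b 0 r) * u +
      ∫ x in truncSet r, (Complex.exp (Complex.I * u * x) - 1) ∂ν) atTop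
      (𝓝 (Complex.I * b * u + ∫ x, levyIntegrand u x ∂ν)) := by
  have h1 : ∀ r, Complex.I * (truncDrift ν b 0 r) * u +
      ∫ x in truncSet r, (Complex.exp (Complex.I * u * x) - 1) ∂ν =
      Complex.I * b * u + ∫ x, (truncSet r).indicator (levyIntegrand u) x ∂ν := by
    intro r
    have hfin : IsFiniteMeasure (ν.restrict (truncSet r)) :=
      ⟨by rw [Measure.restrict_apply_univ]; exact (measure_truncSet_ne_top hν r).lt_top⟩
    have hi1 : Integrable (fun x : ℝ => Complex.exp (Complex.I * u * x) - 1)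
        (ν.restrict (truncSet r)) := by
      refine Integrable.of_bound (by fun_prop) 2 (Eventually.of_forall fun x => ?_)
      refine (norm_sub_le _ _).trans ?_
      rw [norm_exp_I_mul_mul]
      norm_num
    have hA := measurableSet_annulus 0 1
    have hi2 : Integrable ({x : ℝ | 0 ≤ |x| ∧ |x| < 1}.indicator
        fun x : ℝ => Complex.I * u * x) (ν.restrict (truncSet r)) := by
      rw [integrable_indicator_iff hA, IntegrableOn, Measure.restrict_restrict hA, Set.inter_comm]
      exact (integrableOn_id_truncSet hν r hA fun x hx => hx.2.le).ofReal.const_mul _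
    have e : levyIntegrand u = fun x : ℝ => (Complex.exp (Complex.I * u * x) - 1) -
        {x : ℝ | 0 ≤ |x| ∧ |x| < 1}.indicator (fun x : ℝ => Complex.I * u * x) x := by
      ext x
      by_cases hx : |x| < 1 <;> simp [levyIntegrand, hx]
    rw [integral_indicator (measurableSet_truncSet r), e, integral_sub hi1 hi2,
      integral_indicator hA, Measure.restrict_restrict hA, Set.inter_comm, integral_const_mul,
      integral_complex_ofReal, truncDrift]
    push_cast
    ring
  simp only [h1]
  refine tendsto_const_nhds.add ?_
  refine tendsto_integral_of_dominated_convergence (fun x => ‖levyIntegrand u x‖)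
    (fun r => ((measurable_levyIntegrand u).indicator
      (measurableSet_truncSet r)).aestronglyMeasurable)
    (integrable_levyIntegrand hν u).norm
    (fun r => Eventually.of_forall fun x => norm_indicator_le_norm_self _ _)
    (Eventually.of_forall fun x => ?_)
  rcases eq_or_ne x 0 with rfl | hx
  · simp [Set.indicator, levyIntegrand]
  · refine tendsto_const_nhds.congr' ?_
    have := tendsto_one_div_add_atTop_nhds_zero_nat (𝕜 := ℝ)
    filter_upwards [this.eventually (gt_mem_nhds (abs_pos.2 hx))] with r hr
    rw [Set.indicator_of_mem (show x ∈ truncSet r from hr.le)]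

lemma norm_pow_sub_pow_le_of_norm_le_one {a c : ℂ} (ha : ‖a‖ ≤ 1) (hc : ‖c‖ ≤ 1) (m : ℕ) :
    ‖a ^ m - c ^ m‖ ≤ m * ‖a - c‖ := by
  induction m with
  | zero => simp
  | succ m ih =>
    have e : a ^ (m + 1) - c ^ (m + 1) = a ^ m * (a - c) + (a ^ m - c ^ m) * c := by ring
    rw [e]
    refine (norm_add_le _ _).trans ?_
    rw [norm_mul, norm_mul, norm_pow]
    have h1 : ‖a‖ ^ m ≤ 1 := pow_le_one₀ (norm_nonneg _) ha
    push_cast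
    nlinarith [norm_nonneg (a - c), norm_nonneg (a ^ m - c ^ m), norm_nonneg c]

/-- The Poisson approximation `(1 + w) ^ m ≈ exp (m w)`. -/
lemma norm_one_add_pow_sub_exp_le {w : ℂ} (h1 : ‖1 + w‖ ≤ 1) (hre : w.re ≤ 0) (hw : ‖w‖ ≤ 1)
    (m : ℕ) : ‖(1 + w) ^ m - Complex.exp (m * w)‖ ≤ m * ‖w‖ ^ 2 := by
  rw [Complex.exp_nat_mul]
  refine (norm_pow_sub_pow_le_of_norm_le_one h1 ?_ m).trans ?_
  · rw [Complex.norm_exp]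
    exact Real.exp_le_one_iff.2 hre
  · gcongr
    rw [norm_sub_rev, ← sub_sub]
    exact Complex.norm_exp_sub_one_sub_id_le hw

lemma charFun_jumpLaw {η : Measure ℝ} [IsFiniteMeasure η] {δ : ℝ≥0} (h : δ * η Set.univ ≤ 1)
    (u : ℝ) : charFun (jumpLaw η δ) u =
      1 + δ * ∫ x, (Complex.exp (Complex.I * u * x) - 1) ∂η := by
  have e : ∀ x : ℝ, Complex.exp (u * x * Complex.I) = Complex.exp (Complex.I * u * x) := by
    intro x; congr 1; ring
  have hi : Integrable (fun x : ℝ => Complex.exp (Complex.I * u * x)) η :=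
    Integrable.of_bound (by fun_prop) 1 (Eventually.of_forall fun x =>
      (norm_exp_I_mul_mul u x).le)
  rw [charFun_apply_real]
  simp only [e]
  rw [integral_jumpLaw (Continuous.stronglyMeasurable (by fun_prop)) hi,
    integral_sub hi (integrable_const 1), ENNReal.toReal_sub_of_le h (by simp),
    ENNReal.toReal_mul, integral_const, Measure.real]
  simp
  ring

/-- The joint law of the Gaussian part and of the jump of a step of length `δ`. -/
noncomputable def stepLaw (σ : ℝ) (η : Measure ℝ) (δ : ℝ≥0) : Measure (ℝ × ℝ) :=
  (gaussianReal 0 ((σ ^ 2).toNNReal * δ)).prod (jumpLaw η δ)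

lemma charFun_map_stepLaw (σ : ℝ) {η : Measure ℝ} [IsFiniteMeasure η] {δ : ℝ≥0}
    (h : δ * η Set.univ ≤ 1) (d u : ℝ) :
    charFun ((stepLaw σ η δ).map fun x => δ * d + x.1 + x.2) u =
      Complex.exp (δ * (Complex.I * d * u - σ ^ 2 * u ^ 2 / 2)) *
        (1 + δ * ∫ x, (Complex.exp (Complex.I * u * x) - 1) ∂η) := by
  have := isProbabilityMeasure_jumpLaw h
  have e : (stepLaw σ η δ).map (fun x => δ * d + x.1 + x.2) =
      (gaussianReal 0 ((σ ^ 2).toNNReal * δ) ∗ jumpLaw η δ).map fun x => δ * d + x := by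
    rw [Measure.conv, Measure.map_map (by fun_prop) (by fun_prop), stepLaw]
    congr 1
    ext x
    simp [add_assoc]
  rw [e]
  have h2 := charFun_map_const_add (μ := gaussianReal 0 ((σ ^ 2).toNNReal * δ) ∗ jumpLaw η δ)
    (δ * d : ℝ) u
  rw [h2, charFun_conv, charFun_gaussianReal, charFun_jumpLaw h, mul_right_comm,
    ← Complex.exp_add]
  congr 2
  have : ((σ ^ 2).toNNReal : ℝ) = σ ^ 2 := Real.coe_toNNReal _ (sq_nonneg σ)
  simp [← Complex.ofReal_pow, this]
  ring

/-- Convergence of the characteristic functions of the approximating walks. The hypothesis `hm0`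
makes the error of the Poisson approximation vanish. -/
lemma tendsto_charFun_stepLaw_pow {ν : Measure ℝ} (hν : IsLevyMeasure ν) (σ b : ℝ) (s : ℝ≥0)
    {m : ℕ → ℕ} (hm : ∀ r, 0 < m r)
    (hsmall : ∀ r, 2 * ((s / m r : ℝ≥0) : ℝ≥0∞) * ν (truncSet r) ≤ 1)
    (hm0 : Tendsto (fun r => (m r : ℝ) * (2 * (s / m r) * (ν (truncSet r)).toReal) ^ 2) atTop
      (𝓝 0)) (u : ℝ) :
    Tendsto (fun r => charFun ((stepLaw σ (ν.restrict (truncSet r)) (s / m r)).map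
      fun x => ((s / m r : ℝ≥0) : ℝ) * truncDrift ν b 0 r + x.1 + x.2) u ^ m r) atTop
      (𝓝 (Complex.exp ((s : ℝ) * levyExponent σ ν b u))) := by
  set z : ℕ → ℂ := fun r => ∫ x in truncSet r, (Complex.exp (Complex.I * u * x) - 1) ∂ν with hz
  set A : ℕ → ℂ := fun r =>
    Complex.exp ((s : ℝ) * (Complex.I * (truncDrift ν b 0 r) * u - σ ^ 2 * u ^ 2 / 2)) with hA
  have hfin : ∀ r, IsFiniteMeasure (ν.restrict (truncSet r)) := fun r =>
    ⟨by rw [Measure.restrict_apply_univ]; exact (measure_truncSet_ne_top hν r).lt_top⟩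
  have hsm : ∀ r, ((s / m r : ℝ≥0) : ℝ≥0∞) * (ν.restrict (truncSet r)) Set.univ ≤ 1 := fun r => by
    rw [Measure.restrict_apply_univ]
    refine le_trans ?_ (hsmall r)
    gcongr
    rw [two_mul]
    exact le_self_add
  have hms : ∀ r, (m r : ℂ) * ((s / m r : ℝ≥0) : ℝ) = (s : ℝ) := fun r => by
    have : (m r : ℂ) ≠ 0 := by exact_mod_cast (hm r).ne'
    push_cast
    field_simp
  have hpow : ∀ r, charFun ((stepLaw σ (ν.restrict (truncSet r)) (s / m r)).map
      fun x => ((s / m r : ℝ≥0) : ℝ) * truncDrift ν b 0 r + x.1 + x.2) u ^ m r =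
      A r * (1 + ((s / m r : ℝ≥0) : ℝ) * z r) ^ m r := fun r => by
    rw [charFun_map_stepLaw σ (hsm r), mul_pow, ← Complex.exp_nat_mul, ← mul_assoc]
    have := hms r
    simp only [hA, hz, this]
  have hzn : ∀ r, ‖z r‖ ≤ 2 * (ν (truncSet r)).toReal := fun r => by
    refine (norm_integral_le_of_norm_le_const (C := 2) (Eventually.of_forall fun x => ?_)).trans_eq
      (by simp [Measure.real])
    refine (norm_sub_le _ _).trans ?_
    rw [norm_exp_I_mul_mul]
    norm_num
  have hzre : ∀ r, (z r).re ≤ 0 := fun r => by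
    have hi : Integrable (fun x : ℝ => Complex.exp (Complex.I * u * x) - 1)
        (ν.restrict (truncSet r)) := by
      refine Integrable.of_bound (by fun_prop) 2 (Eventually.of_forall fun x => ?_)
      refine (norm_sub_le _ _).trans ?_
      rw [norm_exp_I_mul_mul]
      norm_num
    have := integral_re hi
    simp only [hz]
    rw [← RCLike.re_eq_complex_re, ← this]
    refine integral_nonpos fun x => ?_
    have h1 := (Complex.re_le_norm (Complex.exp (Complex.I * u * x))).trans_eq
      (norm_exp_I_mul_mul u x)
    simpa using h1
  have hwn : ∀ r, ‖((s / m r : ℝ≥0) : ℝ) * z r‖ ≤ 2 * (s / m r) * (ν (truncSet r)).toReal :=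
    fun r => by
      rw [norm_mul, Complex.norm_real, Real.norm_of_nonneg (NNReal.coe_nonneg _)]
      push_cast
      calc _ ≤ (s / m r : ℝ) * (2 * (ν (truncSet r)).toReal) := by gcongr; exact hzn r
        _ = _ := by ring
  have hw1 : ∀ r, 2 * ((s : ℝ) / m r) * (ν (truncSet r)).toReal ≤ 1 := fun r => by
    have := ENNReal.toReal_mono ENNReal.one_ne_top (hsmall r)
    simpa using this
  have hdiff : Tendsto (fun r => (1 + ((s / m r : ℝ≥0) : ℝ) * z r) ^ m r -
      Complex.exp ((s : ℝ) * z r)) atTop (𝓝 0) := by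
    refine squeeze_zero_norm (fun r => ?_) hm0
    have e : (s : ℝ) * z r = m r * (((s / m r : ℝ≥0) : ℝ) * z r) := by
      rw [← mul_assoc, hms]
    rw [e]
    have := isProbabilityMeasure_jumpLaw (hsm r)
    refine (norm_one_add_pow_sub_exp_le ?_ ?_ ((hwn r).trans (hw1 r)) (m r)).trans ?_
    · have := norm_charFun_le_one (μ := jumpLaw (ν.restrict (truncSet r)) (s / m r)) u
      rwa [charFun_jumpLaw (hsm r)] at this
    · rw [Complex.re_ofReal_mul]
      exact mul_nonpos_of_nonneg_of_nonpos (NNReal.coe_nonneg _) (hzre r)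
    · gcongr
      exact hwn r
  -- `A r` need not converge by itself, but it is bounded
  have hAn : ∀ r, ‖A r‖ ≤ 1 := fun r => by
    simp only [hA]
    rw [Complex.norm_exp, Complex.re_ofReal_mul]
    refine Real.exp_le_one_iff.2 (mul_nonpos_of_nonneg_of_nonpos (NNReal.coe_nonneg s) ?_)
    have : ((σ : ℂ) ^ 2 * u ^ 2 / 2).re = σ ^ 2 * u ^ 2 / 2 := by
      rw [show (σ : ℂ) ^ 2 * u ^ 2 / 2 = ((σ ^ 2 * u ^ 2 / 2 : ℝ) : ℂ) by push_cast; ring,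
        Complex.ofReal_re]
    rw [Complex.sub_re, this]
    simp [mul_assoc]
    positivity
  have hAd : Tendsto (fun r => A r * ((1 + ((s / m r : ℝ≥0) : ℝ) * z r) ^ m r -
      Complex.exp ((s : ℝ) * z r))) atTop (𝓝 0) := by
    refine squeeze_zero_norm (fun r => ?_) (tendsto_zero_iff_norm_tendsto_zero.1 hdiff)
    rw [norm_mul]
    exact mul_le_of_le_one_left (norm_nonneg _) (hAn r)
  have hexp : Tendsto (fun r => A r * Complex.exp ((s : ℝ) * z r)) atTop
      (𝓝 (Complex.exp ((s : ℝ) * levyExponent σ ν b u))) := by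
    have h := tendsto_truncated_exponent hν b u
    have h2 : Tendsto (fun r => Complex.exp ((s : ℝ) * ((Complex.I * (truncDrift ν b 0 r) * u +
      ∫ x in truncSet r, (Complex.exp (Complex.I * u * x) - 1) ∂ν) - σ ^ 2 * u ^ 2 / 2))) atTop
      (𝓝 (Complex.exp ((s : ℝ) * ((Complex.I * b * u + ∫ x, levyIntegrand u x ∂ν) -
        σ ^ 2 * u ^ 2 / 2)))) :=
      (Complex.continuous_exp.tendsto _).comp ((h.sub_const _).const_mul _)
    refine (h2.congr fun r => ?_).trans_eq ?_
    · simp only [hA, hz]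
      rw [← Complex.exp_add]
      congr 1
      ring
    · congr 3
      simp only [levyExponent, levyIntegrand]
      ring
  refine (hAd.add hexp).congr (fun r => ?_) |>.trans_eq (by rw [zero_add])
  rw [hpow]
  ring

end CharFun

/-! ### The bound on finite grids -/

section KeyBound

/-- The bound on the `p`-th moment of the positive part of the maximum up to time `t`: the jumps
of size at least `h` are separated from the small ones, and `D` is the drift that remains when the
small jumps are compensated. -/
noncomputable def cutoffBound (σ : ℝ) (ν : Measure ℝ) (p h D t : ℝ) : ℝ≥0∞ :=
  4 ^ max (p - 1) 0 * (ENNReal.ofReal (t * D) ^ p +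
    ENNReal.ofReal (martingaleBound p h (t * ∫ x in Set.Ioo (-h) h, x ^ 2 ∂ν)) +
    ENNReal.ofReal (gaussianMoment p (t * σ ^ 2)) +
    jumpBound p (ENNReal.ofReal t * ∫⁻ x in Set.Ici h, ENNReal.ofReal x ^ p ∂ν)
      (ENNReal.ofReal t * ν (Set.Ici h ∩ Set.Ioi 0)))

lemma lintegral_maxUpTo_stepWalk_rpow_le (σ : ℝ) {η : Measure ℝ} [IsFiniteMeasure η] {δ : ℝ≥0}
    (hδ : δ * η Set.univ ≤ 1) (d : ℝ) (m N : ℕ) {p h : ℝ} (hh : 0 ≤ h) (hp : 0 < p) :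
    ∫⁻ ω, ENNReal.ofReal (maxUpTo (partialSum fun i ω =>
      (fun x : ℝ × ℝ => δ * d + x.1 + x.2) (blockCoord m i ω)) N ω) ^ p
        ∂(blockMeasure (stepLaw σ η δ)) ≤
      cutoffBound σ η p h (d + ∫ x in Set.Ioo (-h) h, x ∂η) (N * δ) := by
  have := isProbabilityMeasure_jumpLaw hδ
  have hprob : IsProbabilityMeasure (stepLaw σ η δ) := by unfold stepLaw; infer_instance
  have hmap : ∀ (f : ℝ × ℝ → ℝ), Measurable f → ∀ i,
      (blockMeasure (stepLaw σ η δ)).map (fun ω => f (blockCoord m i ω)) =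
        (stepLaw σ η δ).map f := fun f hf i => by
    rw [← map_blockCoord (stepLaw σ η δ) m i, Measure.map_map hf (measurable_blockCoord m i)]
    rw [map_blockCoord (stepLaw σ η δ) m i]
    rfl
  have key := lintegral_maxUpTo_walk_rpow_le (P := blockMeasure (stepLaw σ η δ))
    (g := fun i ω => (blockCoord m i ω).1) (J := fun i ω => (blockCoord m i ω).2)
    (κ := jumpLaw η δ) (v := (σ ^ 2).toNNReal * δ)
    (fun i => measurable_fst.comp (measurable_blockCoord m i))
    (iIndepFun_blockCoord _ m measurable_fst)
    (fun i => measurable_snd.comp (measurable_blockCoord m i))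
    (iIndepFun_blockCoord _ m measurable_snd)
    (fun i => by rw [hmap _ measurable_fst i, stepLaw, Measure.map_fst_prod]; simp)
    (fun i => by rw [hmap _ measurable_snd i, stepLaw, Measure.map_snd_prod]; simp)
    (δ * d) N hh hp
  refine key.trans_eq ?_
  have hb : ∀ q : ℕ, q ≠ 0 → ∫ x in Set.Ioo (-h) h, x ^ q ∂(jumpLaw η δ) =
      δ * ∫ x in Set.Ioo (-h) h, x ^ q ∂η := fun q hq => by
    rw [← integral_indicator measurableSet_Ioo, ← integral_indicator measurableSet_Ioo,
      integral_jumpLaw]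
    · simp [Set.indicator_apply, hq]
    · exact ((by fun_prop : Measurable fun x : ℝ => x ^ q).indicator
        measurableSet_Ioo).stronglyMeasurable
    · rw [integrable_indicator_iff measurableSet_Ioo]
      refine IntegrableOn.of_bound (measure_lt_top _ _) (by fun_prop) (h ^ q) ?_
      filter_upwards [ae_restrict_mem measurableSet_Ioo] with x hx
      rw [norm_pow]
      gcongr
      exact abs_le.2 ⟨hx.1.le, hx.2.le⟩
  have hb1 := hb 1 one_ne_zero
  simp only [pow_one] at hb1
  have hl : ∫⁻ x in Set.Ici h, ENNReal.ofReal x ^ p ∂(jumpLaw η δ) =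
      δ * ∫⁻ x in Set.Ici h, ENNReal.ofReal x ^ p ∂η := by
    rw [← lintegral_indicator measurableSet_Ici, ← lintegral_indicator measurableSet_Ici,
      lintegral_jumpLaw]
    · exact (by fun_prop : Measurable fun x : ℝ => ENNReal.ofReal x ^ p).indicator
        measurableSet_Ici
    · simp [Set.indicator_apply, hp]
  have hA : MeasurableSet (Set.Ici h ∩ Set.Ioi 0) := measurableSet_Ici.inter measurableSet_Ioi
  have hq : jumpLaw η δ (Set.Ici h ∩ Set.Ioi 0) = δ * η (Set.Ici h ∩ Set.Ioi 0) := by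
    rw [← lintegral_indicator_one hA, ← lintegral_indicator_one hA, lintegral_jumpLaw]
    · exact measurable_const.indicator hA
    · simp
  have hN : ENNReal.ofReal (N * δ) = N * (δ : ℝ≥0∞) := by
    rw [ENNReal.ofReal_mul (Nat.cast_nonneg N)]
    simp
  rw [cutoffBound, hb1, hb 2 two_ne_zero, hl, hq, hN]
  have e1 : (N : ℝ) * (δ * d + δ * ∫ x in Set.Ioo (-h) h, x ∂η) =
      N * δ * (d + ∫ x in Set.Ioo (-h) h, x ∂η) := by ring
  have e3 : (N : ℝ) * ((σ ^ 2).toNNReal * δ : ℝ≥0) = N * δ * σ ^ 2 := by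
    push_cast
    rw [Real.coe_toNNReal _ (sq_nonneg σ)]
    ring
  rw [e1, e3]
  simp only [mul_assoc]

lemma cutoffBound_restrict_le (σ : ℝ) {ν : Measure ℝ} (hν : IsLevyMeasure ν) (r : ℕ)
    {p h D t : ℝ} (hp : 0 < p) (hh : 0 ≤ h) (hh1 : h ≤ 1) (ht : 0 ≤ t) :
    cutoffBound σ (ν.restrict (truncSet r)) p h D t ≤ cutoffBound σ ν p h D t := by
  unfold cutoffBound
  have hle : ν.restrict (truncSet r) ≤ ν := Measure.restrict_le_self
  gcongr 4 ^ max (p - 1) 0 * (_ + ENNReal.ofReal ?_ + _ + ?_)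
  · refine martingaleBound_mono hp hh ?_ ?_
    · exact mul_nonneg ht (integral_nonneg fun x => sq_nonneg x)
    · refine mul_le_mul_of_nonneg_left ?_ ht
      refine integral_mono_measure (Measure.restrict_mono_measure hle _)
        (Eventually.of_forall fun x => sq_nonneg x) ?_
      refine ((integrable_min_one_sq hν).integrableOn (s := Set.Ioo (-h) h)).congr_fun
        (fun x hx => ?_) measurableSet_Ioo
      have : |x| ≤ 1 := (abs_le.2 ⟨hx.1.le, hx.2.le⟩).trans hh1
      exact min_eq_right (by rw [← sq_abs]; exact pow_le_one₀ (abs_nonneg x) this)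
  · refine jumpBound_mono ?_ ?_ <;> gcongr

lemma truncDrift_zero_add {ν : Measure ℝ} (hν : IsLevyMeasure ν) (b : ℝ) {h : ℝ} (hh1 : h ≤ 1)
    (r : ℕ) :
    truncDrift ν b 0 r + ∫ x in Set.Ioo (-h) h, x ∂(ν.restrict (truncSet r)) =
      truncDrift ν b h r := by
  have hA := measurableSet_annulus h 1
  have hT := measurableSet_truncSet r
  have e : truncSet r ∩ {x : ℝ | 0 ≤ |x| ∧ |x| < 1} =
      (truncSet r ∩ {x | h ≤ |x| ∧ |x| < 1}) ∪ (truncSet r ∩ Set.Ioo (-h) h) := by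
    rw [← Set.inter_union_distrib_left]
    congr 1
    ext x
    simp only [Set.mem_ofPred_eq, Set.mem_union, Set.mem_Ioo, abs_nonneg, true_and, ← abs_lt]
    constructor
    · intro hx
      rcases le_or_gt h |x| with h1 | h1
      · exact Or.inl ⟨h1, hx⟩
      · exact Or.inr h1
    · rintro (hx | hx)
      · exact hx.2
      · exact hx.trans_le hh1
  rw [Measure.restrict_restrict measurableSet_Ioo, Set.inter_comm (Set.Ioo (-h) h), truncDrift,
    truncDrift, e, setIntegral_union _ (hT.inter measurableSet_Ioo)
      (integrableOn_id_truncSet hν r hA fun x hx => hx.2.le)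
      (integrableOn_id_truncSet hν r measurableSet_Ioo fun x hx =>
        (abs_le.2 ⟨hx.1.le, hx.2.le⟩).trans hh1)]
  · ring
  · refine Set.disjoint_left.2 fun x hx hx' => ?_
    exact absurd (abs_lt.2 hx'.2) (not_lt.2 hx.2.1)

/-- A number of steps per block of time `s` for which the approximating walks converge. -/
lemma exists_steps {ν : Measure ℝ} (hν : IsLevyMeasure ν) (s : ℝ≥0) :
    ∃ m : ℕ → ℕ, (∀ r, 0 < m r) ∧
      (∀ r, 2 * ((s / m r : ℝ≥0) : ℝ≥0∞) * ν (truncSet r) ≤ 1) ∧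
      Tendsto (fun r => (m r : ℝ) * (2 * (s / m r) * (ν (truncSet r)).toReal) ^ 2) atTop
        (𝓝 0) := by
  set C : ℝ := (∫⁻ x, ENNReal.ofReal (min 1 (x ^ 2)) ∂ν).toReal with hC
  have hC0 : 0 ≤ C := ENNReal.toReal_nonneg
  set K : ℕ := ⌈2 * s * C⌉₊ + 1 with hK
  have hKle : 2 * s * C ≤ K := by
    rw [hK]; push_cast; linarith [Nat.le_ceil (2 * (s : ℝ) * C)]
  have hK1 : (1 : ℝ) ≤ K := by rw [hK]; push_cast; linarith [Nat.cast_nonneg (α := ℝ) ⌈2 * s * C⌉₊]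
  have hL : ∀ r, (ν (truncSet r)).toReal ≤ (r + 1) ^ 2 * C := fun r => by
    have h := ENNReal.toReal_mono (ENNReal.mul_ne_top (by finiteness) hν.lintegral_lt_top.ne)
      (measure_truncSet_le ν r)
    rw [ENNReal.toReal_mul] at h
    have e : (((r : ℝ≥0∞) + 1) ^ 2).toReal = ((r : ℝ) + 1) ^ 2 := by
      rw [ENNReal.toReal_pow, ENNReal.toReal_add (by finiteness) (by finiteness)]
      simp
    rwa [e] at h
  have hsmall : ∀ r : ℕ, 2 * (s / (K * (r + 1) ^ 5 : ℝ)) * (ν (truncSet r)).toReal ≤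
      2 * s * C / (K * (r + 1) ^ 3) := fun r => by
    have hr : (0 : ℝ) < (r : ℝ) + 1 := by positivity
    calc _ ≤ 2 * (s / (K * (r + 1) ^ 5 : ℝ)) * ((r + 1) ^ 2 * C) := by gcongr; exact hL r
      _ = _ := by field_simp
  -- the kept jumps have mass `O((r + 1) ^ 2)`, and the error is the square of this mass up to a
  -- constant, divided by the number of steps, for which any power above the fourth would do
  refine ⟨fun r => K * (r + 1) ^ 5, fun r => by positivity, fun r => ?_, ?_⟩
  · have h1 : 2 * (s / (K * (r + 1) ^ 5 : ℝ)) * (ν (truncSet r)).toReal ≤ 1 := by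
      refine (hsmall r).trans ?_
      rw [div_le_one (by positivity)]
      have : (1 : ℝ) ≤ ((r : ℝ) + 1) ^ 3 := one_le_pow₀ (by linarith [Nat.cast_nonneg (α := ℝ) r])
      nlinarith
    rw [← ENNReal.ofReal_toReal (measure_truncSet_ne_top hν r), ← ENNReal.ofReal_one,
      ← ENNReal.ofReal_coe_nnreal, ← ENNReal.ofReal_ofNat 2, ← ENNReal.ofReal_mul (by norm_num),
      ← ENNReal.ofReal_mul (by positivity)]
    refine ENNReal.ofReal_le_ofReal ?_
    push_cast
    exact h1
  · have hlim : Tendsto (fun r : ℕ => (2 * s * C) ^ 2 / K * (1 / ((r : ℝ) + 1))) atTop (𝓝 0) := by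
      have := (tendsto_one_div_add_atTop_nhds_zero_nat (𝕜 := ℝ)).const_mul ((2 * s * C) ^ 2 / K)
      simpa using this
    refine squeeze_zero (fun r => by positivity) (fun r => ?_) hlim
    push_cast
    calc _ ≤ (K * (r + 1) ^ 5 : ℝ) * (2 * s * C / (K * (r + 1) ^ 3)) ^ 2 := by
          gcongr
          exact hsmall r
      _ = _ := by
          have hr : (0 : ℝ) < (r : ℝ) + 1 := by positivity
          field_simp

/-- The bound for the maximum of a Lévy process over a finite grid. -/
lemma lintegral_maxUpTo_grid_rpow_le {Ω : Type*} [MeasurableSpace Ω] {P : Measure Ω}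
    [IsProbabilityMeasure P] {X : ℝ≥0 → Ω → ℝ} {σ : ℝ} {ν : Measure ℝ} {b : ℝ}
    (hX : IsLevyProcess X P) (hT : HasTriplet X P σ ν b) {p h D : ℝ} (hp : 0 < p) (hh : 0 ≤ h)
    (hh1 : h ≤ 1) (hD : Tendsto (truncDrift ν b h) atTop (𝓝 D)) (s : ℝ≥0) (n : ℕ) :
    ∫⁻ ω, ENNReal.ofReal (maxUpTo (fun (k : ℕ) ω => X (k * s) ω - X 0 ω) n ω) ^ p ∂P ≤
      cutoffBound σ ν p h D (n * s) := by
  have hν := hT.isLevyMeasure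
  obtain ⟨m, hm, hsmall, hm0⟩ := exists_steps hν s
  set Y : ℕ → Ω → ℝ := fun j ω => X ((j + 1 : ℕ) * s) ω - X (j * s) ω with hY
  have hYm : ∀ j, Measurable (Y j) := fun j => (hX.measurable _).sub (hX.measurable _)
  have hmono : Monotone fun j : ℕ => (j : ℝ≥0) * s := fun i j hij => by
    have : (i : ℝ≥0) ≤ j := by exact_mod_cast hij
    dsimp only
    gcongr
  have hYind : iIndepFun Y P := hX.indep.nat hmono
  have hYlaw : ∀ j, P.map (Y j) = P.map (X s) := fun j => by
    have h1 := (hX.stationary (j * s) s).map_eq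
    have e : ((j + 1 : ℕ) : ℝ≥0) * s = j * s + s := by push_cast; ring
    rw [hY]
    simp only [e]
    rw [h1]
    refine Measure.map_congr ?_
    filter_upwards [hX.zero] with ω hω
    rw [hω, sub_zero]
  have hsum : ∀ k ω, partialSum Y k ω = X (k * s) ω - X 0 ω := fun k ω => by
    have := Finset.sum_range_sub (fun j : ℕ => X (j * s) ω) k
    simpa [partialSum, hY] using this
  have hfin : ∀ r, IsFiniteMeasure (ν.restrict (truncSet r)) := fun r =>
    ⟨by rw [Measure.restrict_apply_univ]; exact (measure_truncSet_ne_top hν r).lt_top⟩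
  have hsm : ∀ r, ((s / m r : ℝ≥0) : ℝ≥0∞) * (ν.restrict (truncSet r)) Set.univ ≤ 1 := fun r => by
    rw [Measure.restrict_apply_univ]
    refine le_trans ?_ (hsmall r)
    gcongr
    rw [two_mul]
    exact le_self_add
  have hprob : ∀ r, IsProbabilityMeasure (stepLaw σ (ν.restrict (truncSet r)) (s / m r)) :=
    fun r => by
      have := isProbabilityMeasure_jumpLaw (hsm r)
      unfold stepLaw
      infer_instance
  have key := lintegral_maxUpTo_le_liminf hYm hYind hYlaw
    (ρ := fun r => stepLaw σ (ν.restrict (truncSet r)) (s / m r))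
    (f := fun r x => ((s / m r : ℝ≥0) : ℝ) * truncDrift ν b 0 r + x.1 + x.2)
    (fun r => by fun_prop) hm
    (fun u => by
      rw [hT.charFun_eq]
      exact tendsto_charFun_stepLaw_pow hν σ b s hm hsmall hm0 u) n hp
  have e0 : partialSum Y = fun (k : ℕ) ω => X (k * s) ω - X 0 ω := by
    ext k ω
    exact hsum k ω
  rw [e0] at key
  refine key.trans ?_
  have hbd : ∀ r, ∫⁻ ω, ENNReal.ofReal (maxUpTo (partialSum fun i ω =>
      (fun x : ℝ × ℝ => ((s / m r : ℝ≥0) : ℝ) * truncDrift ν b 0 r + x.1 + x.2)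
        (blockCoord (m r) i ω)) (n * m r) ω) ^ p
          ∂(blockMeasure (stepLaw σ (ν.restrict (truncSet r)) (s / m r))) ≤
      cutoffBound σ ν p h (truncDrift ν b h r) (n * s) := fun r => by
    have h1 := lintegral_maxUpTo_stepWalk_rpow_le σ (hsm r) (truncDrift ν b 0 r) (m r) (n * m r)
      hh hp
    rw [truncDrift_zero_add hν b hh1] at h1
    have e : ((n * m r : ℕ) : ℝ) * ((s / m r : ℝ≥0) : ℝ) = n * s := by
      have : (m r : ℝ) ≠ 0 := by exact_mod_cast (hm r).ne'
      push_cast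
      field_simp
    rw [e] at h1
    exact h1.trans (cutoffBound_restrict_le σ hν r hp hh hh1 (by positivity))
  have hlim : Tendsto (fun r => cutoffBound σ ν p h (truncDrift ν b h r) (n * s)) atTop
      (𝓝 (cutoffBound σ ν p h D (n * s))) := by
    unfold cutoffBound
    refine ENNReal.Tendsto.const_mul ?_ (Or.inr (by finiteness))
    refine Tendsto.add (Tendsto.add (Tendsto.add ?_ tendsto_const_nhds) tendsto_const_nhds)
      tendsto_const_nhds
    exact (ENNReal.continuous_rpow_const.tendsto _).comp
      (ENNReal.tendsto_ofReal (hD.const_mul _))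
  exact (liminf_le_liminf (Eventually.of_forall hbd)).trans_eq hlim.liminf_eq

end KeyBound

/-! ### From finite grids to the running supremum -/

section Paths

lemma bddAbove_image_Icc_of_cadlag {x : ℝ≥0 → ℝ}
    (hx : ∀ t : ℝ≥0, ContinuousWithinAt x (Set.Ici t) t ∧
      ∃ l : ℝ, Tendsto x (𝓝[<] t) (𝓝 l)) (t : ℝ≥0) : BddAbove (x '' Set.Icc 0 t) := by
  refine (isCompact_Icc (a := (0 : ℝ≥0)) (b := t)).induction_on
    (p := fun s => BddAbove (x '' s)) (by simp)
    (fun s s' hss h => h.mono (Set.image_mono hss))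
    (fun s s' h h' => by rw [Set.image_union]; exact h.union h') fun a _ => ?_
  obtain ⟨hr, l, hl⟩ := hx a
  have h1 : ∀ᶠ s in 𝓝[≥] a, x s ≤ x a + 1 + |l| :=
    (hr.eventually (gt_mem_nhds (show x a < x a + 1 + |l| by linarith [abs_nonneg l]))).mono
      fun s hs => le_of_lt hs
  have h2 : ∀ᶠ s in 𝓝[<] a, x s ≤ max (x a) l + 1 :=
    (hl.eventually (gt_mem_nhds (show l < max (x a) l + 1 by
      linarith [le_max_right (x a) l]))).mono fun s hs => le_of_lt hs
  have h3 : ∀ᶠ s in 𝓝 a, x s ≤ max (x a + 1 + |l|) (max (x a) l + 1) := by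
    rw [← nhdsLT_sup_nhdsGE, eventually_sup]
    exact ⟨h2.mono fun s hs => hs.trans (le_max_right _ _),
      h1.mono fun s hs => hs.trans (le_max_left _ _)⟩
  refine ⟨_, mem_nhdsWithin_of_mem_nhds h3, max (x a + 1 + |l|) (max (x a) l + 1), ?_⟩
  rintro _ ⟨s, hs, rfl⟩
  exact hs

/-- A right-continuous function bounded above on `[0, t]` is controlled by its values on the grids
of mesh `t / (n + 1)`. -/
lemma tendsto_maxUpTo_grid {Ω : Type*} {X : ℝ≥0 → Ω → ℝ} {ω : Ω} (h0 : X 0 ω = 0)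
    (hr : ∀ s : ℝ≥0, ContinuousWithinAt (fun s => X s ω) (Set.Ici s) s) {t : ℝ≥0}
    (hbdd : BddAbove ((fun s => X s ω) '' Set.Icc 0 t)) :
    Tendsto (fun n : ℕ => maxUpTo (fun (k : ℕ) ω => X (k * (t / (n + 1 : ℕ))) ω - X 0 ω) (n + 1) ω)
      atTop (𝓝 (runSup X t ω)) := by
  have hbdd' : BddAbove (Set.range fun s : Set.Icc (0 : ℝ≥0) t => X s ω) := by
    refine hbdd.mono ?_
    rintro _ ⟨s, rfl⟩
    exact ⟨s, s.2, rfl⟩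
  have hcast : ∀ n : ℕ, ((n + 1 : ℕ) : ℝ≥0) ≠ 0 := fun n => by positivity
  refine tendsto_order.2 ⟨fun a ha => ?_, fun a ha => Eventually.of_forall fun n => ?_⟩
  · have : Nonempty (Set.Icc (0 : ℝ≥0) t) := ⟨⟨0, by simp⟩⟩
    obtain ⟨⟨s, hs⟩, has⟩ := exists_lt_of_lt_ciSup ha
    -- `k n` is the index of the first grid point to the right of `s`
    set k : ℕ → ℕ := fun n => ⌈s / (t / (n + 1 : ℕ))⌉₊ with hk
    have hkn : ∀ n, k n ≤ n + 1 := fun n => by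
      refine Nat.ceil_le.2 ?_
      rw [div_div_eq_mul_div]
      refine div_le_of_le_mul₀ zero_le zero_le ?_
      rw [mul_comm]
      gcongr
      exact hs.2
    have hks : ∀ n, s ≤ k n * (t / (n + 1 : ℕ)) := fun n => by
      rcases eq_or_ne t 0 with ht | ht
      · have : s = 0 := le_antisymm (hs.2.trans_eq ht) zero_le
        rw [this]
        exact zero_le
      · have hd : t / ((n + 1 : ℕ) : ℝ≥0) ≠ 0 := div_ne_zero ht (hcast n)
        calc s = s / (t / (n + 1 : ℕ)) * (t / (n + 1 : ℕ)) := (div_mul_cancel₀ s hd).symm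
          _ ≤ _ := by gcongr; exact Nat.le_ceil _
    have hks' : ∀ n, k n * (t / (n + 1 : ℕ)) ≤ s + t / (n + 1 : ℕ) := fun n => by
      rcases eq_or_ne t 0 with ht | ht
      · simp [ht]
      · have hd : t / ((n + 1 : ℕ) : ℝ≥0) ≠ 0 := div_ne_zero ht (hcast n)
        calc _ ≤ (s / (t / (n + 1 : ℕ)) + 1) * (t / (n + 1 : ℕ)) := by
              gcongr
              exact (Nat.ceil_lt_add_one zero_le).le
          _ = _ := by rw [add_mul, div_mul_cancel₀ s hd, one_mul]
    have hmesh : Tendsto (fun n : ℕ => s + t / ((n + 1 : ℕ) : ℝ≥0)) atTop (𝓝 s) := by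
      have h1 : Tendsto (fun n : ℕ => t / ((n + 1 : ℕ) : ℝ≥0)) atTop (𝓝 0) :=
        (tendsto_const_div_atTop_nhds_zero_nat t).comp (tendsto_add_atTop_nat 1)
      simpa using h1.const_add s
    have hlim : Tendsto (fun n => (k n : ℝ≥0) * (t / (n + 1 : ℕ))) atTop (𝓝[≥] s) :=
      tendsto_nhdsWithin_iff.2 ⟨tendsto_of_tendsto_of_tendsto_of_le_of_le tendsto_const_nhds hmesh
        hks hks', Eventually.of_forall hks⟩
    have hX := (hr s).tendsto.comp hlim
    filter_upwards [hX.eventually (lt_mem_nhds has)] with n hn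
    refine lt_of_lt_of_le ?_ (le_maxUpTo (hkn n) ω)
    simpa [h0] using hn
  · refine lt_of_le_of_lt (maxUpTo_le fun k hk => ?_) ha
    rw [h0, sub_zero]
    have hmem : (k : ℝ≥0) * (t / (n + 1 : ℕ)) ∈ Set.Icc 0 t := by
      refine ⟨zero_le, ?_⟩
      have hk' : (k : ℝ≥0) ≤ (n + 1 : ℕ) := by exact_mod_cast hk
      calc _ ≤ ((n + 1 : ℕ) : ℝ≥0) * (t / (n + 1 : ℕ)) := by gcongr
        _ = t := mul_div_cancel₀ t (hcast n)
    exact le_ciSup hbdd' ⟨_, hmem⟩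

variable {Ω : Type*} [MeasurableSpace Ω] {P : Measure Ω} {X : ℝ≥0 → Ω → ℝ}

lemma ae_tendsto_maxUpTo_grid (hX : IsLevyProcess X P) (t : ℝ≥0) :
    ∀ᵐ ω ∂P, Tendsto (fun n : ℕ =>
      maxUpTo (fun (k : ℕ) ω => X (k * (t / (n + 1 : ℕ))) ω - X 0 ω) (n + 1) ω)
        atTop (𝓝 (runSup X t ω)) := by
  filter_upwards [hX.zero, hX.cadlag] with ω h0 hc
  exact tendsto_maxUpTo_grid h0 (fun s => (hc s).1) (bddAbove_image_Icc_of_cadlag hc t)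

lemma measurable_maxUpTo_grid (hX : IsLevyProcess X P) (s : ℝ≥0) (n : ℕ) :
    Measurable (maxUpTo (fun (k : ℕ) ω => X (k * s) ω - X 0 ω) n) :=
  measurable_maxUpTo (fun _ => (hX.measurable _).sub (hX.measurable _)) n

lemma aemeasurable_runSup (hX : IsLevyProcess X P) (t : ℝ≥0) : AEMeasurable (runSup X t) P :=
  aemeasurable_of_tendsto_metrizable_ae atTop
    (fun n => (measurable_maxUpTo_grid hX _ (n + 1)).aemeasurable) (ae_tendsto_maxUpTo_grid hX t)

lemma ae_runSup_nonneg (hX : IsLevyProcess X P) (t : ℝ≥0) : ∀ᵐ ω ∂P, 0 ≤ runSup X t ω := by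
  filter_upwards [ae_tendsto_maxUpTo_grid hX t] with ω hω
  refine ge_of_tendsto' hω fun n => ?_
  have := le_maxUpTo (S := fun (k : ℕ) ω => X (k * (t / (n + 1 : ℕ))) ω - X 0 ω)
    (Nat.zero_le (n + 1)) ω
  simpa using this

lemma integrable_runSup_rpow_and_integral_le (hX : IsLevyProcess X P) (t : ℝ≥0) {p B : ℝ}
    (hp : 0 < p) (hB : 0 ≤ B)
    (h : ∫⁻ ω, ENNReal.ofReal (runSup X t ω) ^ p ∂P ≤ ENNReal.ofReal B) :
    Integrable (fun ω => runSup X t ω ^ p) P ∧ ∫ ω, runSup X t ω ^ p ∂P ≤ B := by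
  have h0 : 0 ≤ᵐ[P] fun ω => runSup X t ω ^ p := by
    filter_upwards [ae_runSup_nonneg hX t] with ω hω using Real.rpow_nonneg hω p
  have hm : AEStronglyMeasurable (fun ω => runSup X t ω ^ p) P :=
    ((aemeasurable_runSup hX t).pow_const p).aestronglyMeasurable
  have e : ∫⁻ ω, ENNReal.ofReal (runSup X t ω ^ p) ∂P =
      ∫⁻ ω, ENNReal.ofReal (runSup X t ω) ^ p ∂P := by
    refine lintegral_congr_ae ?_
    filter_upwards [ae_runSup_nonneg hX t] with ω hω
    exact (ENNReal.ofReal_rpow_of_nonneg hω hp.le).symm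
  refine ⟨⟨hm, ?_⟩, ?_⟩
  · rw [hasFiniteIntegral_iff_ofReal h0, e]
    exact h.trans_lt ENNReal.ofReal_lt_top
  · rw [integral_eq_lintegral_of_nonneg_ae h0 hm, e]
    exact ENNReal.toReal_le_of_le_ofReal hB h

variable [IsProbabilityMeasure P] {σ : ℝ} {ν : Measure ℝ} {b : ℝ}

lemma lintegral_runSup_rpow_le (hX : IsLevyProcess X P) (hT : HasTriplet X P σ ν b) {p h D : ℝ}
    (hp : 0 < p) (hh : 0 ≤ h) (hh1 : h ≤ 1) (hD : Tendsto (truncDrift ν b h) atTop (𝓝 D))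
    (t : ℝ≥0) :
    ∫⁻ ω, ENNReal.ofReal (runSup X t ω) ^ p ∂P ≤ cutoffBound σ ν p h D t := by
  have h1 : ∫⁻ ω, ENNReal.ofReal (runSup X t ω) ^ p ∂P =
      ∫⁻ ω, liminf (fun n : ℕ => ENNReal.ofReal (maxUpTo
        (fun (k : ℕ) ω => X (k * (t / (n + 1 : ℕ))) ω - X 0 ω) (n + 1) ω) ^ p) atTop ∂P := by
    refine lintegral_congr_ae ?_
    filter_upwards [ae_tendsto_maxUpTo_grid hX t] with ω hω
    exact (((ENNReal.continuous_rpow_const.tendsto _).comp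
      (ENNReal.tendsto_ofReal hω)).liminf_eq).symm
  rw [h1]
  refine (lintegral_liminf_le fun n =>
    (measurable_maxUpTo_grid hX _ (n + 1)).ennreal_ofReal.pow_const p).trans ?_
  refine (liminf_le_liminf (Eventually.of_forall fun n => lintegral_maxUpTo_grid_rpow_le hX hT
    hp hh hh1 hD (t / (n + 1 : ℕ)) (n + 1))).trans_eq ?_
  have e : ∀ n : ℕ, ((n + 1 : ℕ) : ℝ) * ((t / (n + 1 : ℕ) : ℝ≥0) : ℝ) = t := fun n => by
    push_cast
    field_simp
  simp only [e]
  simp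

end Paths

/-! ### Moments of the Lévy measure and the Blumenthal–Getoor index -/

section Index

variable {ν : Measure ℝ}

lemma absMoment_mono_set {A B : Set ℝ} (h : A ⊆ B) (p : ℝ) :
    absMoment ν A p ≤ absMoment ν B p :=
  lintegral_mono_set h

lemma I0_antitone {p q : ℝ} (hp : 0 ≤ p) (hpq : p ≤ q) : I0 ν q ≤ I0 ν p := by
  refine setLIntegral_mono' measurableSet_Ioo fun x hx => ENNReal.ofReal_le_ofReal ?_
  exact Real.rpow_le_rpow_of_exponent_ge' (abs_nonneg x) (abs_le.2 ⟨hx.1.le, hx.2.le⟩) hp hpq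

lemma I0_two_lt_top (hν : IsLevyMeasure ν) : I0 ν 2 < ∞ := by
  refine lt_of_le_of_lt ?_ hν.lintegral_lt_top
  refine (setLIntegral_mono' measurableSet_Ioo fun x hx => ENNReal.ofReal_le_ofReal ?_).trans
    (setLIntegral_le_lintegral _ _)
  have : |x| ≤ 1 := abs_le.2 ⟨hx.1.le, hx.2.le⟩
  rw [Real.rpow_two]
  exact le_min (pow_le_one₀ (abs_nonneg x) this) (sq_abs x).le

lemma bddBelow_bgIndex : BddBelow {p : ℝ | 0 < p ∧ I0 ν p < ∞} := ⟨0, fun _ hp => hp.1.le⟩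

lemma bgIndex_nonneg : 0 ≤ bgIndex ν := Real.sInf_nonneg fun _ hp => hp.1.le

lemma bgIndex_le {p : ℝ} (hp : 0 < p) (h : I0 ν p < ∞) : bgIndex ν ≤ p :=
  csInf_le bddBelow_bgIndex ⟨hp, h⟩

lemma bgIndexPlus_nonneg {δ : ℝ}
    (hδ : I0 ν (bgIndex ν) = ∞ →
      0 < δ ∧ δ < 2 - bgIndex ν ∧ (bgIndex ν < 1 → bgIndex ν + δ < 1)) :
    0 ≤ bgIndexPlus ν δ := by
  unfold bgIndexPlus
  split_ifs with h
  · linarith [bgIndex_nonneg (ν := ν), hδ h]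
  · linarith [bgIndex_nonneg (ν := ν)]

lemma bgIndexPlus_le_two (hν : IsLevyMeasure ν) {δ : ℝ}
    (hδ : I0 ν (bgIndex ν) = ∞ →
      0 < δ ∧ δ < 2 - bgIndex ν ∧ (bgIndex ν < 1 → bgIndex ν + δ < 1)) :
    bgIndexPlus ν δ ≤ 2 := by
  unfold bgIndexPlus
  split_ifs with h
  · linarith [hδ h]
  · linarith [bgIndex_le two_pos (I0_two_lt_top hν)]

lemma I0_bgIndexPlus_lt_top (hν : IsLevyMeasure ν) {δ : ℝ}
    (hδ : I0 ν (bgIndex ν) = ∞ →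
      0 < δ ∧ δ < 2 - bgIndex ν ∧ (bgIndex ν < 1 → bgIndex ν + δ < 1)) :
    I0 ν (bgIndexPlus ν δ) < ∞ := by
  unfold bgIndexPlus
  split_ifs with h
  · obtain ⟨p, ⟨hp0, hp⟩, hlt⟩ := exists_lt_of_csInf_lt
      (s := {p : ℝ | 0 < p ∧ I0 ν p < ∞}) ⟨2, two_pos, I0_two_lt_top hν⟩
      (show sInf {p : ℝ | 0 < p ∧ I0 ν p < ∞} < bgIndex ν + δ by
        change bgIndex ν < _
        linarith [hδ h])
    exact (I0_antitone hp0.le hlt.le).trans_lt hp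
  · rw [add_zero]
    exact lt_top_iff_ne_top.2 h

/-- Jumps of finite variation correspond to `β_+ ≤ 1`, by the choice of `δ`. -/
lemma I0_one_eq_top_iff (hν : IsLevyMeasure ν) {δ : ℝ}
    (hδ : I0 ν (bgIndex ν) = ∞ →
      0 < δ ∧ δ < 2 - bgIndex ν ∧ (bgIndex ν < 1 → bgIndex ν + δ < 1)) :
    I0 ν 1 = ∞ ↔ 1 < bgIndexPlus ν δ := by
  constructor
  · intro h
    by_contra hcon
    have := (I0_antitone (bgIndexPlus_nonneg hδ) (not_lt.1 hcon)).trans_lt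
      (I0_bgIndexPlus_lt_top hν hδ)
    exact this.ne h
  · intro h
    by_contra hcon
    have hle := bgIndex_le one_pos (lt_top_iff_ne_top.2 hcon)
    unfold bgIndexPlus at h
    split_ifs at h with htop
    · have hlt : bgIndex ν < 1 := lt_of_le_of_ne hle fun e => hcon (e ▸ htop)
      linarith [(hδ htop).2.2 hlt]
    · linarith

/-- On `[h, 1]`, bounding a power by one of higher order costs a negative power of `h`, and bounding
it by one of lower order costs nothing.
The alternative in `hc` allows `h = 0` where no negative power occurs. -/
lemma rpow_le_cutoff_mul_rpow {p β h y : ℝ} (hβ : 0 ≤ β) (hh : 0 ≤ h) (hy : h ≤ y) (hy1 : y ≤ 1)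
    (hc : 0 < h ∨ β ≤ p) : y ^ p ≤ h ^ (-max (β - p) 0) * y ^ β := by
  rcases le_or_gt β p with hp | hp
  · rw [max_eq_right (by linarith), neg_zero, Real.rpow_zero, one_mul]
    exact Real.rpow_le_rpow_of_exponent_ge' (hh.trans hy) hy1 hβ hp
  · have hh : 0 < h := hc.resolve_right (not_le.2 hp)
    have hy0 : 0 < y := hh.trans_le hy
    rw [max_eq_left (by linarith)]
    calc y ^ p = y ^ (-(β - p)) * y ^ β := by rw [← Real.rpow_add hy0]; congr 1; ring
      _ ≤ _ := by
        refine mul_le_mul_of_nonneg_right ?_ (Real.rpow_nonneg hy0.le _)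
        exact Real.rpow_le_rpow_of_nonpos hh hy (by linarith)

/-- Moments of the jumps of size at least `h` in terms of a moment of order `β`. -/
lemma absMoment_le_of_le_abs {p β h : ℝ} (hβ : 0 ≤ β) (hh : 0 ≤ h) {A : Set ℝ}
    (hA : MeasurableSet A) (hA1 : ∀ x ∈ A, h ≤ |x| ∧ |x| < 1) (hc : 0 < h ∨ β ≤ p) :
    absMoment ν A p ≤ ENNReal.ofReal (h ^ (-max (β - p) 0)) * absMoment ν A β := by
  unfold absMoment
  rw [← lintegral_const_mul' _ _ ENNReal.ofReal_ne_top]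
  refine setLIntegral_mono' hA fun x hx => ?_
  rw [← ENNReal.ofReal_mul (Real.rpow_nonneg hh _)]
  exact ENNReal.ofReal_le_ofReal
    (rpow_le_cutoff_mul_rpow hβ hh (hA1 x hx).1 (hA1 x hx).2.le hc)

/-- Moments of the jumps of size below `h` in terms of a moment of lower order `β`. -/
lemma absMoment_Ioo_le {q β h : ℝ} (hβ : 0 ≤ β) (hq : β ≤ q) (hh1 : h ≤ 1) :
    absMoment ν (Set.Ioo (-h) h) q ≤ ENNReal.ofReal (h ^ (q - β)) * I0 ν β := by
  rcases le_or_gt h 0 with hh | hh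
  · rw [absMoment, Set.Ioo_eq_empty (by linarith)]
    simp
  have h1 : absMoment ν (Set.Ioo (-h) h) q ≤
      ENNReal.ofReal (h ^ (q - β)) * absMoment ν (Set.Ioo (-h) h) β := by
    unfold absMoment
    rw [← lintegral_const_mul' _ _ ENNReal.ofReal_ne_top]
    refine setLIntegral_mono' measurableSet_Ioo fun x hx => ?_
    rw [← ENNReal.ofReal_mul (Real.rpow_nonneg hh.le _)]
    refine ENNReal.ofReal_le_ofReal ?_
    have hx' : |x| < h := abs_lt.2 hx
    calc |x| ^ q = |x| ^ (q - β + β) := by rw [sub_add_cancel]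
      _ ≤ |x| ^ (q - β) * |x| ^ β := by
        rcases (abs_nonneg x).eq_or_lt with h0 | h0
        · rw [← h0]
          rcases hβ.eq_or_lt with rfl | hβ'
          · simp
          · rw [Real.zero_rpow (by linarith), Real.zero_rpow hβ'.ne', mul_zero]
        · exact (Real.rpow_add h0 _ _).le
      _ ≤ _ := by gcongr
  refine h1.trans ?_
  gcongr
  exact absMoment_mono_set (Set.Ioo_subset_Ioo (by linarith) hh1) β

/-- The moments of the positive jumps of size at least `h`. -/
lemma absMoment_Ici_inter_Ioi_le {p β h : ℝ} (hβ : 0 ≤ β) (hh : 0 ≤ h)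
    (hIβ : I0 ν β < ∞) (hc : 0 < h ∨ β ≤ p) :
    absMoment ν (Set.Ici h ∩ Set.Ioi 0) p ≤
      Iplus ν p + ENNReal.ofReal (h ^ (-max (β - p) 0) * Iprime ν β) := by
  have hsub : Set.Ioo (0 : ℝ) 1 ⊆ Set.Ioo (-1) 1 := Set.Ioo_subset_Ioo (by norm_num) le_rfl
  have hfin : absMoment ν (Set.Ioo 0 1) β ≠ ∞ :=
    ((absMoment_mono_set hsub β).trans_lt hIβ).ne
  have hA : MeasurableSet (Set.Ici h ∩ Set.Ioo 0 1) := measurableSet_Ici.inter measurableSet_Ioo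
  calc absMoment ν (Set.Ici h ∩ Set.Ioi 0) p
      ≤ absMoment ν (Set.Ici 1 ∪ Set.Ici h ∩ Set.Ioo 0 1) p := by
        refine absMoment_mono_set (fun x hx => ?_) p
        rcases le_or_gt 1 x with h1 | h1
        · exact Or.inl h1
        · exact Or.inr ⟨hx.1, hx.2, h1⟩
    _ ≤ absMoment ν (Set.Ici 1) p + absMoment ν (Set.Ici h ∩ Set.Ioo 0 1) p :=
        lintegral_union_le _ _ _
    _ ≤ _ := by
        rw [Iplus, Iprime, ENNReal.ofReal_mul (Real.rpow_nonneg hh _), ENNReal.ofReal_toReal hfin]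
        gcongr
        refine (absMoment_le_of_le_abs hβ hh hA (fun x hx => ?_) hc).trans ?_
        · rw [abs_of_pos hx.2.1]
          exact ⟨hx.1, hx.2.2⟩
        · gcongr
          exact absMoment_mono_set Set.inter_subset_right β

lemma lintegral_Ici_ofReal_rpow {p h : ℝ} (hp : 0 < p) (hh : 0 ≤ h) :
    ∫⁻ x in Set.Ici h, ENNReal.ofReal x ^ p ∂ν = absMoment ν (Set.Ici h ∩ Set.Ioi 0) p := by
  rw [absMoment, Set.inter_comm, ← Measure.restrict_restrict measurableSet_Ioi,
    ← lintegral_indicator measurableSet_Ioi]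
  refine setLIntegral_congr_fun measurableSet_Ici fun x hx => ?_
  rcases (hh.trans hx).eq_or_lt with rfl | hx0
  · simp [hp]
  · rw [Set.indicator_of_mem (show x ∈ Set.Ioi 0 from hx0), abs_of_pos hx0,
      ENNReal.ofReal_rpow_of_pos hx0]

lemma absMoment_zero (A : Set ℝ) : absMoment ν A 0 = ν A := by simp [absMoment]

/-- The compensated drift converges as soon as the jumps of size in `[h, 1)` are integrable. -/
lemma tendsto_truncDrift {h : ℝ}
    (hi : IntegrableOn (fun x : ℝ => x) {x | h ≤ |x| ∧ |x| < 1} ν) (b : ℝ) :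
    Tendsto (truncDrift ν b h) atTop (𝓝 (b - ∫ x in {x | h ≤ |x| ∧ |x| < 1}, x ∂ν)) := by
  refine tendsto_const_nhds.sub ?_
  have e : ∀ r, ∫ x in truncSet r ∩ {x | h ≤ |x| ∧ |x| < 1}, x ∂ν =
      ∫ x in {x | h ≤ |x| ∧ |x| < 1}, (truncSet r).indicator (fun x => x) x ∂ν := fun r => by
    rw [integral_indicator (measurableSet_truncSet r),
      Measure.restrict_restrict (measurableSet_truncSet r)]
  simp only [e]
  refine tendsto_integral_of_dominated_convergence (fun x => ‖x‖)
    (fun r => (measurable_id.indicator (measurableSet_truncSet r)).aestronglyMeasurable) hi.norm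
    (fun r => Eventually.of_forall fun x => norm_indicator_le_norm_self _ _)
    (Eventually.of_forall fun x => ?_)
  rcases eq_or_ne x 0 with rfl | hx
  · simp [Set.indicator]
  · refine tendsto_const_nhds.congr' ?_
    have := tendsto_one_div_add_atTop_nhds_zero_nat (𝕜 := ℝ)
    filter_upwards [this.eventually (gt_mem_nhds (abs_pos.2 hx))] with r hr
    rw [Set.indicator_of_mem (show x ∈ truncSet r from hr.le)]

lemma integrableOn_id_of_absMoment_lt_top {A : Set ℝ} (h : absMoment ν A 1 < ∞) :
    IntegrableOn (fun x : ℝ => x) A ν := by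
  refine ⟨by fun_prop, ?_⟩
  rw [hasFiniteIntegral_iff_norm]
  simpa [absMoment] using h

lemma abs_setIntegral_id_le (A : Set ℝ) :
    |∫ x in A, x ∂ν| ≤ (absMoment ν A 1).toReal := by
  refine (abs_integral_le_integral_abs).trans_eq ?_
  rw [integral_eq_lintegral_of_nonneg_ae (Eventually.of_forall fun x => abs_nonneg x)
    (by fun_prop)]
  simp [absMoment]

lemma setIntegral_sq_eq (A : Set ℝ) :
    ∫ x in A, x ^ 2 ∂ν = (absMoment ν A 2).toReal := by
  rw [integral_eq_lintegral_of_nonneg_ae (Eventually.of_forall fun x => sq_nonneg x)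
    (by fun_prop)]
  simp [absMoment]

end Index

/-! ### The cutoff level -/

section CutoffLevel

/-- The level at which jumps are cut off when the supremum is taken up to time `t`: the jumps of a
process of index `β` are of order `t ^ (1 / β)` at small times. For `β = 0` no jump is small. -/
noncomputable def cutoffLevel (β T t : ℝ) : ℝ := if β = 0 then 0 else (t / T) ^ (1 / β)

variable {β T t : ℝ}

lemma cutoffLevel_nonneg (hT : 0 < T) (ht : 0 < t) : 0 ≤ cutoffLevel β T t := by
  unfold cutoffLevel
  split_ifs
  · exact le_rfl
  · positivity

lemma cutoffLevel_pos (hT : 0 < T) (ht : 0 < t) (hβ : β ≠ 0) : 0 < cutoffLevel β T t := by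
  rw [cutoffLevel, if_neg hβ]
  positivity

lemma cutoffLevel_le_one (hT : 0 < T) (ht : 0 < t) (htT : t ≤ T) (hβ : 0 ≤ β) :
    cutoffLevel β T t ≤ 1 := by
  unfold cutoffLevel
  split_ifs
  · exact zero_le_one
  · exact Real.rpow_le_one (by positivity) ((div_le_one hT).2 htT) (by positivity)

lemma cutoffLevel_rpow (hT : 0 < T) (ht : 0 < t) (hβ : β ≠ 0) (q : ℝ) :
    cutoffLevel β T t ^ q = (t / T) ^ (q / β) := by
  rw [cutoffLevel, if_neg hβ, ← Real.rpow_mul (by positivity)]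
  congr 1
  ring

lemma mul_cutoffLevel_rpow_sub (hT : 0 < T) (ht : 0 < t) (hβ : β ≠ 0) (q : ℝ) :
    t * cutoffLevel β T t ^ (q - β) = T * cutoffLevel β T t ^ q := by
  have hd : 0 < t / T := by positivity
  rw [cutoffLevel_rpow hT ht hβ, cutoffLevel_rpow hT ht hβ, sub_div, div_self hβ,
    Real.rpow_sub hd, Real.rpow_one]
  field_simp

lemma mul_cutoffLevel_rpow_neg_max (hT : 0 < T) (ht : 0 < t) (hβ : 0 ≤ β) {p : ℝ} (hp : 0 ≤ p) :
    t * cutoffLevel β T t ^ (-max (β - p) 0) = T ^ oneSubDivPos p β * t ^ minOneDiv p β := by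
  rcases eq_or_ne β 0 with rfl | hβ0
  · simp [oneSubDivPos, minOneDiv, hp]
  have hβ' : 0 < β := lt_of_le_of_ne hβ hβ0.symm
  rw [cutoffLevel_rpow hT ht hβ0, oneSubDivPos, minOneDiv, if_neg hβ0, if_neg hβ0]
  rcases le_total β p with h | h
  · have h1 : 1 ≤ p / β := (one_le_div hβ').2 h
    rw [max_eq_right (by linarith), max_eq_right (by linarith), min_eq_left h1]
    simp
  · have h1 : p / β ≤ 1 := (div_le_one hβ').2 h
    rw [max_eq_left (by linarith), max_eq_left (by linarith), min_eq_right h1, neg_div, sub_div,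
      div_self hβ0, Real.rpow_neg (by positivity), Real.div_rpow ht.le hT.le, inv_div,
      Real.rpow_sub ht, Real.rpow_one]
    have := Real.rpow_pos_of_pos ht (p / β)
    field_simp

lemma mul_cutoffLevel_rpow_neg_le (hT : 0 < T) (ht : 0 < t) (htT : t ≤ T) :
    t * cutoffLevel β T t ^ (-β) ≤ T := by
  rcases eq_or_ne β 0 with rfl | hβ0
  · simpa using htT
  · have := mul_cutoffLevel_rpow_sub hT ht hβ0 0
    rw [zero_sub, Real.rpow_zero, mul_one] at this
    exact this.le

end CutoffLevel

section Terms

variable {ν : Measure ℝ} {β T t : ℝ}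

/-- The contribution of the jumps above the cutoff level. -/
lemma jumpBound_cutoffLevel_le (hν : IsLevyMeasure ν) (hT : 0 < T) (ht : 0 < t) (htT : t ≤ T)
    (hβ : 0 ≤ β) (hIβ : I0 ν β < ∞) {p : ℝ} (hp : 0 < p) (hIp : Iplus ν p < ∞) :
    jumpBound p (ENNReal.ofReal t *
        ∫⁻ x in Set.Ici (cutoffLevel β T t), ENNReal.ofReal x ^ p ∂ν)
      (ENNReal.ofReal t * ν (Set.Ici (cutoffLevel β T t) ∩ Set.Ioi 0)) ≤
      ENNReal.ofReal (C₄ ν T β p * t ^ minOneDiv p β) := by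
  set h := cutoffLevel β T t with hh
  have hh0 : 0 ≤ h := cutoffLevel_nonneg hT ht
  have hI' : 0 ≤ Iprime ν β := ENNReal.toReal_nonneg
  have hν1 : ν (Set.Ici 1) ≠ ∞ := by
    refine ne_top_of_le_ne_top (measure_truncSet_ne_top hν 0) (measure_mono fun x hx => ?_)
    have h1 : (1 : ℝ) ≤ x := hx
    simpa [truncSet] using h1.trans (le_abs_self x)
  have ha : ENNReal.ofReal t * ∫⁻ x in Set.Ici h, ENNReal.ofReal x ^ p ∂ν ≤
      ENNReal.ofReal (T ^ oneSubDivPos p β * t ^ minOneDiv p β *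
        ((Iplus ν p).toReal + Iprime ν β)) := by
    have hc : 0 < h ∨ β ≤ p := by
      rcases eq_or_ne β 0 with rfl | hβ0
      · exact Or.inr hp.le
      · exact Or.inl (cutoffLevel_pos hT ht hβ0)
    rw [lintegral_Ici_ofReal_rpow hp hh0, ← mul_cutoffLevel_rpow_neg_max hT ht hβ hp.le, ← hh]
    have hone : 1 ≤ h ^ (-max (β - p) 0) := by
      rcases hc with hc | hc
      · exact Real.one_le_rpow_of_pos_of_le_one_of_nonpos hc (cutoffLevel_le_one hT ht htT hβ)
          (by simp)
      · rw [max_eq_right (by linarith)]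
        simp
    calc _ ≤ ENNReal.ofReal t *
          (Iplus ν p + ENNReal.ofReal (h ^ (-max (β - p) 0) * Iprime ν β)) := by
          gcongr
          exact absMoment_Ici_inter_Ioi_le hβ hh0 hIβ hc
      _ = ENNReal.ofReal (t * ((Iplus ν p).toReal + h ^ (-max (β - p) 0) * Iprime ν β)) := by
          rw [ENNReal.ofReal_mul ht.le, ENNReal.ofReal_add ENNReal.toReal_nonneg (by positivity),
            ENNReal.ofReal_toReal hIp.ne]
      _ ≤ _ := by
          refine ENNReal.ofReal_le_ofReal ?_
          rw [mul_assoc]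
          refine mul_le_mul_of_nonneg_left ?_ ht.le
          rw [mul_add]
          gcongr
          exact le_mul_of_one_le_left ENNReal.toReal_nonneg hone
  have hq : ENNReal.ofReal t * ν (Set.Ici h ∩ Set.Ioi 0) ≤
      ENNReal.ofReal (T * (Iprime ν β + (ν (Set.Ici 1)).toReal)) := by
    have hc : 0 < h ∨ β ≤ 0 := by
      rcases eq_or_ne β 0 with rfl | hβ0
      · exact Or.inr le_rfl
      · exact Or.inl (cutoffLevel_pos hT ht hβ0)
    have h1 := absMoment_Ici_inter_Ioi_le (p := 0) hβ hh0 hIβ hc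
    rw [absMoment_zero, Iplus, absMoment_zero, sub_zero, max_eq_left hβ] at h1
    calc _ ≤ ENNReal.ofReal t *
          (ν (Set.Ici 1) + ENNReal.ofReal (h ^ (-β) * Iprime ν β)) := by gcongr
      _ = ENNReal.ofReal (t * ((ν (Set.Ici 1)).toReal + h ^ (-β) * Iprime ν β)) := by
          rw [ENNReal.ofReal_mul ht.le, ENNReal.ofReal_add ENNReal.toReal_nonneg (by positivity),
            ENNReal.ofReal_toReal hν1]
      _ ≤ _ := by
          refine ENNReal.ofReal_le_ofReal ?_
          have h2 := mul_cutoffLevel_rpow_neg_le (β := β) hT ht htT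
          rw [← hh] at h2
          rw [mul_add, mul_add, ← mul_assoc, add_comm]
          gcongr
  refine (jumpBound_mono ha hq).trans_eq ?_
  have hs : ∀ k ∈ Finset.Icc 1 ⌈p⌉₊, 0 ≤ (Nat.stirlingSecond ⌈p⌉₊ k : ℝ) * T ^ (k - 1) *
      (Iprime ν β + (ν (Set.Ici 1)).toReal) ^ (k - 1) := fun k _ => by positivity
  have e : ∀ a b c d : ℝ, a * b * c * d = a * d * b * c := fun a b c d => by ring
  rw [jumpBound, C₄, e, ENNReal.ofReal_mul
    (p := T ^ oneSubDivPos p β * t ^ minOneDiv p β * ((Iplus ν p).toReal + Iprime ν β))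
    (by positivity), ENNReal.ofReal_sum_of_nonneg hs]
  congr 1
  refine Finset.sum_congr rfl fun k _ => ?_
  rw [mul_assoc, ← mul_pow, ENNReal.ofReal_mul (Nat.cast_nonneg _), ENNReal.ofReal_natCast,
    ENNReal.ofReal_pow (by positivity)]

/-- The contribution of the compensated jumps below the cutoff level. -/
lemma martingaleBound_cutoffLevel_le (hT : 0 < T) (ht : 0 < t) (htT : t ≤ T) (hβ : 0 ≤ β)
    (hβ2 : β ≤ 2) (hIβ : I0 ν β < ∞) {p : ℝ} (hp : 0 < p) :
    martingaleBound p (cutoffLevel β T t)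
      (t * ∫ x in Set.Ioo (-cutoffLevel β T t) (cutoffLevel β T t), x ^ 2 ∂ν) ≤
      if β = 0 then 0 else T ^ (-(p / β)) *
        (if p ≤ 2 then 2 ^ p * T ^ (p / 2) * (I0 ν β).toReal ^ (p / 2)
          else 2 * (p ^ 2 / (p - 1)) ^ p * Real.exp (T * (I0 ν β).toReal - p)) * t ^ (p / β) := by
  by_cases hβ0 : β = 0
  · rw [if_pos hβ0, cutoffLevel, if_pos hβ0, neg_zero, Set.Ioo_self]
    unfold martingaleBound
    have hp2 : p / 2 ≠ 0 := by positivity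
    simp [hp.ne', hp2]
  rw [if_neg hβ0]
  set h := cutoffLevel β T t with hh
  have hh0 : 0 < h := cutoffLevel_pos hT ht hβ0
  set A := (I0 ν β).toReal with hA
  have hA0 : 0 ≤ A := ENNReal.toReal_nonneg
  have hw : t * ∫ x in Set.Ioo (-h) h, x ^ 2 ∂ν ≤ T * h ^ (2 : ℝ) * A := by
    rw [setIntegral_sq_eq, ← mul_cutoffLevel_rpow_sub hT ht hβ0, ← hh, mul_assoc]
    refine mul_le_mul_of_nonneg_left ?_ ht.le
    have h1 := ENNReal.toReal_mono (ENNReal.mul_ne_top ENNReal.ofReal_ne_top hIβ.ne)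
      (absMoment_Ioo_le (ν := ν) hβ hβ2 (cutoffLevel_le_one hT ht htT hβ))
    rwa [ENNReal.toReal_mul, ENNReal.toReal_ofReal (by positivity)] at h1
  refine (martingaleBound_mono hp hh0.le
    (mul_nonneg ht.le (integral_nonneg fun x => sq_nonneg x)) hw).trans_eq ?_
  have hhp : T ^ (-(p / β)) * t ^ (p / β) = h ^ p := by
    rw [hh, cutoffLevel_rpow hT ht hβ0, Real.div_rpow ht.le hT.le, Real.rpow_neg hT.le]
    field_simp
  rw [mul_right_comm (T ^ (-(p / β))), hhp, martingaleBound]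
  split_ifs with hp2
  · have h4 : (4 : ℝ) ^ (p / 2) = 2 ^ p := by
      rw [show (4 : ℝ) = 2 ^ (2 : ℝ) by norm_num, ← Real.rpow_mul (by norm_num)]
      congr 1
      ring
    rw [Real.mul_rpow (by norm_num) (by positivity), Real.mul_rpow (by positivity) hA0,
      Real.mul_rpow hT.le (by positivity), ← Real.rpow_mul hh0.le, h4,
      show (2 : ℝ) * (p / 2) = p by ring]
    ring
  · congr 4
    rw [Real.rpow_two]
    field_simp

lemma gaussianMoment_mul_sq (σ : ℝ) (ht : 0 ≤ t) (p : ℝ) :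
    gaussianMoment p (t * σ ^ 2) = C₂ σ p * t ^ (p / 2) := by
  have : (σ ^ 2) ^ (p / 2) = |σ| ^ p := by
    rw [← sq_abs, ← Real.rpow_natCast, ← Real.rpow_mul (abs_nonneg σ)]
    congr 1
    push_cast
    ring
  rw [gaussianMoment, C₂, Real.mul_rpow ht (sq_nonneg σ), this]
  ring

/-- The drift left after compensation of the jumps below the cutoff level `h` differs little from
`b` if `β > 1`, by the integral of `x` over `h ≤ |x| < 1`, and little from the natural drift if
`β ≤ 1`, by the integral of `x` over `|x| < h`. -/
lemma exists_tendsto_truncDrift (hT : 0 < T) (ht : 0 < t) (htT : t ≤ T) (hβ : 0 ≤ β)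
    (hIβ : I0 ν β < ∞) (h1β : I0 ν 1 = ∞ ↔ 1 < β) (b : ℝ) :
    ∃ D, Tendsto (truncDrift ν b (cutoffLevel β T t)) atTop (𝓝 D) ∧
      t * D ≤ t * (if 1 < β then max b 0 else max (natDrift ν b) 0) +
        if β = 0 then 0 else T * cutoffLevel β T t * (I0 ν β).toReal := by
  set h := cutoffLevel β T t with hh
  have hh0 : 0 ≤ h := cutoffLevel_nonneg hT ht
  have hh1 : h ≤ 1 := cutoffLevel_le_one hT ht htT hβ
  set S : Set ℝ := {x | h ≤ |x| ∧ |x| < 1} with hS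
  have hSm : MeasurableSet S := measurableSet_annulus h 1
  have hSsub : S ⊆ Set.Ioo (-1) 1 := fun x hx => abs_lt.1 hx.2
  have hc : 0 < h ∨ β ≤ 1 := by
    rcases eq_or_ne β 0 with rfl | hβ0
    · exact Or.inr zero_le_one
    · exact Or.inl (cutoffLevel_pos hT ht hβ0)
  have hS1 : absMoment ν S 1 ≤ ENNReal.ofReal (h ^ (-max (β - 1) 0)) * I0 ν β := by
    refine (absMoment_le_of_le_abs hβ hh0 hSm (fun x hx => hx) hc).trans ?_
    gcongr
    exact absMoment_mono_set hSsub β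
  have hS1' : absMoment ν S 1 < ∞ :=
    hS1.trans_lt (ENNReal.mul_lt_top ENNReal.ofReal_lt_top hIβ)
  refine ⟨_, tendsto_truncDrift (integrableOn_id_of_absMoment_lt_top hS1') b, ?_⟩
  change t * (b - ∫ x in S, x ∂ν) ≤ _
  by_cases hβ1 : 1 < β
  · have hβ0 : β ≠ 0 := by linarith
    rw [if_pos hβ1, if_neg hβ0, mul_sub]
    have h2 : t * (absMoment ν S 1).toReal ≤ T * h * (I0 ν β).toReal := by
      have h3 := ENNReal.toReal_mono (ENNReal.mul_ne_top ENNReal.ofReal_ne_top hIβ.ne) hS1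
      rw [ENNReal.toReal_mul, ENNReal.toReal_ofReal (by positivity), max_eq_left (by linarith),
        neg_sub] at h3
      have h4 := mul_cutoffLevel_rpow_sub hT ht hβ0 1
      rw [Real.rpow_one, ← hh] at h4
      rw [← h4, mul_assoc]
      exact mul_le_mul_of_nonneg_left h3 ht.le
    have h5 := abs_le.1 (abs_setIntegral_id_le (ν := ν) S)
    have h6 := le_max_left b 0
    nlinarith
  · have hfin : absMoment ν (Set.Ioo (-1) 1) 1 < ∞ :=
      lt_top_iff_ne_top.2 fun e => hβ1 (h1β.1 e)
    have hsplit : ∫ x in Set.Ioo (-1 : ℝ) 1, x ∂ν =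
        (∫ x in S, x ∂ν) + ∫ x in Set.Ioo (-h) h, x ∂ν := by
      have hsub : Set.Ioo (-h) h ⊆ Set.Ioo (-1) 1 := Set.Ioo_subset_Ioo (by linarith) hh1
      rw [← setIntegral_union _ measurableSet_Ioo
        (integrableOn_id_of_absMoment_lt_top hS1') (integrableOn_id_of_absMoment_lt_top
          ((absMoment_mono_set hsub 1).trans_lt hfin))]
      · congr 2
        ext x
        refine ⟨fun hx => ?_, fun hx => hx.elim (fun hx => hSsub hx) fun hx => hsub hx⟩
        rcases le_or_gt h |x| with h1 | h1
        · exact Or.inl ⟨h1, abs_lt.2 hx⟩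
        · exact Or.inr (abs_lt.1 h1)
      · exact Set.disjoint_left.2 fun x hx hx' => absurd (abs_lt.2 hx') (not_lt.2 hx.1)
    have hD : b - ∫ x in S, x ∂ν = natDrift ν b + ∫ x in Set.Ioo (-h) h, x ∂ν := by
      rw [natDrift, hsplit]
      ring
    rw [hD, if_neg hβ1, mul_add]
    have h6 := le_max_left (natDrift ν b) 0
    refine add_le_add (mul_le_mul_of_nonneg_left h6 ht.le) ?_
    split_ifs with hβ0
    · have : h = 0 := by rw [hh, cutoffLevel, if_pos hβ0]
      simp [this]
    · have h3 := ENNReal.toReal_mono (ENNReal.mul_ne_top ENNReal.ofReal_ne_top hIβ.ne)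
        (absMoment_Ioo_le (ν := ν) hβ (not_lt.1 hβ1) hh1)
      rw [ENNReal.toReal_mul, ENNReal.toReal_ofReal (by positivity)] at h3
      have h4 := mul_cutoffLevel_rpow_sub hT ht hβ0 1
      rw [Real.rpow_one, ← hh] at h4
      rw [← h4, mul_assoc]
      exact mul_le_mul_of_nonneg_left
        (((le_abs_self _).trans (abs_setIntegral_id_le _)).trans h3) ht.le

end Terms

/-! ### The bounds on the moments and on the mean -/

section MomentBounds

lemma ennreal_add_rpow_le (x y : ℝ≥0∞) {p : ℝ} (hp : 0 < p) :
    (x + y) ^ p ≤ 2 ^ max (p - 1) 0 * (x ^ p + y ^ p) := by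
  rcases le_total p 1 with h | h
  · rw [max_eq_right (by linarith), ENNReal.rpow_zero, one_mul]
    exact ENNReal.rpow_add_le_add_rpow x y hp.le h
  · rw [max_eq_left (by linarith)]
    exact ENNReal.rpow_add_le_mul_rpow_add_rpow x y h

variable {ν : Measure ℝ} {β T t : ℝ}

/-- The contribution of the drift to the bound on the `p`-th moment. -/
lemma ofReal_drift_rpow_le (hT : 0 < T) (ht : 0 < t) {p B D : ℝ} (hp : 0 < p) (hB : 0 ≤ B)
    (hD : t * D ≤ t * B + if β = 0 then 0 else T * cutoffLevel β T t * (I0 ν β).toReal) :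
    ENNReal.ofReal (t * D) ^ p ≤ ENNReal.ofReal
      (2 ^ max (p - 1) 0 * B ^ p * t ^ p + if β = 0 then 0 else
        2 ^ max (p - 1) 0 * T ^ (p - p / β) * (I0 ν β).toReal ^ p * t ^ (p / β)) := by
  set A := (I0 ν β).toReal with hA
  have hA0 : 0 ≤ A := ENNReal.toReal_nonneg
  by_cases hβ0 : β = 0
  · rw [if_pos hβ0, add_zero] at hD ⊢
    rw [mul_assoc, ← Real.mul_rpow hB ht.le]
    refine (ENNReal.rpow_le_rpow (ENNReal.ofReal_le_ofReal hD) hp.le).trans ?_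
    rw [ENNReal.ofReal_rpow_of_nonneg (by positivity) hp.le, mul_comm t B]
    refine ENNReal.ofReal_le_ofReal (le_mul_of_one_le_left (by positivity) ?_)
    exact Real.one_le_rpow one_le_two (le_max_right _ _)
  · rw [if_neg hβ0] at hD ⊢
    have hh := cutoffLevel_nonneg (β := β) hT ht
    have e : T ^ (p - p / β) * A ^ p * t ^ (p / β) = (T * cutoffLevel β T t * A) ^ p := by
      rw [Real.mul_rpow (by positivity) hA0, Real.mul_rpow hT.le hh, cutoffLevel_rpow hT ht hβ0,
        Real.div_rpow ht.le hT.le, Real.rpow_sub hT]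
      ring
    calc _ ≤ (ENNReal.ofReal (t * B) + ENNReal.ofReal (T * cutoffLevel β T t * A)) ^ p := by
          rw [← ENNReal.ofReal_add (by positivity) (by positivity)]
          gcongr
      _ ≤ _ := ennreal_add_rpow_le _ _ hp
      _ = _ := by
          have e2 : 2 ^ max (p - 1) 0 * B ^ p * t ^ p +
              2 ^ max (p - 1) 0 * T ^ (p - p / β) * A ^ p * t ^ (p / β) =
              2 ^ max (p - 1) 0 * ((t * B) ^ p + (T * cutoffLevel β T t * A) ^ p) := by
            rw [← e, Real.mul_rpow ht.le hB]
            ring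
          rw [e2, ENNReal.ofReal_mul (p := (2 : ℝ) ^ max (p - 1) 0) (by positivity),
            ENNReal.ofReal_add (by positivity) (by positivity),
            ← ENNReal.ofReal_rpow_of_pos two_pos, ENNReal.ofReal_ofNat,
            ENNReal.ofReal_rpow_of_nonneg (by positivity) hp.le,
            ENNReal.ofReal_rpow_of_nonneg (by positivity) hp.le]

lemma C₁_nonneg (ν : Measure ℝ) (hT : 0 ≤ T) (β p : ℝ) : 0 ≤ C₁ ν T β p := by
  have hA : 0 ≤ (I0 ν β).toReal := ENNReal.toReal_nonneg
  unfold C₁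
  split_ifs with hp2
  · positivity
  · have : 0 < p - 1 := by linarith
    positivity

lemma C₂_nonneg (σ : ℝ) {p : ℝ} (hp : 0 < p) : 0 ≤ C₂ σ p := by
  have := Real.Gamma_pos_of_pos (show 0 < (p + 1) / 2 by positivity)
  unfold C₂
  positivity

lemma C₃_nonneg (ν : Measure ℝ) (b p : ℝ) : 0 ≤ C₃ ν b p := by
  unfold C₃
  split_ifs <;> positivity

lemma C₄_nonneg (ν : Measure ℝ) (hT : 0 ≤ T) (β p : ℝ) : 0 ≤ C₄ ν T β p := by
  have h1 : 0 ≤ Iprime ν β := ENNReal.toReal_nonneg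
  unfold C₄
  refine mul_nonneg (by positivity) (Finset.sum_nonneg fun k _ => by positivity)

lemma momentBound_nonneg (σ : ℝ) (ν : Measure ℝ) (b : ℝ) (hT : 0 ≤ T) (β : ℝ) {p : ℝ} (hp : 0 < p)
    (ht : 0 ≤ t) : 0 ≤ momentBound σ ν b T β p t := by
  have h1 := C₁_nonneg ν hT β p
  have h2 := C₂_nonneg σ hp
  have h3 := C₃_nonneg ν b p
  have h4 := C₄_nonneg ν hT β p
  unfold momentBound
  split_ifs <;> positivity

lemma meanBound_nonneg (σ : ℝ) (ν : Measure ℝ) (b : ℝ) (hT : 0 ≤ T) (β : ℝ) (ht : 0 ≤ t) :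
    0 ≤ meanBound σ ν b T β t := by
  have h1 : 0 ≤ (I0 ν β).toReal := ENNReal.toReal_nonneg
  have h2 : 0 ≤ (Iplus ν 1).toReal := ENNReal.toReal_nonneg
  have h3 : 0 ≤ (absMoment ν (Set.Ioi 0) 1).toReal := ENNReal.toReal_nonneg
  unfold meanBound
  split_ifs <;> positivity

lemma cutoffBound_le_momentBound (σ : ℝ) (hν : IsLevyMeasure ν) (b : ℝ) (hT : 0 < T) (ht : 0 < t)
    (htT : t ≤ T) (hβ : 0 ≤ β) (hβ2 : β ≤ 2) (hIβ : I0 ν β < ∞) (h1β : I0 ν 1 = ∞ ↔ 1 < β)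
    {p D : ℝ} (hp : 0 < p) (hIp : Iplus ν p < ∞)
    (hD : t * D ≤ t * (if 1 < β then max b 0 else max (natDrift ν b) 0) +
      if β = 0 then 0 else T * cutoffLevel β T t * (I0 ν β).toReal) :
    cutoffBound σ ν p (cutoffLevel β T t) D t ≤ ENNReal.ofReal (momentBound σ ν b T β p t) := by
  have hB : 0 ≤ if 1 < β then max b 0 else max (natDrift ν b) 0 := by split_ifs <;> positivity
  have k1 := ofReal_drift_rpow_le hT ht hp hB hD
  have k2 := martingaleBound_cutoffLevel_le hT ht htT hβ hβ2 hIβ hp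
  have k3 := (gaussianMoment_mul_sq σ ht.le p).le
  have k4 := jumpBound_cutoffLevel_le hν hT ht htT hβ hIβ hp hIp
  have n1 := C₁_nonneg ν hT.le β p
  have n2 := C₂_nonneg σ hp
  have n3 := C₃_nonneg ν b p
  have n4 := C₄_nonneg ν hT.le β p
  have e3 : 2 ^ max (p - 1) 0 * (if 1 < β then max b 0 else max (natDrift ν b) 0) ^ p =
      C₃ ν b p := by
    rw [C₃]
    congr 2
    exact if_congr h1β.symm rfl rfl
  rw [e3] at k1
  have hA : 0 ≤ (I0 ν β).toReal := ENNReal.toReal_nonneg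
  have m1 : 0 ≤ (if β = 0 then 0 else 2 ^ max (p - 1) 0 * T ^ (p - p / β) *
      (I0 ν β).toReal ^ p * t ^ (p / β) : ℝ) := by split_ifs <;> positivity
  have m2 : 0 ≤ (if β = 0 then 0 else T ^ (-(p / β)) *
        (if p ≤ 2 then 2 ^ p * T ^ (p / 2) * (I0 ν β).toReal ^ (p / 2)
          else 2 * (p ^ 2 / (p - 1)) ^ p * Real.exp (T * (I0 ν β).toReal - p)) * t ^ (p / β)) :=
    (martingaleBound_nonneg (cutoffLevel_nonneg hT ht)
      (mul_nonneg ht.le (integral_nonneg fun x => sq_nonneg x))).trans k2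
  rw [cutoffBound, momentBound,
    ENNReal.ofReal_mul (p := (4 : ℝ) ^ max (p - 1) 0) (by positivity),
    ← ENNReal.ofReal_rpow_of_pos (by norm_num), ENNReal.ofReal_ofNat]
  refine mul_le_mul_right ?_ _
  refine (add_le_add (add_le_add (add_le_add k1 (ENNReal.ofReal_le_ofReal k2))
    (ENNReal.ofReal_le_ofReal k3)) k4).trans_eq ?_
  rw [← ENNReal.ofReal_add (by positivity) m2, ← ENNReal.ofReal_add (by positivity) (by positivity),
    ← ENNReal.ofReal_add (by positivity) (by positivity)]
  congr 1
  by_cases hβ0 : β = 0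
  · simp only [if_pos hβ0]
    ring
  · simp only [if_neg hβ0, C₁]
    ring

lemma jumpBound_one (a q : ℝ≥0∞) : jumpBound 1 a q = a := by
  simp [jumpBound, Nat.stirlingSecond]

lemma gaussianMoment_one (σ : ℝ) (ht : 0 ≤ t) :
    gaussianMoment 1 (t * σ ^ 2) = |σ| * √(2 / Real.pi) * √t := by
  rw [gaussianMoment_mul_sq σ ht, C₂, ← Real.sqrt_eq_rpow, ← Real.sqrt_eq_rpow,
    Real.sqrt_div' _ Real.pi_pos.le]
  simp

lemma martingaleBound_one (h w : ℝ) : martingaleBound 1 h w = 2 * √w := by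
  rw [martingaleBound, if_pos one_le_two, ← Real.sqrt_eq_rpow, Real.sqrt_mul (by norm_num),
    show (4 : ℝ) = 2 ^ 2 by norm_num, Real.sqrt_sq two_pos.le]

lemma cutoffBound_one (σ : ℝ) (ν : Measure ℝ) {h : ℝ} (hh : 0 ≤ h) (D : ℝ) (ht : 0 ≤ t) :
    cutoffBound σ ν 1 h D t = ENNReal.ofReal (t * D) +
      ENNReal.ofReal (2 * √(t * ∫ x in Set.Ioo (-h) h, x ^ 2 ∂ν)) +
      ENNReal.ofReal (|σ| * √(2 / Real.pi) * √t) +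
      ENNReal.ofReal t * absMoment ν (Set.Ici h ∩ Set.Ioi 0) 1 := by
  rw [cutoffBound, jumpBound_one, gaussianMoment_one σ ht, martingaleBound_one,
    lintegral_Ici_ofReal_rpow one_pos hh]
  simp

/-- A cutoff level and a drift for which the bound on the mean holds. For `β = 2` all jumps in
`(-1, 1)` are compensated, for `β ≤ 1` none is, and in between those below `cutoffLevel β T t`
are. -/
lemma exists_cutoffBound_one_le_meanBound (σ b : ℝ) (hT : 0 < T)
    (ht : 0 < t) (htT : t ≤ T) (hβ : 0 ≤ β) (hβ2 : β ≤ 2) (hIβ : I0 ν β < ∞)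
    (h1β : I0 ν 1 = ∞ ↔ 1 < β) (hI1 : Iplus ν 1 < ∞) :
    ∃ h D, 0 ≤ h ∧ h ≤ 1 ∧ Tendsto (truncDrift ν b h) atTop (𝓝 D) ∧
      cutoffBound σ ν 1 h D t ≤ ENNReal.ofReal (meanBound σ ν b T β t) := by
  have hJ : 0 ≤ (Iplus ν 1).toReal := ENNReal.toReal_nonneg
  have hA : 0 ≤ (I0 ν β).toReal := ENNReal.toReal_nonneg
  rcases le_or_gt β 1 with hβ1 | hβ1
  · have hfin : absMoment ν (Set.Ioo (-1) 1) 1 < ∞ :=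
      lt_top_iff_ne_top.2 fun e => absurd (h1β.1 e) (not_lt.2 hβ1)
    have hS : {x : ℝ | 0 ≤ |x| ∧ |x| < 1} = Set.Ioo (-1) 1 := by
      ext x
      simp [abs_lt]
    have hD := tendsto_truncDrift (ν := ν) (h := 0)
      (by rw [hS]; exact integrableOn_id_of_absMoment_lt_top hfin) b
    rw [hS] at hD
    refine ⟨0, _, le_rfl, zero_le_one, hD, ?_⟩
    have hpos : absMoment ν (Set.Ioi 0) 1 ≠ ∞ := by
      refine ne_top_of_le_ne_top (ENNReal.add_ne_top.2 ⟨hfin.ne, hI1.ne⟩)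
        ((absMoment_mono_set (fun x hx => ?_) 1).trans (lintegral_union_le _ _ _))
      have hx : 0 < x := hx
      rcases lt_or_ge x 1 with h1 | h1
      · exact Or.inl ⟨by linarith, h1⟩
      · exact Or.inr h1
    have hI : Set.Ici (0 : ℝ) ∩ Set.Ioi 0 = Set.Ioi 0 :=
      Set.inter_eq_right.2 Set.Ioi_subset_Ici_self
    rw [cutoffBound_one σ ν le_rfl _ ht.le, neg_zero, Set.Ioo_self, hI,
      ← ENNReal.ofReal_toReal hpos, ← ENNReal.ofReal_mul ht.le, meanBound,
      if_neg (by linarith), if_neg (not_lt.2 hβ1)]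
    have hp0 : 0 ≤ (absMoment ν (Set.Ioi 0) 1).toReal := ENNReal.toReal_nonneg
    have h2 : ENNReal.ofReal (t * natDrift ν b) ≤ ENNReal.ofReal (t * max (natDrift ν b) 0) := by
      gcongr
      exact le_max_left _ _
    change ENNReal.ofReal (t * natDrift ν b) + _ + _ + _ ≤ _
    rw [Measure.restrict_empty, integral_zero_measure, mul_zero, Real.sqrt_zero, mul_zero,
      ENNReal.ofReal_zero, add_zero]
    refine (add_le_add_left (add_le_add_left h2 _) _).trans_eq ?_
    rw [← ENNReal.ofReal_add (by positivity) (by positivity),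
      ← ENNReal.ofReal_add (by positivity) (by positivity)]
    congr 1
    ring
  rcases hβ2.eq_or_lt with rfl | hβ2'
  · have hS : {x : ℝ | 1 ≤ |x| ∧ |x| < 1} = ∅ := by
      ext x
      simp
    have hD := tendsto_truncDrift (ν := ν) (h := 1) (by rw [hS]; exact integrableOn_empty) b
    rw [hS, Measure.restrict_empty, integral_zero_measure, sub_zero] at hD
    refine ⟨1, b, zero_le_one, le_rfl, hD, ?_⟩
    have hI : Set.Ici (1 : ℝ) ∩ Set.Ioi 0 = Set.Ici 1 :=
      Set.inter_eq_left.2 fun x hx => show (0 : ℝ) < x from lt_of_lt_of_le one_pos hx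
    have h2 : ENNReal.ofReal (t * b) ≤ ENNReal.ofReal (t * max b 0) := by
      gcongr
      exact le_max_left _ _
    rw [cutoffBound_one σ ν zero_le_one _ ht.le, hI, setIntegral_sq_eq]
    change _ + ENNReal.ofReal (2 * √(t * (I0 ν 2).toReal)) + _ + ENNReal.ofReal t * Iplus ν 1 ≤ _
    rw [← ENNReal.ofReal_toReal hI1.ne, ← ENNReal.ofReal_mul ht.le, meanBound, if_pos rfl]
    refine (add_le_add_left (add_le_add_left (add_le_add_left h2 _) _) _).trans_eq ?_
    rw [← ENNReal.ofReal_add (by positivity) (by positivity),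
      ← ENNReal.ofReal_add (by positivity) (by positivity),
      ← ENNReal.ofReal_add (by positivity) (by positivity), Real.sqrt_mul ht.le]
    congr 1
    ring
  · have hβ0 : β ≠ 0 := by linarith
    obtain ⟨D, hD, hDt⟩ := exists_tendsto_truncDrift hT ht htT hβ hIβ h1β b
    set h := cutoffLevel β T t with hh
    have hh0 : 0 < h := cutoffLevel_pos hT ht hβ0
    refine ⟨h, D, hh0.le, cutoffLevel_le_one hT ht htT hβ, hD, ?_⟩
    rw [if_pos hβ1, if_neg hβ0] at hDt
    have k2 := martingaleBound_cutoffLevel_le hT ht htT hβ hβ2 hIβ one_pos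
    rw [martingaleBound_one, if_neg hβ0, if_pos one_le_two, Real.rpow_one, ← Real.sqrt_eq_rpow,
      ← Real.sqrt_eq_rpow, ← hh] at k2
    have k4 : ENNReal.ofReal t * absMoment ν (Set.Ici h ∩ Set.Ioi 0) 1 ≤
        ENNReal.ofReal (t * (Iplus ν 1).toReal + T * h * (I0 ν β).toReal) := by
      have hI' : Iprime ν β ≤ (I0 ν β).toReal := ENNReal.toReal_mono hIβ.ne
        (absMoment_mono_set (Set.Ioo_subset_Ioo (by norm_num) le_rfl) β)
      have hI'0 : 0 ≤ Iprime ν β := ENNReal.toReal_nonneg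
      have h1 := absMoment_Ici_inter_Ioi_le (p := 1) hβ hh0.le hIβ (Or.inl hh0)
      rw [max_eq_left (by linarith), neg_sub] at h1
      have h4 := mul_cutoffLevel_rpow_sub hT ht hβ0 1
      rw [Real.rpow_one, ← hh] at h4
      calc _ ≤ ENNReal.ofReal t * (Iplus ν 1 + ENNReal.ofReal (h ^ (1 - β) * Iprime ν β)) := by
            gcongr
        _ = ENNReal.ofReal (t * ((Iplus ν 1).toReal + h ^ (1 - β) * Iprime ν β)) := by
            rw [ENNReal.ofReal_mul ht.le, ENNReal.ofReal_add hJ (by positivity),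
              ENNReal.ofReal_toReal hI1.ne]
        _ ≤ _ := by
            refine ENNReal.ofReal_le_ofReal ?_
            rw [mul_add, ← mul_assoc, h4]
            gcongr
    rw [cutoffBound_one σ ν hh0.le _ ht.le, meanBound, if_neg hβ2'.ne, if_pos hβ1]
    refine (add_le_add (add_le_add (add_le_add (ENNReal.ofReal_le_ofReal hDt)
      (ENNReal.ofReal_le_ofReal k2)) le_rfl) k4).trans_eq ?_
    rw [← ENNReal.ofReal_add (by positivity) (by positivity),
      ← ENNReal.ofReal_add (by positivity) (by positivity),
      ← ENNReal.ofReal_add (by positivity) (by positivity), Real.sqrt_mul hT.le]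
    have hhe : h = T ^ (-(1 / β)) * t ^ (1 / β) := by
      rw [hh, cutoffLevel, if_neg hβ0, Real.div_rpow ht.le hT.le, Real.rpow_neg hT.le]
      field_simp
    rw [hhe]
    congr 1
    ring

lemma runSup_zero {Ω : Type*} (X : ℝ≥0 → Ω → ℝ) : runSup X 0 = X 0 := by
  ext ω
  have : Unique (Set.Icc (0 : ℝ≥0) 0) := by rw [Set.Icc_self]; infer_instance
  rw [runSup, ciSup_unique]
  congr 1
  exact le_antisymm (default : Set.Icc (0 : ℝ≥0) 0).2.2 zero_le

lemma lintegral_runSup_zero_rpow {Ω : Type*} [MeasurableSpace Ω] {P : Measure Ω}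
    {X : ℝ≥0 → Ω → ℝ} (hX : IsLevyProcess X P) {p : ℝ} (hp : 0 < p) :
    ∫⁻ ω, ENNReal.ofReal (runSup X 0 ω) ^ p ∂P = 0 := by
  rw [lintegral_congr_ae (g := 0), Pi.zero_def, lintegral_zero]
  filter_upwards [hX.zero] with ω hω
  simp [runSup_zero, hω, hp]

end MomentBounds

end LevySup

theorem mainTheorem3 {Ω : Type*} [MeasurableSpace Ω] (P : Measure Ω) [IsProbabilityMeasure P]
    (X : ℝ≥0 → Ω → ℝ) (σ : ℝ) (ν : Measure ℝ) (b : ℝ)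
    (hX : LevySup.IsLevyProcess X P) (hT : LevySup.HasTriplet X P σ ν b)
    (δ : ℝ)
    (hδ : LevySup.I0 ν (LevySup.bgIndex ν) = ∞ →
      0 < δ ∧ δ < 2 - LevySup.bgIndex ν ∧
        (LevySup.bgIndex ν < 1 → LevySup.bgIndex ν + δ < 1))
    (T : ℝ≥0) (hTpos : 0 < T) (t : ℝ≥0) (htT : t ≤ T) :
    (∀ p : ℝ, 0 < p → LevySup.Iplus ν p < ∞ →
      Integrable (fun ω => LevySup.runSup X t ω ^ p) P ∧
        ∫ ω, LevySup.runSup X t ω ^ p ∂P ≤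
          LevySup.momentBound σ ν b T (LevySup.bgIndexPlus ν δ) p t) ∧
    (LevySup.Iplus ν 1 < ∞ →
      Integrable (LevySup.runSup X t) P ∧
        ∫ ω, LevySup.runSup X t ω ∂P ≤
          LevySup.meanBound σ ν b T (LevySup.bgIndexPlus ν δ) t) := by
  have hν := hT.isLevyMeasure
  have hT0 : (0 : ℝ) < T := hTpos
  have htT' : (t : ℝ) ≤ T := htT
  have hβ := LevySup.bgIndexPlus_nonneg hδ
  have hβ2 := LevySup.bgIndexPlus_le_two hν hδ
  have hIβ := LevySup.I0_bgIndexPlus_lt_top hν hδ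
  have h1β := LevySup.I0_one_eq_top_iff hν hδ
  refine ⟨fun p hp hIp => ?_, fun hI1 => ?_⟩
  · refine LevySup.integrable_runSup_rpow_and_integral_le hX t hp
      (LevySup.momentBound_nonneg σ ν b hT0.le _ hp t.coe_nonneg) ?_
    rcases eq_or_ne t 0 with rfl | ht
    · rw [LevySup.lintegral_runSup_zero_rpow hX hp]
      exact zero_le
    · have ht0 : (0 : ℝ) < t := NNReal.coe_pos.2 (pos_iff_ne_zero.2 ht)
      obtain ⟨D, hD, hDt⟩ := LevySup.exists_tendsto_truncDrift hT0 ht0 htT' hβ hIβ h1β b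
      exact (LevySup.lintegral_runSup_rpow_le hX hT hp (LevySup.cutoffLevel_nonneg hT0 ht0)
        (LevySup.cutoffLevel_le_one hT0 ht0 htT' hβ) hD t).trans
          (LevySup.cutoffBound_le_momentBound σ hν b hT0 ht0 htT' hβ hβ2 hIβ h1β hp hIp hDt)
  · have key : ∫⁻ ω, ENNReal.ofReal (LevySup.runSup X t ω) ^ (1 : ℝ) ∂P ≤
        ENNReal.ofReal (LevySup.meanBound σ ν b T (LevySup.bgIndexPlus ν δ) t) := by
      rcases eq_or_ne t 0 with rfl | ht
      · rw [LevySup.lintegral_runSup_zero_rpow hX one_pos]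
        exact zero_le
      · have ht0 : (0 : ℝ) < t := NNReal.coe_pos.2 (pos_iff_ne_zero.2 ht)
        obtain ⟨h, D, hh0, hh1, hD, hle⟩ := LevySup.exists_cutoffBound_one_le_meanBound σ b hT0
          ht0 htT' hβ hβ2 hIβ h1β hI1
        exact (LevySup.lintegral_runSup_rpow_le hX hT one_pos hh0 hh1 hD t).trans hle
    simpa only [Real.rpow_one] using LevySup.integrable_runSup_rpow_and_integral_le hX t one_pos
      (LevySup.meanBound_nonneg σ ν b hT0.le _ t.coe_nonneg) key
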